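/- **Conventions.** $\mathrm{Par}_r$ is the set of partitions $\nu=(\nu_1\ge\nu_2\ge\cdots\ge 0)$ with at most $r$ nonzero parts ($\nu_i=0$ for $i>r$), $|\nu|=\sum_i\nu_i$, and $\delta_r=(r-1,r-2,\dots,1,0)$. For $\nu\in\mathrm{Par}_r$ let $a_{\nu+\delta_r}(x_1,\dots,x_r)=\det\big(x_i^{\nu_j+r-j}\big)_{i,j=1}^r$. For $0<q<1$ put $\int_a^b f(x)\,d_qx=(1-q)\sum_{i\ge0}\big(f(bq^i)bq^i-f(aq^i)aq^i\big)$ and $\int_{0\le x_1\le\cdots\le x_r\le1}f\,d_qx_1\cdots d_qx_r=\int_0^1\int_0^{x_r}\cdots\int_0^{x_2}f\,d_qx_1\cdots d_qx_r$. For $\nu\in\mathrm{Par}_r$, the shifted Young poset $(\nu+\delta_{r+1})^*$ has the cells $(a,b)$ with $1\le a\le r$ and $a\le b\le \nu_a+r$, where $u\le v$ if $u$ is weakly below and weakly to the right of $v$. For a finite family $X=\{(\lambda^{(i)},n_i,s_i)\}$ with $n_i,s_i\ge 1$, $s_i+n_i-1\le N$ and $\lambda^{(i)}\in\mathrm{Par}_{n_i}$,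 the poset $P_N^m(X)$ is obtained from a chain $x_1<\dots<x_N$ by gluing to it, for every $i$, the poset $(\lambda^{(i)}+\delta_{n_i+1})^*$, whose diagonal cells $(1,1),(2,2),\dots,(n_i,n_i)$ are identified with $x_{s_i+n_i-1},\dots,x_{s_i+1},x_{s_i}$ respectively, and by attaching a chain of $m$ further elements above $x_N$; its order is the one generated by these relations. For $k\ge3$, $d_k(1)$ is the poset with $2k-2$ elements consisting of a chain of $k-2$ elements (the tail), two incomparable elements above all of these, and a chain of $k-2$ elements (the neck) above all of these. A $d_k$-interval of a poset is an interval isomorphic to $d_k(1)$. The hook length $h(z)$ of an element $z$ of a finite poset is given recursively as follows. If $z$ is in the neck of no $d_k$-interval ($k\ge3$), then $h(z)$ is the number of elements $\le z$. If $[w,z]$ is a $d_k$-interval with incomparable elements $x,y$, then $h(z)=h(x)+h(y)-h(w)$. A finite poset $P$ has the hook length property if these rules define a unique function $h:P\to\mathbb N$ and $$\sum_{\sigma}q^{\sum_{z\in P}\sigma(z)}=\prod_{z\in P}\frac1{1-q^{h(z)}}\qquad(0<q<1),$$ where $\sigma$ runs over all order-reversing maps $P\to\mathbb N=\{0,1,2,\dots\}$.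 **Theorem.** Let $n\ge2$, $k\ge0$, $\lambda\in\mathrm{Par}_{n-1}$, $\mu\in\mathrm{Par}_{n+1}$. (a) The poset $P_{n+1}^{\lambda_1+n-2}(X_4)$ of class 4 (insets), where $X_4=\{(\lambda,n-1,1),(\mu,n+1,1),((k),1,n)\}$, has the hook length property. (b) For all $0<q<1$, $$\int_{0\le x_1\le\cdots\le x_{n+1}\le1}x_n^k\,a_{\lambda+\delta_{n-1}}(x_1,\dots,x_{n-1})\,a_{\mu+\delta_{n+1}}(x_1,\dots,x_{n+1})\,d_qx_1\cdots d_qx_{n+1}$$ $$=\frac{-q^{\sum_{i=1}^n((i+1)\lambda_i+i\mu_{i+1})+\frac16n(n-1)(2n+5)+1+k}(1-q)^{n+1}}{\prod_{i=1}^{n+1}\big(1-q^{|\lambda|+|\mu|-\mu_i+n(n-1)+k+i}\big)}\cdot\frac{\prod_{j=1}^{n-1}\big(1-q^{|\lambda|+|\mu|+\lambda_j+n^2+n-j+k+1}\big)}{1-q^{|\lambda|+|\mu|+n^2+k+2}}$$ $$\times\frac{\prod_{1\le i<j\le n+1}\big(1-q^{\mu_i-\mu_j+j-i}\big)\prod_{1\le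 i<j\le n-1}\big(1-q^{\lambda_i-\lambda_j+j-i}\big)}{\prod_{1\le i\le n+1,\ 1\le j\le n-1}\big(1-q^{\mu_i+\lambda_j+2n-i-j+1}\big)}.$$ -/

import Mathlib

open scoped BigOperators

namespace HookInsets

/-! ### Partitions -/

/-- A partition of length at most `n`, as a weakly decreasing sequence that vanishes from index `n`
on.  Parts are indexed from `0`: `l.part i` is the part usually written `l_{i+1}`. -/
structure Par (n : ℕ) where
  part : ℕ → ℕ
  antitone_part : Antitone part
  part_eq_zero : ∀ i, n ≤ i → part i = 0

/-- The size of a partition. -/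
def Par.size {n : ℕ} (l : Par n) : ℕ := ∑ i ∈ Finset.range n, l.part i

/-- The one-row partition `(k)`. -/
def Par.single (k : ℕ) : Par 1 where
  part i := if i = 0 then k else 0
  antitone_part := by
    intro i j hij
    by_cases hj : j = 0
    · have hi : i = 0 := by omega
      simp [hi, hj]
    · simp [hj]
  part_eq_zero := by
    intro i hi
    have : i ≠ 0 := by omega
    simp [this]

/-- The staircase `(m - 1, m - 2, …, 1, 0)`; here `staircase m j` is its part with index `j`,
counted from `0` (and `0` for `j ≥ m`). -/
def staircase (m j : ℕ) : ℕ := m - 1 - j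

/-! ### The posets `P_n^m(X)` -/

/-- Cells of the shifted Young diagram with row lengths `ν 0, ν 1, …`: row `a` occupies the columns
`a, a + 1, …, a + ν a - 1`. -/
@[ext]
structure ShiftedCell (ν : ℕ → ℕ) where
  row : ℕ
  col : ℕ
  row_le_col : row ≤ col
  col_lt : col < row + ν row

/-- The order of the shifted Young poset: `u ≤ v` when `u` is weakly below and weakly to the right
of `v`. -/
instance (ν : ℕ → ℕ) : LE (ShiftedCell ν) where
  le u v := v.row ≤ u.row ∧ v.col ≤ u.col

/-- A triple `(λ, len, start)` with `λ ∈ Par_len`, where the positions `start, …, start + len - 1`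
(counted from `0`) lie on a chain with `n` elements. -/
structure Attachment (n : ℕ) where
  len : ℕ
  len_pos : 0 < len
  shape : Par len
  start : ℕ
  start_add_len_le : start + len ≤ n

/-- The row lengths of `λ + δ_{len+1}`. -/
def Attachment.rows {n : ℕ} (A : Attachment n) (a : ℕ) : ℕ :=
  A.shape.part a + staircase (A.len + 1) a

/-- The elements of `P_n^m(X)`: the diagonal entries `x_1 < ⋯ < x_n` (counted from `0`), the
off-diagonal cells of the shifted diagrams `(λ^{(i)} + δ_{n_i+1})^*`, and the `m` elements of the
chain attached on the top. The diagonal cells are identified with diagonal entries, see `cellNode`. -/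
inductive Node {n r : ℕ} (X : Fin r → Attachment n) (m : ℕ) : Type
  | diag (t : Fin n) : Node X m
  | cell (i : Fin r) (u : ShiftedCell (X i).rows) (hu : u.row ≠ u.col) : Node X m
  | top (j : Fin m) : Node X m

variable {n r : ℕ} {X : Fin r → Attachment n} {m : ℕ}

/-- The element of `P_n^m(X)` given by a cell of the `i`-th shifted diagram. The diagonal cells, in
the rows `0, 1, …, len - 1` from the top, are the diagonal entries at the positions
`start + len - 1, …, start + 1, start`. -/
def cellNode (i : Fin r) (u : ShiftedCell (X i).rows) : Node X m :=
  if h : u.row = u.col then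
    Node.diag ⟨(X i).start + (X i).len - 1 - u.row, by
      have h1 := (X i).len_pos
      have h2 := (X i).start_add_len_le
      omega⟩
  else Node.cell i u h

/-- The relations that generate the order of `P_n^m(X)`: those of the diagonal chain, those of each
of the shifted Young posets, and those of the chain of `m` elements above the diagonal. -/
inductive Gen : Node X m → Node X m → Prop
  | chain (s t : Fin n) (h : s ≤ t) : Gen (Node.diag s) (Node.diag t)
  | piece (i : Fin r) (u v : ShiftedCell (X i).rows) (h : u ≤ v) : Gen (cellNode i u) (cellNode i v)
  | attach (t : Fin n) (j : Fin m) : Gen (Node.diag t) (Node.top j)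
  | topChain (j j' : Fin m) (h : j ≤ j') : Gen (Node.top j) (Node.top j')

/-- An integer that increases strictly along the order (used to prove antisymmetry). -/
def Node.rank : Node X m → ℤ
  | .diag t => 2 * (t : ℤ)
  | .cell i u _ => 2 * ((X i).start + (X i).len - 1 : ℤ) - (u.row + u.col)
  | .top j => 2 * (n : ℤ) + j

lemma row_lt_len {i : Fin r} (u : ShiftedCell (X i).rows) : u.row < (X i).len := by
  by_contra h
  have h1 := u.row_le_col
  have h2 := u.col_lt
  have h3 : (X i).rows u.row = 0 := by
    have := (X i).shape.part_eq_zero u.row (by omega)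
    simp only [Attachment.rows, staircase, this]
    omega
  omega

lemma rank_cellNode (i : Fin r) (u : ShiftedCell (X i).rows) :
    (cellNode i u : Node X m).rank
      = 2 * ((X i).start + (X i).len - 1 : ℤ) - (u.row + u.col) := by
  have h1 := row_lt_len u
  unfold cellNode
  split_ifs with h
  · simp only [Node.rank]
    omega
  · rfl

lemma Gen.rank_lt {a b : Node X m} (h : Gen a b) : a = b ∨ a.rank < b.rank := by
  cases h with
  | chain s t h =>
    rcases h.eq_or_lt with h | h
    · exact Or.inl (by rw [h])
    · right
      have : (s : ℕ) < t := h
      simp only [Node.rank]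
      omega
  | piece i u v h =>
    obtain ⟨h1, h2⟩ := h
    by_cases he : u = v
    · exact Or.inl (by rw [he])
    · right
      have : ¬ (u.row = v.row ∧ u.col = v.col) := fun hh => he (ShiftedCell.ext hh.1 hh.2)
      rw [rank_cellNode, rank_cellNode]
      omega
  | attach t j =>
    right
    have := t.isLt
    simp only [Node.rank]
    omega
  | topChain j j' h =>
    rcases h.eq_or_lt with h | h
    · exact Or.inl (by rw [h])
    · right
      have : (j : ℕ) < j' := h
      simp only [Node.rank]
      omega

lemma rank_lt_of_reflTransGen {a b : Node X m} (h : Relation.ReflTransGen Gen a b) :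
    a = b ∨ a.rank < b.rank := by
  induction h with
  | refl => exact Or.inl rfl
  | tail _ h ih =>
    rcases ih with rfl | ih <;> rcases h.rank_lt with rfl | h
    · exact Or.inl rfl
    · exact Or.inr h
    · exact Or.inr ih
    · exact Or.inr (ih.trans h)

/-- The order of `P_n^m(X)`: the reflexive transitive closure of the generating relations. -/
instance : PartialOrder (Node X m) where
  le := Relation.ReflTransGen Gen
  le_refl _ := Relation.ReflTransGen.refl
  le_trans _ _ _ := Relation.ReflTransGen.trans
  le_antisymm a b h h' := by
    rcases rank_lt_of_reflTransGen h with h | h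
    · exact h
    · rcases rank_lt_of_reflTransGen h' with h' | h'
      · exact h'.symm
      · omega

instance (i : Fin r) : Finite (ShiftedCell (X i).rows) := by
  let N := ∑ a ∈ Finset.range (X i).len, (a + (X i).rows a)
  have hN (u : ShiftedCell (X i).rows) : u.col < N :=
    lt_of_lt_of_le u.col_lt
      (Finset.single_le_sum (f := fun a => a + (X i).rows a) (fun _ _ => Nat.zero_le _)
        (Finset.mem_range.2 (row_lt_len u)))
  refine Finite.of_injective
    (fun u => ((⟨u.row, row_lt_len u⟩, ⟨u.col, hN u⟩) : Fin (X i).len × Fin N)) ?_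
  intro u v h
  simp only [Prod.mk.injEq, Fin.mk.injEq] at h
  exact ShiftedCell.ext h.1 h.2

instance : Finite (Node X m) := by
  let f : Node X m → Fin n ⊕ (Σ i : Fin r, ShiftedCell (X i).rows) ⊕ Fin m := fun
    | .diag t => Sum.inl t
    | .cell i u _ => Sum.inr (Sum.inl ⟨i, u⟩)
    | .top j => Sum.inr (Sum.inr j)
  refine Finite.of_injective f ?_
  rintro (s | ⟨i, u, hu⟩ | j) (t | ⟨i', v, hv⟩ | j') h
  all_goals simp only [f, Sum.inl.injEq, Sum.inr.injEq, reduceCtorEq, Sigma.mk.injEq] at h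
  · rw [h]
  · obtain ⟨rfl, h⟩ := h
    obtain rfl := eq_of_heq h
    rfl
  · rw [h]

noncomputable instance : Fintype (Node X m) := Fintype.ofFinite _

/-! ### Hook lengths and the hook length property -/

/-- The double-tailed diamond poset `d_k(1)` (for `k ≥ 3`) on `2k - 2` elements: the numbers
`0 < ⋯ < k - 3` form the lower tail, the two incomparable elements `k - 2` and `k - 1` lie above
them, and the numbers `k < ⋯ < 2k - 3`, the neck elements, lie above these. -/
structure DoubleTailedDiamond (k : ℕ) where
  pos : Fin (2 * k - 2)

instance (k : ℕ) : PartialOrder (DoubleTailedDiamond k) where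
  le i j := i = j ∨
    ((i.pos : ℕ) < j.pos ∧ ¬ ((i.pos : ℕ) = k - 2 ∧ (j.pos : ℕ) = k - 1))
  le_refl _ := Or.inl rfl
  le_trans := by
    rintro a b c (rfl | hab) (rfl | hbc)
    · exact Or.inl rfl
    · exact Or.inr hbc
    · exact Or.inr hab
    · right
      omega
  le_antisymm := by
    rintro a b (rfl | hab) (h | hba)
    · rfl
    · rfl
    · exact h.symm
    · omega

section Hooks

variable {P : Type*} [PartialOrder P]

/-- `z` is in the neck of some `d_k`-interval `[w, t]`, i.e. of an interval isomorphic to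
`d_k(1)`, with `k ≥ 3`. -/
def InNeck (z : P) : Prop :=
  ∃ (k : ℕ) (_ : 3 ≤ k) (w t : P) (e : Set.Icc w t ≃o DoubleTailedDiamond k) (hz : z ∈ Set.Icc w t),
    k ≤ ((e ⟨z, hz⟩).pos : ℕ)

/-- `h` assigns to the elements of `P` their hook lengths: if `z` is in the neck of no `d_k`-interval
then `h z` is the number of elements `≤ z`; and if `[w, z]` is a `d_k`-interval whose two
incomparable elements are `x` and `y`, then `h z = h x + h y - h w`. -/
structure IsHookLength (h : P → ℕ) : Prop where
  of_not_inNeck : ∀ z, ¬ InNeck z → h z = Nat.card (Set.Iic z)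
  of_interval : ∀ (k : ℕ), 3 ≤ k → ∀ (w z : P) (e : Set.Icc w z ≃o DoubleTailedDiamond k)
    (x y : Set.Icc w z), ((e x).pos : ℕ) = k - 2 → ((e y).pos : ℕ) = k - 1 →
      (h z : ℤ) = h x + h y - h w

end Hooks

/-- The `P`-partitions: order-reversing maps from `P` to the natural numbers. -/
def PPartition (P : Type*) [PartialOrder P] : Type _ := {σ : P → ℕ // Antitone σ}

/-- The size of a `P`-partition. -/
def PPartition.size {P : Type*} [PartialOrder P] [Fintype P] (σ : PPartition P) : ℕ :=
  ∑ z, σ.1 z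

/-- The hook length property: hook lengths are well defined on `P`, and the `P`-partition generating
function is the product of the factors `1 / (1 - q ^ h(z))`. -/
def HasHookLengthProperty (P : Type*) [PartialOrder P] [Fintype P] : Prop :=
  (∃! h : P → ℕ, IsHookLength h) ∧
  ∀ h : P → ℕ, IsHookLength h → ∀ q : ℝ, 0 < q → q < 1 →
    HasSum (fun σ : PPartition P => q ^ σ.size) (∏ z, 1 / (1 - q ^ h z))

/-! ### Class 4: insets -/

/-- The family `X_4 = {(λ, n-1, 1), (μ, n+1, 1), ((k), 1, n)}` (start positions are counted from
`0` here). -/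
def insetData (n : ℕ) (hn : 2 ≤ n) (k : ℕ) (lam : Par (n - 1)) (mu : Par (n + 1)) :
    Fin 3 → Attachment (n + 1) :=
  ![{ len := n - 1, len_pos := by omega, shape := lam, start := 0, start_add_len_le := by omega },
    { len := n + 1, len_pos := by omega, shape := mu, start := 0, start_add_len_le := by omega },
    { len := 1, len_pos := by omega, shape := Par.single k, start := n - 1,
      start_add_len_le := by omega }]

/-- The semi-irreducible poset `P_{n+1}^{λ_1 + n - 2}(X_4)` of class 4. -/
abbrev InsetPoset (n : ℕ) (hn : 2 ≤ n) (k : ℕ) (lam : Par (n - 1)) (mu : Par (n + 1)) : Type :=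
  Node (insetData n hn k lam mu) (lam.part 0 + (n - 2))

/-! ### `q`-integrals and alternants -/

/-- The `q`-integral of `f` over `[a, b]`. -/
noncomputable def qIntegral (q a b : ℝ) (f : ℝ → ℝ) : ℝ :=
  (1 - q) * ∑' i : ℕ, (f (b * q ^ i) * (b * q ^ i) - f (a * q ^ i) * (a * q ^ i))

/-- The iterated `q`-integral of `f` over `0 ≤ x_1 ≤ ⋯ ≤ x_d ≤ b`, with `x_d` as the outermost
variable. -/
noncomputable def qIntegralSimplex (q : ℝ) : (d : ℕ) → (b : ℝ) → ((Fin d → ℝ) → ℝ) → ℝ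
  | 0, _, f => f Fin.elim0
  | d + 1, b, f =>
    qIntegral q 0 b fun t =>
      qIntegralSimplex q d t fun x => f (Fin.snoc (α := fun _ => ℝ) x t)

/-- The alternant `a_{λ + δ_d}(x_1, …, x_d) = det (x_i ^ (λ_j + d - j))`. -/
def alternant {d : ℕ} (l : Par d) (x : Fin d → ℝ) : ℝ :=
  Matrix.det (Matrix.of fun i j : Fin d => x i ^ (l.part j + staircase d j))

/-- The left-hand side of the class 4 identity:
the integral of `x_n^k a_{λ+δ_{n-1}}(x_1, …, x_{n-1}) a_{μ+δ_{n+1}}(x_1, …, x_{n+1})`. -/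
noncomputable def insetIntegral (q : ℝ) (n k : ℕ) (lam : Par (n - 1)) (mu : Par (n + 1)) : ℝ :=
  qIntegralSimplex q (n + 1) 1 fun x =>
    x ⟨n - 1, by omega⟩ ^ k *
      alternant lam (fun i => x (Fin.castLE (by omega) i)) * alternant mu x

end HookInsets

/-! Both halves rest on one sum. Put `n = p + 1`. The `q`-integral is a weighted sum over points
whose coordinates are powers of `q`; `alternant mu` vanishes when two coordinates agree, so only
strictly monotone exponents count. A `P`-partition without top chain is a weakly decreasing diagonal
with independent fillings of the three attached diagrams; adding a staircase makes the diagonal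
strictly monotone too. Since a shifted diagram with prescribed diagonal `D` has the generating
function `det (q ^ ((D i + i) * exps j))` up to a constant (`hasSum_filling`), each diagonal
receives the same weight as in the integral. Both quantities are therefore explicit multiples of the
sum of `diagWeight` over strictly increasing tuples.

That sum is a single determinant (`hasSum_diagWeight`). Expanding the smaller determinant and
absorbing its permutations into the rows of the larger one frees the order of the last `p` entries.
In terms of gaps the summand is a determinant whose row `i` depends on the `i`-th gap only, so
summation gives a matrix of geometric series. One row operation turns it into a Cauchy matrix with
one constant row, and `det_baseMatrix` evaluates it as `diagTotal`. For the integral only exponents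
remain to be rewritten.

For hook lengths the inset is drawn in the plane with the product order (`PlanarInset`). Its
`d_k`-intervals are the unit squares of the diagram and the intervals from its first column to one
of the special elements `(0, 1)`, `(0, 0)`, `(-1, -1)`, … (`isDiamond_cases_aux`). This forces
arm-plus-leg hooks in the diagram and the value `T - 1 + i - R i` at the `i`-th special element,
where `T` counts the elements outside the top chain. The product of the hook factors matches
`diagTotal` because the exponents of a partition and those of its conjugate are complementary
(`prod_mul_prod_conj`). For `lam`, shifted by `T`, the complement produces exactly the factors of a
top chain of length `λ_1 + n - 2`; the same length makes the first column of the diagram just long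
enough for all the intervals above. -/

namespace HookInsets

/-! ### Determinants -/

/-- Every pair of indices is an inversion of the reversal. -/
lemma sign_revPerm (N : ℕ) :
    Equiv.Perm.sign (Fin.revPerm : Equiv.Perm (Fin N)) = (-1) ^ (∑ i ∈ Finset.range N, i) := by
  rw [Equiv.Perm.sign_eq_prod_prod_Ioi]
  have h : ∀ i : Fin N, ∀ j ∈ Finset.Ioi i,
      (if (Fin.revPerm : Equiv.Perm (Fin N)) i < Fin.revPerm j then (1 : ℤˣ) else -1) = -1 := by
    intro i j hj
    rw [Finset.mem_Ioi] at hj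
    rw [if_neg]
    simpa using hj.le
  rw [Finset.prod_congr rfl fun i _ => Finset.prod_congr rfl (h i)]
  simp only [Finset.prod_const, Fin.card_Ioi]
  rw [Finset.prod_pow_eq_pow_sum, ← Finset.sum_range_reflect, Finset.sum_range]

/-- The two exponents differ by `p + (p + 1)`, which is odd. This is the source of the minus sign in
the integral formula. -/
lemma sign_revPerm_mul (p : ℕ) :
    Equiv.Perm.sign (Fin.revPerm : Equiv.Perm (Fin p)) *
      Equiv.Perm.sign (Fin.revPerm : Equiv.Perm (Fin (p + 2))) = -1 := by
  rw [sign_revPerm, sign_revPerm, ← pow_add, Finset.sum_range_succ, Finset.sum_range_succ]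
  exact Odd.neg_one_pow ⟨∑ i ∈ Finset.range p, i + p, by ring⟩

/-- The Cauchy determinant, in homogeneous form. -/
lemma det_cauchy (N : ℕ) (α β z : Fin N → ℝ) (h : ∀ i j, α i - β i * z j ≠ 0) :
    (Matrix.of fun i j => (α i - β i * z j)⁻¹).det =
      (∏ j, ∏ i ∈ Finset.univ.filter (· < j), ((β i * α j - β j * α i) * (z i - z j)))
        / ∏ i, ∏ j, (α i - β i * z j) := by
  induction N with
  | zero => simp
  | succ N ih =>
    have h0 := h 0
    -- Column `0` is subtracted from all others. The factor `α 0 - β 0 * z j` is inserted and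
    -- compensated so that, once row and column factors are pulled out, row `0` is `1, β 0, β 0, …`
    -- and column `0` is constant `1`.
    have key : (Matrix.of fun i j => (α i - β i * z j)⁻¹).det =
        (Matrix.of fun i j : Fin (N + 1) => (α i - β i * z 0)⁻¹ *
          (Fin.cases 1 (fun j => (z j.succ - z 0) * (α 0 - β 0 * z j.succ)⁻¹) j : ℝ) *
          (Fin.cases 1 (fun j => (α 0 - β 0 * z j.succ) * β i * (α i - β i * z j.succ)⁻¹) j : ℝ)).det := by
      rw [← Matrix.det_transpose, ← Matrix.det_transpose (Matrix.of fun i j : Fin (N + 1) => _ * _)]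
      refine Matrix.det_eq_of_forall_row_eq_smul_add_const (Fin.cases 0 fun _ => 1) 0 rfl ?_
      intro j i
      refine Fin.cases ?_ (fun j => ?_) j
      · simp
      · have h1 := h i 0
        have h2 := h i j.succ
        have h3 := h 0 j.succ
        simp only [Matrix.transpose_apply, Matrix.of_apply, Fin.cases_zero, Fin.cases_succ]
        linear_combination (-(α i - β i * z j.succ)⁻¹) * mul_inv_cancel₀ h1
          + (α i - β i * z 0)⁻¹ * mul_inv_cancel₀ h2
          - (α i - β i * z 0)⁻¹ * (z j.succ - z 0) * β i * (α i - β i * z j.succ)⁻¹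
            * mul_inv_cancel₀ h3
    have e1 : (Matrix.of fun i j : Fin (N + 1) => (α i - β i * z 0)⁻¹ *
          (Fin.cases 1 (fun j => (z j.succ - z 0) * (α 0 - β 0 * z j.succ)⁻¹) j : ℝ) *
          (Fin.cases 1 (fun j => (α 0 - β 0 * z j.succ) * β i * (α i - β i * z j.succ)⁻¹) j : ℝ)).det
        = (∏ i, (α i - β i * z 0)⁻¹) * ((∏ j : Fin N, (z j.succ - z 0) * (α 0 - β 0 * z j.succ)⁻¹) *
          (Matrix.of fun i j : Fin (N + 1) =>
          (Fin.cases 1 (fun j => (α 0 - β 0 * z j.succ) * β i * (α i - β i * z j.succ)⁻¹) j : ℝ)).det) := by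
      have := Matrix.det_mul_row (fun j : Fin (N + 1) =>
        (Fin.cases 1 (fun j => (z j.succ - z 0) * (α 0 - β 0 * z j.succ)⁻¹) j : ℝ))
        (Matrix.of fun i j : Fin (N + 1) =>
          (Fin.cases 1 (fun j => (α 0 - β 0 * z j.succ) * β i * (α i - β i * z j.succ)⁻¹) j : ℝ))
      rw [Fin.prod_univ_succ] at this
      simp only [Fin.cases_zero, Fin.cases_succ, one_mul] at this
      rw [← this, ← Matrix.det_mul_column]
      congr 1
      ext i j
      simp only [Matrix.of_apply]
      ring
    have e2 : (Matrix.of fun i j : Fin (N + 1) =>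
          (Fin.cases 1 (fun j => (α 0 - β 0 * z j.succ) * β i * (α i - β i * z j.succ)⁻¹) j : ℝ)).det
        = (∏ i : Fin N, (β i.succ * α 0 - β 0 * α i.succ)) *
          (Matrix.of fun i j : Fin N => (α i.succ - β i.succ * z j.succ)⁻¹).det := by
      -- Subtracting row `0` from the other rows clears column `0` and leaves the smaller Cauchy
      -- matrix with row factors `β i * α 0 - β 0 * α i`.
      have : (Matrix.of fun i j : Fin (N + 1) =>
          (Fin.cases 1 (fun j => (α 0 - β 0 * z j.succ) * β i * (α i - β i * z j.succ)⁻¹) j : ℝ)).det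
          = (Matrix.of fun i j : Fin (N + 1) =>
          (Fin.cases (Fin.cases 1 (fun j => β 0) j) (fun i => Fin.cases 0 (fun j =>
             (β i.succ * α 0 - β 0 * α i.succ) * (α i.succ - β i.succ * z j.succ)⁻¹) j) i : ℝ)).det := by
        refine Matrix.det_eq_of_forall_row_eq_smul_add_const (Fin.cases 0 fun _ => 1) 0 rfl ?_
        intro i j
        have h3 := h 0
        refine Fin.cases ?_ (fun j => ?_) j
        · refine Fin.cases ?_ (fun i => ?_) i <;> simp
        · have h3 := h 0 j.succ
          refine Fin.cases ?_ (fun i => ?_) i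
          · simp only [Matrix.of_apply, Fin.cases_zero, Fin.cases_succ]
            field_simp
            ring
          · have h2 := h i.succ j.succ
            simp only [Matrix.of_apply, Fin.cases_zero, Fin.cases_succ]
            linear_combination β 0 * mul_inv_cancel₀ h2
      rw [this, Matrix.det_succ_column_zero, Fin.sum_univ_succ]
      simp only [Matrix.of_apply, Fin.cases_zero, Fin.cases_succ, mul_zero, zero_mul,
        Finset.sum_const_zero, add_zero, Fin.val_zero, pow_zero, one_mul]
      rw [← Matrix.det_mul_column]
      congr 1
    rw [key, e1, e2, ih (fun i => α i.succ) (fun i => β i.succ) (fun i => z i.succ)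
      (fun i j => h _ _)]
    have e3 : ∀ G : Fin (N + 1) → Fin (N + 1) → ℝ,
        (∏ j, ∏ i ∈ Finset.univ.filter (· < j), G i j) = (∏ j : Fin N, G 0 j.succ) *
          ∏ j : Fin N, ∏ i ∈ Finset.univ.filter (· < j), G i.succ j.succ := by
      intro G
      rw [Fin.prod_univ_succ]
      simp only [Finset.prod_filter]
      rw [← Finset.prod_mul_distrib]
      simp [Fin.prod_univ_succ]
    rw [e3, Fin.prod_univ_succ (f := fun i => ∏ j, (α i - β i * z j))]
    simp only [Fin.prod_univ_succ (f := fun j => α _ - β _ * z j)]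
    rw [Fin.prod_univ_succ]
    simp only [Finset.prod_mul_distrib, Finset.prod_inv_distrib]
    have e4 : (∏ i : Fin N, (β i.succ * α 0 - β 0 * α i.succ)) * (∏ j : Fin N, (z j.succ - z 0))
        = (∏ i : Fin N, (β 0 * α i.succ - β i.succ * α 0)) * (∏ j : Fin N, (z 0 - z j.succ)) := by
      rw [← Finset.prod_mul_distrib, ← Finset.prod_mul_distrib]
      exact Finset.prod_congr rfl fun i _ => by ring
    have n1 := h 0 0
    have n2 : ∏ i : Fin N, (α i.succ - β i.succ * z 0) ≠ 0 :=
      Finset.prod_ne_zero_iff.2 fun i _ => h _ _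
    have n3 : ∏ j : Fin N, (α 0 - β 0 * z j.succ) ≠ 0 :=
      Finset.prod_ne_zero_iff.2 fun i _ => h _ _
    have n4 : ∏ i : Fin N, ∏ j : Fin N, (α i.succ - β i.succ * z j.succ) ≠ 0 :=
      Finset.prod_ne_zero_iff.2 fun i _ => Finset.prod_ne_zero_iff.2 fun i _ => h _ _
    rw [← e4]
    field_simp

/-! ### Sums over tuples -/

lemma hasSum_prod_mul {ι κ : Type*} {f : ι → ℝ} {g : κ → ℝ} {a b : ℝ} (hf : HasSum f a)
    (hg : HasSum g b) : HasSum (fun x : ι × κ => f x.1 * g x.2) (a * b) :=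
  hf.mul hg (summable_mul_of_summable_norm hf.summable.norm hg.summable.norm)

lemma hasSum_pi {r : ℕ} {β : Fin r → Type*} (f : ∀ i, β i → ℝ) (a : Fin r → ℝ)
    (h : ∀ i, HasSum (f i) (a i)) :
    HasSum (fun x : ∀ i, β i => ∏ i, f i (x i)) (∏ i, a i) := by
  induction r with
  | zero => simp
  | succ r ih =>
    have h1 := ih (fun i => f i.succ) (fun i => a i.succ) fun i => h _
    have h2 := hasSum_prod_mul (h 0) h1
    have h3 : (fun x : β 0 × (∀ i : Fin r, β i.succ) => f 0 x.1 * ∏ i, f i.succ (x.2 i)) =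
        (fun x : ∀ i, β i => ∏ i, f i (x i)) ∘ Fin.consEquiv β := by
      funext x
      rw [Function.comp_apply, Fin.prod_univ_succ]
      rfl
    rw [h3] at h2
    rw [Fin.prod_univ_succ]
    exact (Fin.consEquiv β).hasSum_iff.1 h2

/-- Each term of the Leibniz expansion is a product of series in separate variables, one for each
row. -/
lemma hasSum_det {r : ℕ} (f : Fin r → Fin r → ℕ → ℝ) (F : Fin r → Fin r → ℝ)
    (h : ∀ i j, HasSum (f i j) (F i j)) :
    HasSum (fun E : Fin r → ℕ => (Matrix.of fun i j => f i j (E i)).det) (Matrix.of F).det := by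
  simp only [← Matrix.det_transpose (Matrix.of _), Matrix.det_apply]
  refine hasSum_sum fun σ _ => ?_
  refine HasSum.const_smul _ ?_
  exact hasSum_pi (fun i => f i (σ i)) (fun i => F i (σ i)) fun i => h _ _

/-- For nonnegative terms, summability of the fibre sums already gives summability over the sigma
type. -/
lemma hasSum_sigma_of_nonneg {ι : Type*} {β : ι → Type*} {f : (Σ i, β i) → ℝ} (hf : ∀ x, 0 ≤ f x)
    {g : ι → ℝ} {a : ℝ} (h : ∀ i, HasSum (fun b => f ⟨i, b⟩) (g i)) (hg : HasSum g a) :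
    HasSum f a := by
  have hs : Summable f := (summable_sigma_of_nonneg hf).2
    ⟨fun i => (h i).summable, by simpa only [(h _).tsum_eq] using hg.summable⟩
  rw [hs.hasSum_iff]
  exact (hs.hasSum.sigma h).unique hg

end HookInsets

namespace HookInsets

/-! ### Sums of products of two alternants over strictly increasing tuples -/

lemma det_of_mul_column {r : ℕ} (v : Fin r → ℝ) (A : Fin r → Fin r → ℝ) :
    (Matrix.of fun i j => v i * A i j).det = (∏ i, v i) * (Matrix.of A).det :=
  Matrix.det_mul_column v (Matrix.of A)

lemma det_of_mul_row {r : ℕ} (v : Fin r → ℝ) (A : Fin r → Fin r → ℝ) :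
    (Matrix.of fun i j => v j * A i j).det = (∏ i, v i) * (Matrix.of A).det :=
  Matrix.det_mul_row v (Matrix.of A)

/-- A permutation of `Fin p`, extended to `Fin (p + 2)` by fixing `0` and `1`. -/
def shiftPerm {p : ℕ} (π : Equiv.Perm (Fin p)) : Equiv.Perm (Fin (p + 2)) :=
  Equiv.Perm.decomposeFin.symm (0, Equiv.Perm.decomposeFin.symm (0, π))

lemma shiftPerm_zero {p : ℕ} (π : Equiv.Perm (Fin p)) : shiftPerm π 0 = 0 := by
  simp [shiftPerm]

lemma shiftPerm_one {p : ℕ} (π : Equiv.Perm (Fin p)) : shiftPerm π 1 = 1 := by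
  rw [shiftPerm, ← Fin.succ_zero_eq_one, Equiv.Perm.decomposeFin_symm_apply_succ]
  simp

lemma shiftPerm_succ {p : ℕ} (π : Equiv.Perm (Fin p)) (a : Fin p) :
    shiftPerm π a.succ.succ = (π a).succ.succ := by
  rw [shiftPerm, Equiv.Perm.decomposeFin_symm_apply_succ, Equiv.Perm.decomposeFin_symm_apply_succ]
  simp

lemma sign_shiftPerm {p : ℕ} (π : Equiv.Perm (Fin p)) :
    Equiv.Perm.sign (shiftPerm π) = Equiv.Perm.sign π := by
  simp [shiftPerm, Equiv.Perm.decomposeFin.symm_sign]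

/-- The summand attached to a diagonal of an inset. -/
noncomputable def diagWeight {p : ℕ} (q : ℝ) (k : ℕ) (m : Fin (p + 2) → ℕ) (l : Fin p → ℕ)
    (s : Fin (p + 2) → ℕ) : ℝ :=
  q ^ (∑ i, s i) * q ^ (k * s 1) * (Matrix.of fun i j => q ^ (s i * m j)).det *
    (Matrix.of fun a b : Fin p => q ^ (s a.succ.succ * l b)).det

/-- The summand of `diagWeight` that comes from the diagonal term of the second determinant. -/
noncomputable def preWeight {p : ℕ} (q : ℝ) (k : ℕ) (m : Fin (p + 2) → ℕ) (l : Fin p → ℕ)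
    (s : Fin (p + 2) → ℕ) : ℝ :=
  q ^ (∑ i, s i) * q ^ (k * s 1) * (Matrix.of fun i j => q ^ (s i * m j)).det *
    ∏ a : Fin p, q ^ (s a.succ.succ * l a)

/-- Permuting the last `p` entries of `s` permutes rows of the larger determinant, and the resulting
sign is the one in the Leibniz expansion of the smaller determinant. The factor `q ^ (k * s 1)` is
unaffected because the positions `0` and `1` stay fixed. -/
lemma sum_preWeight {p : ℕ} (q : ℝ) (k : ℕ) (m : Fin (p + 2) → ℕ) (l : Fin p → ℕ)
    (s : Fin (p + 2) → ℕ) :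
    ∑ π : Equiv.Perm (Fin p), preWeight q k m l (s ∘ shiftPerm π) = diagWeight q k m l s := by
  rw [diagWeight, Matrix.det_apply' (Matrix.of fun a b : Fin p => _), Finset.mul_sum]
  refine Finset.sum_congr rfl fun π _ => ?_
  have h1 : ∑ i, (s ∘ shiftPerm π) i = ∑ i, s i := Equiv.sum_comp (shiftPerm π) s
  have h2 : (Matrix.of fun i j => q ^ ((s ∘ shiftPerm π) i * m j)).det
      = Equiv.Perm.sign π * (Matrix.of fun i j => q ^ (s i * m j)).det := by
    rw [← sign_shiftPerm, ← Matrix.det_permute]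
    rfl
  rw [preWeight, h1, h2]
  simp only [Function.comp_apply, shiftPerm_one, shiftPerm_succ, Matrix.of_apply]
  ring

lemma preWeight_eq_zero {p : ℕ} (q : ℝ) (k : ℕ) (m : Fin (p + 2) → ℕ) (l : Fin p → ℕ)
    (s : Fin (p + 2) → ℕ) (hs : ¬ Function.Injective s) : preWeight q k m l s = 0 := by
  simp only [Function.Injective, not_forall] at hs
  obtain ⟨i, j, h, hij⟩ := hs
  rw [preWeight, Matrix.det_zero_of_row_eq hij (by ext; simp [h])]
  ring

/-- The bases of the geometric series in `hasSum_preWeight`. -/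
def baseMatrix {p : ℕ} (q : ℝ) (R : ℕ) (m : Fin (p + 2) → ℕ) (l : Fin p → ℕ)
    (i j : Fin (p + 2)) : ℝ :=
  Fin.cases (q ^ (∑ i, m i - m j + R))
    (fun i => Fin.cases (q ^ (∑ i, m i + R + 1)) (fun a => q ^ (m j + l a + 1)) i) i

/-- The tuple with the smallest entry `E 1`, the second entry larger by `E 0`, and the others larger
than the second by `E 2, E 3, …`. -/
def cumulate {p : ℕ} (E : Fin (p + 2) → ℕ) : Fin (p + 2) → ℕ :=
  Fin.cases (E 1) (fun i => Fin.cases (E 0 + E 1) (fun a => E a.succ.succ + (E 0 + E 1)) i)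

lemma cumulate_zero {p : ℕ} (E : Fin (p + 2) → ℕ) : cumulate E 0 = E 1 := rfl

lemma cumulate_one {p : ℕ} (E : Fin (p + 2) → ℕ) : cumulate E 1 = E 0 + E 1 := rfl

lemma cumulate_succ {p : ℕ} (E : Fin (p + 2) → ℕ) (a : Fin p) :
    cumulate E a.succ.succ = E a.succ.succ + (E 0 + E 1) := rfl

lemma sum_cumulate {p : ℕ} (E : Fin (p + 2) → ℕ) :
    ∑ i, cumulate E i = ∑ a : Fin p, E a.succ.succ + (p + 1) * E 0 + (p + 2) * E 1 := by
  rw [Fin.sum_univ_succ, Fin.sum_univ_succ, Fin.succ_zero_eq_one, cumulate_zero, cumulate_one]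
  simp only [cumulate_succ, Finset.sum_add_distrib, Finset.sum_const, Finset.card_univ,
    Fintype.card_fin, smul_eq_mul]
  ring

/-- Dividing column `j` of `q ^ (s i * m j)` by `q ^ (s 1 * m j)` subtracts the second entry of the
tuple from all entries: row `0` then involves only `-E 0`, row `1` is constant, and row `a + 2`
involves only `E (a + 2)`. The remaining scalar has an exponent linear in `E`, so it can be
distributed over the rows. The constant `∑ l + p + 1 + k` is the coefficient of `E 0` in the
exponents outside the larger determinant; for `E 1` it is one more. -/
lemma det_baseMatrix_pow {p : ℕ} {q : ℝ} (hq : 0 < q) (k : ℕ) (m : Fin (p + 2) → ℕ)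
    (l : Fin p → ℕ) (E : Fin (p + 2) → ℕ) :
    (Matrix.of fun i j => baseMatrix q (∑ a, l a + p + 1 + k) m l i j ^ E i).det
      = preWeight q k m l (cumulate E) := by
  set R := ∑ a, l a + p + 1 + k with hR
  have key : ∀ i j, baseMatrix q R m l i j ^ E i =
      (Fin.cases (q ^ (E 0 * (∑ i, m i + R))) (fun i => Fin.cases (q ^ (E 1 * (∑ i, m i + R + 1)))
        (fun a => q ^ (E a.succ.succ * (l a + 1))) i) i : ℝ) *
      ((q ^ ((E 0 + E 1) * m j))⁻¹ * q ^ (cumulate E i * m j)) := by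
    intro i j
    have hm : m j ≤ ∑ i, m i := Finset.single_le_sum (fun _ _ => Nat.zero_le _) (Finset.mem_univ j)
    have hne : q ^ ((E 0 + E 1) * m j) ≠ 0 := (pow_pos hq _).ne'
    rw [mul_left_comm, ← div_eq_inv_mul, eq_div_iff hne]
    refine Fin.cases ?_ (fun i => Fin.cases ?_ (fun a => ?_) i) i
    · simp only [baseMatrix, cumulate, Fin.cases_zero]
      rw [← pow_mul, ← pow_add, ← pow_add]
      congr 1
      zify [hm]
      ring
    · simp only [baseMatrix, cumulate, Fin.cases_zero, Fin.cases_succ]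
      rw [Fin.succ_zero_eq_one]
      rw [← pow_mul, ← pow_add, ← pow_add]
      congr 1
      ring
    · simp only [baseMatrix, cumulate, Fin.cases_succ]
      rw [← pow_mul, ← pow_add, ← pow_add]
      congr 1
      ring
  simp only [key]
  rw [det_of_mul_column (fun i => (Fin.cases (q ^ (E 0 * (∑ i, m i + R)))
    (fun i => Fin.cases (q ^ (E 1 * (∑ i, m i + R + 1)))
        (fun a => q ^ (E a.succ.succ * (l a + 1))) i) i : ℝ))
      (fun i j => (q ^ ((E 0 + E 1) * m j))⁻¹ * q ^ (cumulate E i * m j)),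
    det_of_mul_row (fun j => (q ^ ((E 0 + E 1) * m j))⁻¹)
      (fun i j => q ^ (cumulate E i * m j)), preWeight]
  rw [mul_right_comm _ _ (∏ a : Fin p, q ^ (cumulate E a.succ.succ * l a)), ← mul_assoc]
  congr 1
  rw [Finset.prod_inv_distrib, Fin.prod_univ_succ, Fin.prod_univ_succ]
  simp only [Fin.cases_zero, Fin.cases_succ]
  rw [← div_eq_mul_inv, div_eq_iff (Finset.prod_ne_zero_iff.2 fun _ _ => (pow_pos hq _).ne')]
  simp only [Finset.prod_pow_eq_pow_sum, ← pow_add]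
  congr 1
  rw [sum_cumulate]
  simp only [cumulate_one, cumulate_succ]
  rw [← Finset.mul_sum]
  simp only [mul_add, add_mul, Finset.sum_add_distrib, mul_one, ← Finset.mul_sum]
  rw [hR]
  ring

/-- The inverse of `cumulate` on tuples obtained from strictly increasing ones by a permutation that
fixes `0` and `1`. -/
def gaps {p : ℕ} (x : {s : Fin (p + 2) → ℕ // StrictMono s} × Equiv.Perm (Fin p)) :
    Fin (p + 2) → ℕ :=
  Fin.cases (x.1.1 1 - x.1.1 0)
    (fun i => Fin.cases (x.1.1 0) (fun a => x.1.1 (x.2 a).succ.succ - x.1.1 1) i)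

lemma cumulate_gaps {p : ℕ} (x : {s : Fin (p + 2) → ℕ // StrictMono s} × Equiv.Perm (Fin p)) :
    cumulate (gaps x) = x.1.1 ∘ shiftPerm x.2 := by
  obtain ⟨⟨s, hs⟩, π⟩ := x
  have h01 : s 0 ≤ s 1 := hs.monotone (Fin.zero_le _)
  have g0 : gaps (⟨s, hs⟩, π) 0 = s 1 - s 0 := rfl
  have g1 : gaps (⟨s, hs⟩, π) 1 = s 0 := rfl
  funext i
  rw [Function.comp_apply]
  refine Fin.cases ?_ (fun i => Fin.cases ?_ (fun a => ?_) i) i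
  · rw [shiftPerm_zero, cumulate_zero, g1]
  · rw [Fin.succ_zero_eq_one, shiftPerm_one, cumulate_one, g0, g1]
    exact Nat.sub_add_cancel h01
  · have : s 1 ≤ s (π a).succ.succ :=
      hs.monotone (by rw [← Fin.succ_zero_eq_one, Fin.succ_le_succ_iff]; exact Fin.zero_le _)
    have g2 : gaps (⟨s, hs⟩, π) a.succ.succ = s (π a).succ.succ - s 1 := rfl
    rw [shiftPerm_succ, cumulate_succ, g0, g1, g2]
    dsimp only
    omega

/-- A strictly increasing tuple is determined by its set of values, and the permutation by where
these values go. -/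
lemma gaps_injective {p : ℕ} : Function.Injective (gaps (p := p)) := by
  rintro x y h
  have h1 : x.1.1 ∘ shiftPerm x.2 = y.1.1 ∘ shiftPerm y.2 := by
    rw [← cumulate_gaps, ← cumulate_gaps, h]
  have h2 : Set.range x.1.1 = Set.range y.1.1 := by
    rw [← (shiftPerm x.2).surjective.range_comp, h1, (shiftPerm y.2).surjective.range_comp]
  have h3 : x.1 = y.1 := Subtype.ext ((x.1.2.range_inj y.1.2).1 h2)
  refine Prod.ext h3 (Equiv.ext fun a => ?_)
  have h4 := congrFun h1 a.succ.succ
  simp only [Function.comp_apply, shiftPerm_succ, h3] at h4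
  simpa using y.1.2.injective h4

/-- The preimage is found by sorting the last `p` entries of `cumulate E`; injectivity makes all the
weak inequalities strict. -/
lemma mem_range_gaps {p : ℕ} (E : Fin (p + 2) → ℕ) (hE : Function.Injective (cumulate E)) :
    E ∈ Set.range (gaps (p := p)) := by
  set r : Fin p → ℕ := fun a => E a.succ.succ + (E 0 + E 1) with hr
  have hr' : ∀ a, cumulate E a.succ.succ = r a := fun a => rfl
  have rinj : Function.Injective r := fun a b h => by
    rw [← hr', ← hr'] at h
    simpa using hE h
  have c0 : cumulate E 0 = E 1 := rfl
  have c1 : cumulate E 1 = E 0 + E 1 := rfl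
  have h0 : E 0 ≠ 0 := fun h => by
    have : cumulate E 0 = cumulate E 1 := by rw [c0, c1, h, zero_add]
    exact absurd (hE this) (by simp)
  have h1 : ∀ a, E 0 + E 1 < r a := fun a => by
    refine lt_of_le_of_ne (Nat.le_add_left _ _) fun h => ?_
    rw [← hr', ← c1] at h
    exact absurd (hE h) (by simp [Fin.ext_iff])
  set t := r ∘ Tuple.sort r with ht
  have tmono : StrictMono t :=
    (Tuple.monotone_sort r).strictMono_of_injective (rinj.comp (Tuple.sort r).injective)
  let s : Fin (p + 2) → ℕ := Fin.cases (E 1) (fun i => Fin.cases (E 0 + E 1) t i)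
  have hs : StrictMono s := by
    rw [Fin.strictMono_iff_lt_succ]
    intro i
    refine Fin.cases ?_ (fun i => ?_) i
    · change E 1 < E 0 + E 1
      omega
    · change (Fin.cases (E 0 + E 1) t i.castSucc : ℕ) < t i
      rcases p with _ | p
      · exact i.elim0
      refine Fin.cases ?_ (fun i => ?_) i
      · exact h1 _
      · exact tmono (Fin.castSucc_lt_succ)
  refine ⟨(⟨s, hs⟩, (Tuple.sort r).symm), ?_⟩
  funext i
  refine Fin.cases ?_ (fun i => Fin.cases ?_ (fun a => ?_) i) i
  · change E 0 + E 1 - E 1 = E 0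
    omega
  · rfl
  · change t ((Tuple.sort r).symm a) - (E 0 + E 1) = _
    simp [ht, hr]

/-- The geometric series run over all gap tuples. Those outside the range of `gaps` have a repeated
entry and contribute zero; the others are grouped by their sorted tuple, and each group sums to
`diagWeight`. -/
theorem hasSum_diagWeight {p : ℕ} {q : ℝ} (hq : 0 < q) (hq1 : q < 1) (k : ℕ)
    (m : Fin (p + 2) → ℕ) (l : Fin p → ℕ) :
    HasSum (fun s : {s : Fin (p + 2) → ℕ // StrictMono s} => diagWeight q k m l s.1)
      (Matrix.of fun i j => (1 - baseMatrix q (∑ a, l a + p + 1 + k) m l i j)⁻¹).det := by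
  have hb : ∀ i j, 0 ≤ baseMatrix q (∑ a, l a + p + 1 + k) m l i j ∧
      baseMatrix q (∑ a, l a + p + 1 + k) m l i j < 1 := by
    intro i j
    refine Fin.cases ?_ (fun i => Fin.cases ?_ (fun a => ?_) i) i
    · exact ⟨(pow_pos hq _).le, pow_lt_one₀ hq.le hq1 (by omega)⟩
    · exact ⟨(pow_pos hq _).le, pow_lt_one₀ hq.le hq1 (by omega)⟩
    · exact ⟨(pow_pos hq _).le, pow_lt_one₀ hq.le hq1 (by omega)⟩
  have h1 := hasSum_det _ _ fun i j => hasSum_geometric_of_lt_one (hb i j).1 (hb i j).2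
  simp only [det_baseMatrix_pow hq] at h1
  rw [← gaps_injective.hasSum_iff] at h1
  · refine (h1.prod_fiberwise fun s => hasSum_fintype _).congr_fun fun s => ?_
    simp only [Function.comp_apply, cumulate_gaps, sum_preWeight]
  · intro E hE
    exact preWeight_eq_zero _ _ _ _ _ fun h => hE (mem_range_gaps E h)

end HookInsets

namespace HookInsets

/-! ### Evaluation of the determinant -/

lemma prod_filter_lt_succ {N : ℕ} (G : Fin (N + 1) → Fin (N + 1) → ℝ) :
    (∏ j, ∏ i ∈ Finset.univ.filter (· < j), G i j) = (∏ j : Fin N, G 0 j.succ) *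
      ∏ j : Fin N, ∏ i ∈ Finset.univ.filter (· < j), G i.succ j.succ := by
  rw [Fin.prod_univ_succ]
  simp only [Finset.prod_filter]
  rw [← Finset.prod_mul_distrib]
  simp [Fin.prod_univ_succ]

lemma prod_filter_lt_sub {N : ℕ} (q : ℝ) (m : Fin N → ℕ) (hm : StrictAnti m) :
    (∏ j, ∏ i ∈ Finset.univ.filter (· < j), (q ^ m i - q ^ m j)) =
      (∏ j : Fin N, (-q ^ m j) ^ (j : ℕ)) *
        ∏ j, ∏ i ∈ Finset.univ.filter (· < j), (1 - q ^ (m i - m j)) := by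
  rw [← Finset.prod_mul_distrib]
  refine Finset.prod_congr rfl fun j _ => ?_
  have h : (Finset.univ.filter (· < j)).card = (j : ℕ) := by
    rw [Finset.filter_gt_eq_Iio, Fin.card_Iio]
  rw [← h, ← Finset.prod_const, ← Finset.prod_mul_distrib]
  refine Finset.prod_congr rfl fun i hi => ?_
  have h1 := (hm (Finset.mem_filter.1 hi).2).le
  obtain ⟨d, hd⟩ := Nat.exists_eq_add_of_le h1
  rw [hd, Nat.add_sub_cancel_left, pow_add]
  ring

/-- The value of the sum of `diagWeight` over all strictly increasing tuples. -/
noncomputable def diagTotal {p : ℕ} (q : ℝ) (k : ℕ) (m : Fin (p + 2) → ℕ) (l : Fin p → ℕ) : ℝ :=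
  q ^ (∑ j : Fin (p + 2), (j : ℕ) * m j + ∑ b : Fin p, ((b : ℕ) + 2) * l b + ∑ j ∈ Finset.range (p + 2), j + k) *
    ((∏ j, ∏ i ∈ Finset.univ.filter (· < j), (1 - q ^ (m i - m j))) *
      (∏ b, ∏ a ∈ Finset.univ.filter (· < b), (1 - q ^ (l a - l b))) *
      ∏ a, (1 - q ^ (∑ i, m i + (∑ a, l a + p + 1 + k) + 1 + l a))) /
    ((∏ i, ∏ a, (1 - q ^ (m i + l a + 1))) *
      (∏ j, (1 - q ^ (∑ i, m i - m j + (∑ a, l a + p + 1 + k)))) *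
      (1 - q ^ (∑ i, m i + (∑ a, l a + p + 1 + k) + 1)))

/-- The bookkeeping of signs and powers of `q` left over when all factors of the Cauchy formula are
normalised to the form `1 - q ^ e`. On the left stand the scalar of row `0`, the differences with
the constant row, and the two Vandermonde products; on the right the product comes from the Cauchy
denominators of row `0`. -/
lemma monomial_identity {p : ℕ} (q : ℝ) (k : ℕ) (m : Fin (p + 2) → ℕ) (l : Fin p → ℕ) :
    -q ^ (∑ i, m i + (∑ a, l a + p + 1 + k)) * (∏ a, (-q ^ (l a + 1))) *
      (∏ b : Fin p, (-q ^ (l b + 1)) ^ (b : ℕ)) * (∏ j : Fin (p + 2), (-q ^ m j) ^ (j : ℕ)) =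
    q ^ (∑ j : Fin (p + 2), (j : ℕ) * m j + ∑ b : Fin p, ((b : ℕ) + 2) * l b + ∑ j ∈ Finset.range (p + 2), j + k) *
      ∏ j, (-q ^ m j) := by
  have e : ∀ x : ℝ, -x = (-1) * x := fun x => by ring
  simp only [fun n : ℕ => e (q ^ n), mul_pow, Finset.prod_mul_distrib, Finset.prod_const,
    Finset.prod_pow_eq_pow_sum, ← pow_mul, Finset.card_univ, Fintype.card_fin]
  have e2 : ∑ j : Fin (p + 2), (j : ℕ) = ∑ j : Fin p, (j : ℕ) + p + (p + 1) := by
    simp [Fin.sum_univ_castSucc]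
  have e3 : ∑ j ∈ Finset.range (p + 2), j = ∑ j : Fin p, (j : ℕ) + p + (p + 1) := by
    rw [Finset.sum_range_succ, Finset.sum_range_succ, Finset.sum_range]
  have e4 : (-1 : ℝ) * (-1) ^ p * (-1) ^ (∑ j : Fin p, (j : ℕ)) *
      (-1) ^ (∑ j : Fin (p + 2), (j : ℕ)) = (-1) ^ (p + 2) := by
    have : (-1 : ℝ) ^ (∑ j : Fin p, (j : ℕ)) * (-1) ^ (∑ j : Fin p, (j : ℕ)) = 1 := by
      rw [← mul_pow]
      simp
    have h2 : (-1 : ℝ) ^ p * (-1) ^ p = 1 := by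
      rw [← mul_pow]
      simp
    rw [e2, pow_add, pow_add, pow_add, pow_add]
    linear_combination ((-1 : ℝ) ^ p) ^ 3 * this + (-1 : ℝ) ^ p * h2
  have e5 : q ^ (∑ i, m i + (∑ a, l a + p + 1 + k)) * q ^ (∑ a, (l a + 1)) *
      q ^ (∑ b : Fin p, (l b + 1) * (b : ℕ)) * q ^ (∑ j : Fin (p + 2), m j * (j : ℕ)) =
      q ^ (∑ j : Fin (p + 2), (j : ℕ) * m j + ∑ b : Fin p, ((b : ℕ) + 2) * l b + ∑ j ∈ Finset.range (p + 2), j + k) *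
        q ^ ∑ i, m i := by
    simp only [← pow_add]
    congr 1
    rw [e3]
    have h1 : ∑ b : Fin p, ((b : ℕ) + 2) * l b = ∑ b : Fin p, l b * (b : ℕ) + 2 * ∑ b, l b := by
      rw [Finset.mul_sum, ← Finset.sum_add_distrib]
      exact Finset.sum_congr rfl fun b _ => by ring
    have h2 : ∑ b : Fin p, (l b + 1) * (b : ℕ) = ∑ b : Fin p, l b * (b : ℕ) + ∑ b : Fin p, (b : ℕ) := by
      rw [← Finset.sum_add_distrib]
      exact Finset.sum_congr rfl fun b _ => by ring
    rw [h1, h2, Finset.sum_add_distrib]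
    simp only [Finset.sum_const, Finset.card_univ, Fintype.card_fin, smul_eq_mul, mul_one,
      mul_comm (m _)]
    ring
  linear_combination ((-1 : ℝ) ^ (p + 2)) * e5 +
    (q ^ (∑ i, m i + (∑ a, l a + p + 1 + k)) * q ^ (∑ a, (l a + 1)) *
      q ^ (∑ b : Fin p, (l b + 1) * (b : ℕ)) * q ^ (∑ j : Fin (p + 2), m j * (j : ℕ))) * e4

/-- With `c = q ^ (M + R)` and `y = q ^ m j`, row `0` is `1 / (1 - c / y) = 1 - c / (c - y)`. Since
row `1` is constant, the summand `1` can be removed, and a Cauchy matrix in the variables `q ^ m j`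
remains. -/
lemma det_baseMatrix {p : ℕ} {q : ℝ} (hq : 0 < q) (hq1 : q < 1) (k : ℕ)
    {m : Fin (p + 2) → ℕ} {l : Fin p → ℕ} (hm : StrictAnti m) (hl : StrictAnti l) :
    (Matrix.of fun i j => (1 - baseMatrix q (∑ a, l a + p + 1 + k) m l i j)⁻¹).det
      = diagTotal q k m l := by
  have hne : ∀ n : ℕ, n ≠ 0 → 1 - q ^ n ≠ 0 := fun n hn =>
    sub_ne_zero.2 (pow_lt_one₀ hq.le hq1 hn).ne'
  have hmle : ∀ j, m j ≤ ∑ i, m i := fun j =>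
    Finset.single_le_sum (fun _ _ => Nat.zero_le _) (Finset.mem_univ j)
  have hmono := monomial_identity q k m l
  rw [diagTotal]
  set R := ∑ a, l a + p + 1 + k with hR
  set M := ∑ i, m i with hM
  have hR0 : R ≠ 0 := by omega
  clear_value R M
  have hsub : ∀ j, q ^ (M + R) - 1 * q ^ m j = -q ^ m j * (1 - q ^ (M - m j + R)) := by
    intro j
    obtain ⟨d, hd⟩ := Nat.exists_eq_add_of_le (hmle j)
    rw [hd, Nat.add_sub_cancel_left, add_assoc, pow_add]
    ring
  -- The constant row `1` is the Cauchy row with `β = 0`; this is why the homogeneous form of the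
  -- determinant is used.
  let α : Fin (p + 2) → ℝ := Fin.cases (q ^ (M + R)) fun _ => 1
  let β : Fin (p + 2) → ℝ := Fin.cases 1 fun i => Fin.cases 0 (fun a => q ^ (l a + 1)) i
  have hC : ∀ i j, α i - β i * q ^ m j ≠ 0 := by
    intro i j
    refine Fin.cases ?_ (fun i => Fin.cases ?_ (fun a => ?_) i) i
    · change q ^ (M + R) - 1 * q ^ m j ≠ 0
      rw [hsub]
      exact mul_ne_zero (neg_ne_zero.2 (pow_pos hq _).ne') (hne _ (by omega))
    · change (1 : ℝ) - 0 * q ^ m j ≠ 0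
      simp
    · change (1 : ℝ) - q ^ (l a + 1) * q ^ m j ≠ 0
      rw [← pow_add]
      exact hne _ (by omega)
  have h1 : (Matrix.of fun i j => (1 - baseMatrix q R m l i j)⁻¹).det =
      -q ^ (M + R) * (1 - q ^ (M + R + 1))⁻¹ *
        (Matrix.of fun i j => (α i - β i * q ^ m j)⁻¹).det := by
    have e1 : (Matrix.of fun i j => (1 - baseMatrix q R m l i j)⁻¹) = Matrix.of fun i j =>
        (Fin.cases (-q ^ (M + R)) (fun i => Fin.cases (1 - q ^ (M + R + 1))⁻¹ (fun _ => 1) i) i : ℝ) *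
          ((α i - β i * q ^ m j)⁻¹ + (Fin.cases (-(q ^ (M + R))⁻¹) (fun _ => 0) i : ℝ) *
            (α 1 - β 1 * q ^ m j)⁻¹) := by
      ext i j
      have a1 : α 1 - β 1 * q ^ m j = 1 := by
        change (1 : ℝ) - 0 * q ^ m j = 1
        simp
      rw [Matrix.of_apply, Matrix.of_apply, a1]
      refine Fin.cases ?_ (fun i => Fin.cases ?_ (fun a => ?_) i) i
      · change (1 - q ^ (∑ i, m i - m j + R))⁻¹ = -q ^ (M + R) *
          ((q ^ (M + R) - 1 * q ^ m j)⁻¹ + -(q ^ (M + R))⁻¹ * 1⁻¹)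
        have hb : q ^ (M + R) = q ^ m j * q ^ (M - m j + R) := by
          rw [← pow_add]
          congr 1
          have := hmle j
          omega
        have b1 := hne (M - m j + R) (by omega)
        have b2 := (pow_pos hq (m j)).ne'
        have b3 := (pow_pos hq (M - m j + R)).ne'
        rw [hsub, ← hM, hb]
        generalize q ^ (M - m j + R) = x at *
        generalize q ^ m j = y at *
        have b4 : -y * (1 - x) ≠ 0 := mul_ne_zero (neg_ne_zero.2 b2) b1
        rw [inv_one, mul_one, mul_add, neg_mul_neg, mul_inv_cancel₀ (mul_ne_zero b2 b3),
          ← div_eq_mul_inv, div_add_one b4, inv_eq_one_div, div_eq_div_iff b1 b4]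
        ring
      · change (1 - q ^ (∑ i, m i + R + 1))⁻¹ = (1 - q ^ (M + R + 1))⁻¹ *
          (((1 : ℝ) - 0 * q ^ m j)⁻¹ + 0 * 1⁻¹)
        simp [hM]
      · change (1 - q ^ (m j + l a + 1))⁻¹ = 1 * (((1 : ℝ) - q ^ (l a + 1) * q ^ m j)⁻¹ + 0 * 1⁻¹)
        rw [← pow_add]
        simp only [one_mul, zero_mul, add_zero]
        congr 3
        ring
    rw [e1, det_of_mul_column, Fin.prod_univ_succ, Fin.prod_univ_succ]
    simp only [Fin.cases_zero, Fin.cases_succ, Finset.prod_const_one, mul_one]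
    congr 1
    exact Matrix.det_eq_of_forall_row_eq_smul_add_const _ 1 rfl fun i j => rfl
  rw [h1, det_cauchy _ _ _ _ hC]
  simp only [Finset.prod_mul_distrib]
  rw [prod_filter_lt_sub q m hm, prod_filter_lt_succ, prod_filter_lt_succ, Fin.prod_univ_succ]
  have f1 : (∏ b : Fin p, ∏ a ∈ Finset.univ.filter (· < b),
      (β a.succ.succ * α b.succ.succ - β b.succ.succ * α a.succ.succ)) =
      (∏ b : Fin p, (-q ^ (l b + 1)) ^ (b : ℕ)) *
        ∏ b, ∏ a ∈ Finset.univ.filter (· < b), (1 - q ^ (l a - l b)) := by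
    have := prod_filter_lt_sub q (fun a => l a + 1) fun a b h => Nat.succ_lt_succ (hl h)
    simp only [Nat.add_sub_add_right] at this
    rw [← this]
    refine Finset.prod_congr rfl fun b _ => Finset.prod_congr rfl fun a _ => ?_
    change q ^ (l a + 1) * 1 - q ^ (l b + 1) * 1 = _
    ring
  have f2 : ∀ a : Fin p, β 0 * α a.succ.succ - β a.succ.succ * α 0 = 1 - q ^ (M + R + 1 + l a) := by
    intro a
    change (1 : ℝ) * 1 - q ^ (l a + 1) * q ^ (M + R) = _
    rw [← pow_add, mul_one]
    congr 2
    ring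
  have f3 : ∀ a : Fin p, β (Fin.succ 0) * α a.succ.succ - β a.succ.succ * α (Fin.succ 0)
      = -q ^ (l a + 1) := by
    intro a
    change (0 : ℝ) * 1 - q ^ (l a + 1) * 1 = _
    ring
  have f4 : β 0 * α (Fin.succ 0) - β (Fin.succ 0) * α 0 = 1 := by
    change (1 : ℝ) * 1 - 0 * q ^ (M + R) = _
    ring
  have f5 : ∏ j, (α 0 - β 0 * q ^ m j) = (∏ j, (-q ^ m j)) * ∏ j, (1 - q ^ (M - m j + R)) := by
    rw [← Finset.prod_mul_distrib]
    exact Finset.prod_congr rfl fun j _ => hsub j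
  have f6 : ∏ j, (α (Fin.succ 0) - β (Fin.succ 0) * q ^ m j) = 1 := by
    refine Finset.prod_eq_one fun j _ => ?_
    change (1 : ℝ) - 0 * q ^ m j = 1
    simp
  have f7 : ∏ a : Fin p, ∏ j, (α a.succ.succ - β a.succ.succ * q ^ m j) =
      ∏ i, ∏ a, (1 - q ^ (m i + l a + 1)) := by
    rw [Finset.prod_comm]
    refine Finset.prod_congr rfl fun j _ => Finset.prod_congr rfl fun a _ => ?_
    change (1 : ℝ) - q ^ (l a + 1) * q ^ m j = _
    rw [← pow_add]
    congr 2
    ring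
  have f8 : ∏ i, ∏ j, (α i - β i * q ^ m j) =
      ((∏ j, (-q ^ m j)) * ∏ j, (1 - q ^ (M - m j + R))) * ∏ i, ∏ a, (1 - q ^ (m i + l a + 1)) := by
    rw [Fin.prod_univ_succ, f5, Fin.prod_univ_succ (f := fun i : Fin (p + 1) => ∏ j, _), f6, f7,
      one_mul]
  rw [f1, f4, f8]
  simp only [f2, f3]
  have g1 := hne (M + R + 1) (by omega)
  have g2 : ∏ j, (-q ^ m j) ≠ 0 :=
    Finset.prod_ne_zero_iff.2 fun j _ => neg_ne_zero.2 (pow_pos hq _).ne'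
  have g3 : ∏ j, (1 - q ^ (M - m j + R)) ≠ 0 :=
    Finset.prod_ne_zero_iff.2 fun j _ => hne _ (by omega)
  have g4 : ∏ i, ∏ a, (1 - q ^ (m i + l a + 1)) ≠ 0 :=
    Finset.prod_ne_zero_iff.2 fun i _ => Finset.prod_ne_zero_iff.2 fun a _ => hne _ (by omega)
  generalize ∏ j, (1 - q ^ (M - m j + R)) = x3 at *
  generalize ∏ i, ∏ a, (1 - q ^ (m i + l a + 1)) = x4 at *
  generalize ∏ a, (1 - q ^ (M + R + 1 + l a)) = x5 at *
  generalize 1 - q ^ (M + R + 1) = x6 at *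
  generalize ∏ j, (-q ^ m j) = x7 at *
  generalize ∏ j : Fin (p + 2), (-q ^ m j) ^ (j : ℕ) = x8 at *
  generalize ∏ b : Fin p, (-q ^ (l b + 1)) ^ (b : ℕ) = x9 at *
  generalize ∏ a, (-q ^ (l a + 1)) = x10 at *
  generalize ∏ b, ∏ a ∈ Finset.univ.filter (· < b), (1 - q ^ (l a - l b)) = x11 at *
  generalize ∏ b, ∏ a ∈ Finset.univ.filter (· < b), (1 - q ^ (m a - m b)) = x12 at *
  generalize q ^ (M + R) = x13 at *
  rw [← div_eq_mul_inv, div_mul_div_comm, div_eq_div_iff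
    (mul_ne_zero g1 (mul_ne_zero (mul_ne_zero g2 g3) g4)) (mul_ne_zero (mul_ne_zero g4 g3) g1)]
  linear_combination (x12 * x11 * x5 * x4 * x3 * x6) * hmono

end HookInsets

namespace HookInsets

/-! ### The `q`-integral as a sum over tuples -/

/-- An antitone tuple with entries at least `t` is given by its last entry and the others. -/
def antitoneTupleEquiv (d t : ℕ) :
    (Σ i : ℕ, {s : Fin d → ℕ // Antitone s ∧ ∀ j, t + i ≤ s j}) ≃
      {s : Fin (d + 1) → ℕ // Antitone s ∧ ∀ j, t ≤ s j} where
  toFun x := ⟨Fin.snoc (α := fun _ => ℕ) x.2.1 (t + x.1), by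
    obtain ⟨i, s, hs, hst⟩ := x
    refine ⟨fun a b hab => ?_, fun a => ?_⟩
    · refine Fin.lastCases (fun hab => ?_) (fun b hab => ?_) b hab
      · refine Fin.lastCases (by simp) (fun a => ?_) a
        simpa using hst a
      · have : a ≠ Fin.last d := (lt_of_le_of_lt hab (Fin.castSucc_lt_last b)).ne
        obtain ⟨a, rfl⟩ := Fin.exists_castSucc_eq.2 this
        simpa using hs (by simpa using hab)
    · refine Fin.lastCases (by simp) (fun a => ?_) a
      simpa using le_trans (Nat.le_add_right t i) (hst a)⟩
  invFun s := ⟨s.1 (Fin.last d) - t, fun j => s.1 j.castSucc, by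
    refine ⟨fun a b hab => s.2.1 (by simpa using hab), fun j => ?_⟩
    have h1 := s.2.2 (Fin.last d)
    have h2 := s.2.1 (Fin.le_last j.castSucc)
    dsimp only
    omega⟩
  left_inv x := by
    obtain ⟨i, s, hs, hst⟩ := x
    have e : (Fin.snoc (α := fun _ => ℕ) s (t + i) (Fin.last d) : ℕ) - t = i := by
      rw [Fin.snoc_last]
      omega
    simp only [Fin.snoc_castSucc]
    congr! 3
    rw [e]
  right_inv s := by
    ext j
    have h1 := s.2.2 (Fin.last d)
    refine Fin.lastCases ?_ (fun j => ?_) j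
    · simp
      omega
    · simp

/-- With upper limit `q ^ t` the outermost variable takes the values `q ^ (t + i)`, and each of
these becomes the next upper limit; so the exponents decrease weakly and stay at least `t`. The
lower limit `0` contributes nothing, and summability allows the nested sums to be merged. -/
lemma qIntegralSimplex_eq_tsum {q : ℝ} (hq : 0 < q) (d t : ℕ) (f : (Fin d → ℝ) → ℝ)
    (hf : Summable fun s : {s : Fin d → ℕ // Antitone s ∧ ∀ j, t ≤ s j} =>
      q ^ (∑ i, s.1 i) * f fun i => q ^ s.1 i) :
    qIntegralSimplex q d (q ^ t) f = (1 - q) ^ d *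
      ∑' s : {s : Fin d → ℕ // Antitone s ∧ ∀ j, t ≤ s j}, q ^ (∑ i, s.1 i) * f fun i => q ^ s.1 i := by
  induction d generalizing t with
  | zero =>
    have : Unique {s : Fin 0 → ℕ // Antitone s ∧ ∀ j, t ≤ s j} :=
      { default := ⟨Fin.elim0, fun a => a.elim0, fun a => a.elim0⟩
        uniq := fun s => Subtype.ext (funext fun a => a.elim0) }
    rw [tsum_eq_single default fun b hb => absurd (Subsingleton.elim _ _) hb]
    simp only [qIntegralSimplex, pow_zero, Finset.univ_eq_empty, Finset.sum_empty, one_mul]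
    congr 1
    funext a
    exact a.elim0
  | succ d ih =>
    have key : ∀ x : (Σ i : ℕ, {s : Fin d → ℕ // Antitone s ∧ ∀ j, t + i ≤ s j}),
        q ^ (∑ i, (antitoneTupleEquiv d t x).1 i) * f (fun i => q ^ (antitoneTupleEquiv d t x).1 i) =
        q ^ (t + x.1) * (q ^ (∑ i, x.2.1 i) *
          f (Fin.snoc (α := fun _ => ℝ) (fun i => q ^ x.2.1 i) (q ^ (t + x.1)))) := by
      rintro ⟨i, s, hs⟩
      simp only [antitoneTupleEquiv, Equiv.coe_fn_mk, Fin.sum_univ_castSucc, Fin.snoc_castSucc,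
        Fin.snoc_last]
      rw [pow_add, mul_comm (q ^ _) (q ^ (t + i)), mul_assoc]
      congr 3
      funext j
      refine Fin.lastCases ?_ (fun j => ?_) j <;> simp
    have hf' := (antitoneTupleEquiv d t).summable_iff.2 hf
    rw [← (antitoneTupleEquiv d t).tsum_eq]
    simp only [Function.comp_def, key] at hf' ⊢
    rw [hf'.tsum_sigma]
    simp only [qIntegralSimplex, qIntegral]
    rw [pow_succ', mul_assoc]
    congr 1
    rw [← tsum_mul_left]
    refine tsum_congr fun i => ?_
    have hs : Summable fun s : {s : Fin d → ℕ // Antitone s ∧ ∀ j, t + i ≤ s j} =>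
        q ^ (t + i) * (q ^ (∑ i, s.1 i) *
          f (Fin.snoc (α := fun _ => ℝ) (fun i => q ^ s.1 i) (q ^ (t + i)))) := hf'.sigma_factor i
    have hs' := (summable_mul_left_iff (pow_pos hq (t + i)).ne').1 hs
    have hi := ih (t + i) (fun x => f (Fin.snoc (α := fun _ => ℝ) x (q ^ (t + i)))) hs'
    rw [tsum_mul_left, zero_mul, mul_zero, sub_zero, ← pow_add, hi]
    ring

end HookInsets

namespace HookInsets

/-! ### The class 4 integral -/

/-- The exponents `ν_j + d - j` of the alternant `a_{ν + δ_d}`. -/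
def Par.exps {d : ℕ} (l : Par d) (j : Fin d) : ℕ := l.part j + staircase d j

lemma Par.exps_strictAnti {d : ℕ} (l : Par d) : StrictAnti l.exps := by
  intro i j hij
  have h1 := l.antitone_part (show (i : ℕ) ≤ j from hij.le)
  have h2 : (i : ℕ) < j := hij
  have h3 := j.isLt
  simp only [Par.exps, staircase]
  omega

lemma alternant_pow_rev {d : ℕ} (l : Par d) (q : ℝ) (s : Fin d → ℕ) :
    alternant l (fun i => q ^ s i.rev) =
      (Equiv.Perm.sign (Fin.revPerm : Equiv.Perm (Fin d)) : ℤ) *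
        (Matrix.of fun i j => q ^ (s i * l.exps j)).det := by
  rw [← Matrix.det_permute, alternant]
  congr 1
  ext i j
  simp only [Matrix.of_apply, Matrix.submatrix_apply, ← pow_mul, id, Fin.revPerm_apply]
  rfl

/-- The exponents are read backwards: `s 0` and `s 1` belong to the two largest variables, the
remaining entries to the variables of the alternant of `lam`. Reversing the rows of both alternants
costs the sign of `sign_revPerm_mul`. -/
lemma inset_summand {p : ℕ} (q : ℝ) (k : ℕ) (lam : Par p) (mu : Par (p + 2))
    (s : Fin (p + 2) → ℕ) :
    q ^ (∑ i : Fin (p + 2), s i.rev) * ((q ^ s (Fin.rev ⟨p, by omega⟩)) ^ k *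
      alternant lam (fun i => q ^ s (Fin.rev (Fin.castLE (by omega : p ≤ p + 2) i))) *
        alternant mu (fun i => q ^ s i.rev)) = -diagWeight q k mu.exps lam.exps s := by
  have h1 : ∑ i : Fin (p + 2), s i.rev = ∑ i, s i := Equiv.sum_comp Fin.revPerm s
  have h2 : (Fin.rev ⟨p, by omega⟩ : Fin (p + 2)) = 1 := by
    ext
    simp [Fin.val_rev]
  have h3 : ∀ i : Fin p, Fin.rev (Fin.castLE (by omega : p ≤ p + 2) i) = i.rev.succ.succ := by
    intro i
    ext
    simp only [Fin.val_rev, Fin.val_succ, Fin.val_castLE]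
    omega
  simp only [h3]
  rw [h1, h2, alternant_pow_rev, alternant_pow_rev lam q fun i => s i.succ.succ, diagWeight]
  have h4 := congrArg (fun x : ℤˣ => ((x : ℤ) : ℝ)) (sign_revPerm_mul p)
  simp only [Units.val_mul, Int.cast_mul, Units.val_neg, Units.val_one, Int.cast_neg,
    Int.cast_one] at h4
  rw [← pow_mul, mul_comm (s 1) k]
  linear_combination (q ^ (∑ i, s i) * q ^ (k * s 1) *
    (Matrix.of fun i j => q ^ (s i * mu.exps j)).det *
    (Matrix.of fun a b : Fin p => q ^ (s a.succ.succ * lam.exps b)).det) * h4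

/-- Weakly monotone exponents with a repetition give `alternant mu` two equal rows, so only strictly
monotone ones survive. -/
lemma insetIntegral_eq {p : ℕ} {q : ℝ} (hq : 0 < q) (hq1 : q < 1) (k : ℕ) (lam : Par p)
    (mu : Par (p + 2)) :
    insetIntegral q (p + 1) k lam mu = -((1 - q) ^ (p + 2) * diagTotal q k mu.exps lam.exps) := by
  have h0 := hasSum_diagWeight hq hq1 k mu.exps lam.exps
  rw [det_baseMatrix hq hq1 k mu.exps_strictAnti lam.exps_strictAnti] at h0
  let f : (Fin (p + 2) → ℝ) → ℝ := fun x => x ⟨p, by omega⟩ ^ k *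
      alternant lam (fun i => x (Fin.castLE (by omega) i)) * alternant mu x
  let g : {s : Fin (p + 2) → ℕ // StrictMono s} →
      {s : Fin (p + 2) → ℕ // Antitone s ∧ ∀ j, 0 ≤ s j} :=
    fun s => ⟨fun i => s.1 i.rev,
      fun a b h => s.2.monotone (Fin.rev_le_rev.2 h), fun _ => Nat.zero_le _⟩
  have hg : Function.Injective g := by
    intro s t h
    refine Subtype.ext (funext fun i => ?_)
    have := congrFun (congrArg Subtype.val h) i.rev
    simpa [g] using this
  have hsum : HasSum (fun s : {s : Fin (p + 2) → ℕ // Antitone s ∧ ∀ j, 0 ≤ s j} =>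
      q ^ (∑ i, s.1 i) * f fun i => q ^ s.1 i) (-diagTotal q k mu.exps lam.exps) := by
    rw [← hg.hasSum_iff]
    · refine h0.neg.congr_fun fun s => ?_
      exact inset_summand q k lam mu s.1
    · rintro ⟨s, hs, hs0⟩ h
      have hni : ¬ Function.Injective s := by
        intro hi
        refine h ⟨⟨fun i => s i.rev, ?_⟩, ?_⟩
        · have h1 : StrictAnti s := hs.strictAnti_of_injective hi
          exact fun a b hab => h1 (Fin.rev_lt_rev.2 hab)
        · simp [g]
      simp only [Function.Injective, not_forall] at hni
      obtain ⟨i, j, hij, hne⟩ := hni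
      have : alternant mu (fun i => q ^ s i) = 0 :=
        Matrix.det_zero_of_row_eq hne (by ext; simp [hij])
      simp only [f, this, mul_zero]
  have := qIntegralSimplex_eq_tsum hq (p + 2) 0 f hsum.summable
  rw [pow_zero, hsum.tsum_eq] at this
  rw [mul_neg] at this
  exact this

lemma prod_filter_lt_eq_range {N : ℕ} (g : ℕ → ℝ) (j : Fin N) :
    ∏ i ∈ Finset.univ.filter (· < j), g i = ∏ i ∈ Finset.range j, g i := by
  refine Finset.prod_bij (fun i _ => (i : ℕ)) ?_ ?_ ?_ fun _ _ => rfl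
  · intro i hi
    simpa using hi
  · intro i _ i' _ h
    exact Fin.ext h
  · intro i hi
    exact ⟨⟨i, (Finset.mem_range.1 hi).trans j.isLt⟩, 
      Finset.mem_filter.2 ⟨Finset.mem_univ _, Finset.mem_range.1 hi⟩, rfl⟩

lemma Par.sum_exps {d : ℕ} (l : Par d) : ∑ j, l.exps j = l.size + ∑ j ∈ Finset.range d, j := by
  simp only [Par.exps, staircase]
  rw [Finset.sum_add_distrib, Par.size, Finset.sum_range, ← Finset.sum_range_reflect,
    Finset.sum_range (fun j => d - 1 - j)]

lemma sum_range_mul_sub (N : ℕ) :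
    6 * (∑ j ∈ Finset.range (N + 2), (j : ℤ) * (N + 1 - j)) = (N + 2) * (N + 1) * N := by
  induction N with
  | zero => decide
  | succ N ih =>
    have h1 : (∑ j ∈ Finset.range (N + 2), (j : ℤ) * ((N + 1 : ℕ) + 1 - j)) =
        (∑ j ∈ Finset.range (N + 2), (j : ℤ) * (N + 1 - j)) + ∑ j ∈ Finset.range (N + 2), (j : ℤ) := by
      rw [← Finset.sum_add_distrib]
      exact Finset.sum_congr rfl fun j _ => by push_cast; ring
    have h2 := Finset.sum_range_id_mul_two (N + 2)
    rw [show N + 2 - 1 = N + 1 from rfl] at h2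
    zify at h2
    rw [Finset.sum_range_succ, h1]
    push_cast
    linear_combination ih + 3 * h2

/-- The staircases inside `exps` and the sum of the indices produce the cubic polynomial; `h6` shows
that the division by `6` is exact. The right-hand sum may include `i = p` because `lam.part p = 0`.
-/
lemma inset_exponent {p : ℕ} (k : ℕ) (lam : Par p) (mu : Par (p + 2)) :
    ∑ j : Fin (p + 2), (j : ℕ) * mu.exps j + ∑ b : Fin p, ((b : ℕ) + 2) * lam.exps b +
      ∑ j ∈ Finset.range (p + 2), j + k =
    ∑ i ∈ Finset.range (p + 1), ((i + 2) * lam.part i + (i + 1) * mu.part (i + 1))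
      + (p + 1) * (p + 1 - 1) * (2 * (p + 1) + 5) / 6 + 1 + k := by
  have h1 : ∑ j : Fin (p + 2), (j : ℕ) * mu.exps j =
      ∑ i ∈ Finset.range (p + 1), (i + 1) * mu.part (i + 1) +
        ∑ j ∈ Finset.range (p + 2), j * (p + 1 - j) := by
    simp only [Par.exps, staircase, mul_add]
    rw [Finset.sum_add_distrib, ← Finset.sum_range (fun j => j * mu.part j),
      ← Finset.sum_range (fun j => j * (p + 2 - 1 - j)), Finset.sum_range_succ']
    simp
  have h2 : ∑ b : Fin p, ((b : ℕ) + 2) * lam.exps b =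
      ∑ i ∈ Finset.range (p + 1), (i + 2) * lam.part i +
        ∑ b ∈ Finset.range p, (b + 2) * (p - 1 - b) := by
    simp only [Par.exps, staircase, mul_add ((_ : ℕ) + 2)]
    rw [Finset.sum_add_distrib, ← Finset.sum_range (fun j => (j + 2) * lam.part j),
      ← Finset.sum_range (fun j => (j + 2) * (p - 1 - j)), Finset.sum_range_succ,
      lam.part_eq_zero p le_rfl]
    simp
  have h3 : ∑ j ∈ Finset.range (p + 2), j * (p + 1 - j) =
      ∑ b ∈ Finset.range p, (b + 2) * (p - 1 - b) + p := by
    rw [Finset.sum_range_succ', Finset.sum_range_succ']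
    simp only [zero_mul, add_zero, zero_add, one_mul, Nat.add_sub_cancel]
    congr 1
    exact Finset.sum_congr rfl fun b _ => by congr 1; omega
  have h4 : 6 * ∑ j ∈ Finset.range (p + 2), j * (p + 1 - j) = (p + 2) * (p + 1) * p := by
    have := sum_range_mul_sub p
    zify
    rw [← this]
    congr 1
    refine Finset.sum_congr rfl fun j hj => ?_
    have := Finset.mem_range.1 hj
    rw [Nat.cast_sub (by omega)]
    push_cast
    ring
  have h5 := Finset.sum_range_id_mul_two (p + 2)
  rw [show p + 2 - 1 = p + 1 from rfl] at h5
  have h6 : (p + 1) * (p + 1 - 1) * (2 * (p + 1) + 5) =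
      6 * (∑ j ∈ Finset.range (p + 2), j * (p + 1 - j) + ∑ b ∈ Finset.range p, (b + 2) * (p - 1 - b)
        + ∑ j ∈ Finset.range (p + 2), j - 1) := by
    rw [Nat.add_sub_cancel]
    have h7 : 1 ≤ ∑ j ∈ Finset.range (p + 2), j := by
      rw [Finset.sum_range_succ]
      omega
    generalize ∑ j ∈ Finset.range (p + 2), j * (p + 1 - j) = A at *
    generalize ∑ b ∈ Finset.range p, (b + 2) * (p - 1 - b) = B at *
    generalize ∑ j ∈ Finset.range (p + 2), j = C at *
    zify [show 1 ≤ A + B + C by omega]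
    zify at h3 h4 h5
    linear_combination 6 * h3 - 2 * h4 - 3 * h5
  rw [h1, h2, h6, Nat.mul_div_cancel_left _ (by norm_num), Finset.sum_add_distrib]
  have h7 : 1 ≤ ∑ j ∈ Finset.range (p + 2), j := by
    rw [Finset.sum_range_succ]
    omega
  omega

theorem insetIntegral_formula {p : ℕ} {q : ℝ} (hq : 0 < q) (hq1 : q < 1) (k : ℕ) (lam : Par p)
    (mu : Par (p + 2)) :
    insetIntegral q (p + 1) k lam mu =
        (-1) * q ^ (∑ i ∈ Finset.range (p + 1), ((i + 2) * lam.part i + (i + 1) * mu.part (i + 1))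
              + (p + 1) * (p + 1 - 1) * (2 * (p + 1) + 5) / 6 + 1 + k) * (1 - q) ^ (p + 1 + 1)
          / (∏ i ∈ Finset.range (p + 1 + 1),
              (1 - q ^ (lam.size + mu.size - mu.part i + (p + 1) * (p + 1 - 1) + k + (i + 1))))
          * ((∏ j ∈ Finset.range (p + 1 - 1),
                (1 - q ^ (lam.size + mu.size + lam.part j + (p + 1) ^ 2 + (p + 1) - (j + 1) + k + 1)))
              / (1 - q ^ (lam.size + mu.size + (p + 1) ^ 2 + k + 2)))
          * (((∏ j ∈ Finset.range (p + 1 + 1), ∏ i ∈ Finset.range j,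
                  (1 - q ^ (mu.part i - mu.part j + (j - i))))
                * ∏ j ∈ Finset.range (p + 1 - 1), ∏ i ∈ Finset.range j,
                  (1 - q ^ (lam.part i - lam.part j + (j - i))))
              / ∏ i ∈ Finset.range (p + 1 + 1), ∏ j ∈ Finset.range (p + 1 - 1),
                  (1 - q ^ (mu.part i + lam.part j + 2 * (p + 1) - (i + 1) - (j + 1) + 1))) := by
  have s1 := mu.sum_exps
  have s2 := lam.sum_exps
  have s3 := Finset.sum_range_id_mul_two (p + 2)
  have s4 := Finset.sum_range_id_mul_two p
  have s5 : p * (p - 1) + p = p * p := by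
    rcases p with _ | p
    · rfl
    · rw [Nat.add_sub_cancel]
      ring
  have s6 : (p + 1) ^ 2 = p * p + 2 * p + 1 := by ring
  have s7 : (p + 2) * (p + 2 - 1) = p * p + 3 * p + 2 := by
    rw [show p + 2 - 1 = p + 1 from rfl]
    ring
  have s8 : (p + 1) * (p + 1 - 1) = p * p + p := by
    rw [Nat.add_sub_cancel]
    ring
  have hle : ∀ j : Fin (p + 2), mu.part j ≤ mu.size := fun j =>
    Finset.single_le_sum (f := mu.part) (fun _ _ => Nat.zero_le _) (Finset.mem_range.2 j.isLt)
  have hmle : ∀ j, mu.exps j ≤ ∑ i, mu.exps i := fun j =>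
    Finset.single_le_sum (fun _ _ => Nat.zero_le _) (Finset.mem_univ j)
  rw [insetIntegral_eq hq hq1, ← inset_exponent, diagTotal]
  -- The bounds `hle` and `hmle` make the subtractions of natural numbers exact here.
  have e1 : ∏ j, (1 - q ^ (∑ i, mu.exps i - mu.exps j + (∑ a, lam.exps a + p + 1 + k))) =
      ∏ i ∈ Finset.range (p + 1 + 1),
        (1 - q ^ (lam.size + mu.size - mu.part i + (p + 1) * (p + 1 - 1) + k + (i + 1))) := by
    rw [Finset.prod_range]
    refine Finset.prod_congr rfl fun j _ => ?_
    congr 2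
    have h1 := hle j
    have h2 := hmle j
    have h3 := j.isLt
    have h4 : mu.exps j = mu.part j + (p + 2 - 1 - j) := rfl
    omega
  have e2 : ∏ a, (1 - q ^ (∑ i, mu.exps i + (∑ a, lam.exps a + p + 1 + k) + 1 + lam.exps a)) =
      ∏ j ∈ Finset.range (p + 1 - 1),
        (1 - q ^ (lam.size + mu.size + lam.part j + (p + 1) ^ 2 + (p + 1) - (j + 1) + k + 1)) := by
    rw [Nat.add_sub_cancel, Finset.prod_range]
    refine Finset.prod_congr rfl fun j _ => ?_
    congr 2
    have h3 := j.isLt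
    have h4 : lam.exps j = lam.part j + (p - 1 - j) := rfl
    omega
  have e3 : ∑ i, mu.exps i + (∑ a, lam.exps a + p + 1 + k) + 1 =
      lam.size + mu.size + (p + 1) ^ 2 + k + 2 := by omega
  have e4 : ∀ {d : ℕ} (l : Par d), ∏ j, ∏ i ∈ Finset.univ.filter (· < j),
      (1 - q ^ (l.exps i - l.exps j)) = ∏ j ∈ Finset.range d, ∏ i ∈ Finset.range j,
                  (1 - q ^ (l.part i - l.part j + (j - i))) := by
    intro d l
    rw [Finset.prod_range]
    refine Finset.prod_congr rfl fun j _ => ?_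
    rw [← prod_filter_lt_eq_range (fun i => 1 - q ^ (l.part i - l.part j + (j - i)))]
    refine Finset.prod_congr rfl fun i hi => ?_
    have h1 : (i : ℕ) < j := (Finset.mem_filter.1 hi).2
    have h2 := l.antitone_part h1.le
    have h3 := j.isLt
    congr 2
    simp only [Par.exps, staircase]
    omega
  have e5 : ∏ i, ∏ a, (1 - q ^ (mu.exps i + lam.exps a + 1)) =
      ∏ i ∈ Finset.range (p + 1 + 1), ∏ j ∈ Finset.range (p + 1 - 1),
        (1 - q ^ (mu.part i + lam.part j + 2 * (p + 1) - (i + 1) - (j + 1) + 1)) := by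
    rw [Finset.prod_range]
    refine Finset.prod_congr rfl fun i _ => ?_
    rw [Nat.add_sub_cancel, Finset.prod_range]
    refine Finset.prod_congr rfl fun a _ => ?_
    congr 2
    have h1 := i.isLt
    have h2 := a.isLt
    simp only [Par.exps, staircase]
    omega
  rw [e1, e2, e3, e4, e4, e5, Nat.add_sub_cancel]
  simp only [div_eq_mul_inv, mul_inv]
  ring

end HookInsets

namespace HookInsets

/-! ### Fillings of shifted diagrams with a given diagonal -/

/-- The order-reversing fillings of a shifted diagram with `d` rows whose diagonal is `D`. -/
abbrev Filling (ν : ℕ → ℕ) {d : ℕ} (D : Fin d → ℕ) : Type :=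
  {c : ShiftedCell ν → ℕ // (∀ u v, u ≤ v → c v ≤ c u) ∧
    ∀ u (h : u.row < d), u.row = u.col → c u = D ⟨u.row, h⟩}

/-- The cells off the diagonal. -/
abbrev OffCell (ν : ℕ → ℕ) : Type := {u : ShiftedCell ν // ¬ u.row = u.col}

lemma finite_shiftedCell {ν : ℕ → ℕ} {d : ℕ} (hν : ∀ a, 0 < ν a ↔ a < d) :
    Finite (ShiftedCell ν) := by
  have hrow (u : ShiftedCell ν) : u.row < d := by
    rw [← hν]
    have h1 := u.row_le_col
    have h2 := u.col_lt
    omega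
  let N := ∑ a ∈ Finset.range d, (a + ν a)
  have hN (u : ShiftedCell ν) : u.col < N :=
    lt_of_lt_of_le u.col_lt
      (Finset.single_le_sum (f := fun a => a + ν a) (fun _ _ => Nat.zero_le _)
        (Finset.mem_range.2 (hrow u)))
  refine Finite.of_injective
    (fun u => ((⟨u.row, hrow u⟩, ⟨u.col, hN u⟩) : Fin d × Fin N)) ?_
  intro u v h
  simp only [Prod.mk.injEq, Fin.mk.injEq] at h
  exact ShiftedCell.ext h.1 h.2

/-- The off-diagonal cells form a shifted diagram with rows shorter by one. -/
def offCellEquiv (ν : ℕ → ℕ) : ShiftedCell (fun a => ν a - 1) ≃ OffCell ν where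
  toFun u := ⟨⟨u.row, u.col + 1, by have := u.row_le_col; omega, by
    have h1 := u.row_le_col
    have h2 := u.col_lt
    omega⟩, by
    have := u.row_le_col
    simp only
    omega⟩
  invFun u := ⟨u.1.row, u.1.col - 1, by
    have h1 := u.1.row_le_col
    have h2 := u.2
    omega, by
    have h1 := u.1.row_le_col
    have h2 := u.1.col_lt
    have h3 := u.2
    omega⟩
  left_inv u := by
    ext <;> simp
  right_inv u := by
    have h1 := u.1.row_le_col
    have h2 := u.2
    refine Subtype.ext (ShiftedCell.ext rfl ?_)
    simp only
    omega

/-- The first superdiagonal `E` of a filling with diagonal `D` interlaces `D`. -/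
def Interlaces {d e : ℕ} (D : Fin d → ℕ) (E : Fin e → ℕ) : Prop :=
  ∀ (a : Fin e) (b : Fin d), ((b : ℕ) = a → D b ≤ E a) ∧ ((b : ℕ) = a + 1 → E a ≤ D b)

section Peel

variable {ν : ℕ → ℕ} {d e : ℕ} {D : Fin d → ℕ}

/-- The filling obtained by removing the diagonal. -/
def Filling.tail (c : Filling ν D) : ShiftedCell (fun a => ν a - 1) → ℕ :=
  fun u => c.1 (offCellEquiv ν u).1

/-- The diagonal cell in row `a`. -/
def diagCell {μ : ℕ → ℕ} (hμ : ∀ a, 0 < μ a ↔ a < e) (a : Fin e) : ShiftedCell μ :=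
  ⟨a, a, le_rfl, by have := (hμ a).2 a.isLt; omega⟩

/-- Put a new diagonal in front of a filling. -/
def consDiag (hν : ∀ a, 0 < ν a ↔ a < d) (D : Fin d → ℕ)
    (c : ShiftedCell (fun a => ν a - 1) → ℕ) (u : ShiftedCell ν) : ℕ :=
  if h : u.row = u.col then
    D ⟨u.row, by
      rw [← hν]
      have := u.col_lt
      omega⟩
  else c ((offCellEquiv ν).symm ⟨u, h⟩)

lemma consDiag_diag (hν : ∀ a, 0 < ν a ↔ a < d) (c : ShiftedCell (fun a => ν a - 1) → ℕ)
    {u : ShiftedCell ν} (h : u.row = u.col) (hd : u.row < d) : consDiag hν D c u = D ⟨u.row, hd⟩ :=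
  dif_pos h

lemma consDiag_off (hν : ∀ a, 0 < ν a ↔ a < d) (c : ShiftedCell (fun a => ν a - 1) → ℕ)
    {u : ShiftedCell ν} (h : ¬ u.row = u.col) :
    consDiag hν D c u = c ((offCellEquiv ν).symm ⟨u, h⟩) :=
  dif_neg h

lemma row_lt_of_pos_iff {μ : ℕ → ℕ} (hμ : ∀ a, 0 < μ a ↔ a < e) (u : ShiftedCell μ) : u.row < e := by
  rw [← hμ]
  have h1 := u.row_le_col
  have h2 := u.col_lt
  omega

/-- An off-diagonal cell is compared with a diagonal one through the superdiagonal cell in its own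
column (if it is the larger element) or in its own row (if it is the smaller one); there interlacing
and the monotonicity of `D` apply. -/
lemma consDiag_anti (hν : ∀ a, 0 < ν a ↔ a < d) (he : ∀ a, 0 < ν a - 1 ↔ a < e) (hde : d ≤ e + 1)
    (hD : Monotone D) {E : Fin e → ℕ} (hE : Interlaces D E) (c : Filling (fun a => ν a - 1) E)
    (u v : ShiftedCell ν) (huv : u ≤ v) : consDiag hν D c.1 v ≤ consDiag hν D c.1 u := by
  have hu := row_lt_of_pos_iff hν u
  have hv := row_lt_of_pos_iff hν v
  have hu1 := u.row_le_col
  have hv1 := v.row_le_col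
  obtain ⟨h1, h2⟩ := huv
  by_cases hud : u.row = u.col <;> by_cases hvd : v.row = v.col
  · rw [consDiag_diag hν _ hud hu, consDiag_diag hν _ hvd hv]
    exact hD h1
  · rw [consDiag_diag hν _ hud hu, consDiag_off hν _ hvd]
    have hb : v.col - 1 < e := by omega
    have h3 := c.2.1 (diagCell he ⟨v.col - 1, hb⟩) ((offCellEquiv ν).symm ⟨v, hvd⟩)
      ⟨by change v.row ≤ v.col - 1; omega, le_rfl⟩
    rw [c.2.2 (diagCell he ⟨v.col - 1, hb⟩) hb rfl] at h3
    refine h3.trans (le_trans ((hE ⟨v.col - 1, hb⟩ ⟨v.col, by omega⟩).2 ?_) (hD ?_))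
    · simp only
      omega
    · simp only [Fin.mk_le_mk]
      omega
  · rw [consDiag_off hν _ hud, consDiag_diag hν _ hvd hv]
    have hb : u.row < e := by
      rw [← he]
      have := u.col_lt
      omega
    have h3 := c.2.1 ((offCellEquiv ν).symm ⟨u, hud⟩) (diagCell he ⟨u.row, hb⟩)
      ⟨le_rfl, by change u.row ≤ u.col - 1; omega⟩
    rw [c.2.2 (diagCell he ⟨u.row, hb⟩) hb rfl] at h3
    exact le_trans (le_trans (hD h1) ((hE ⟨u.row, hb⟩ ⟨u.row, hu⟩).1 rfl)) h3
  · rw [consDiag_off hν _ hud, consDiag_off hν _ hvd]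
    refine c.2.1 _ _ ⟨h1, ?_⟩
    change v.col - 1 ≤ u.col - 1
    omega

/-- A filling with diagonal `D` is given by its first superdiagonal and the filling without the
diagonal. -/
def fillingEquiv (hν : ∀ a, 0 < ν a ↔ a < d) (he : ∀ a, 0 < ν a - 1 ↔ a < e) (hde : d ≤ e + 1)
    (hD : Monotone D) :
    (Σ E : {E : Fin e → ℕ // Interlaces D E}, Filling (fun a => ν a - 1) E.1) ≃ Filling ν D where
  toFun x := ⟨consDiag hν D x.2.1, consDiag_anti hν he hde hD x.1.2 x.2,
    fun _ h hu => consDiag_diag hν _ hu h⟩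
  invFun c := ⟨⟨fun a => c.tail (diagCell he a), by
      intro a b
      have hb : c.1 (diagCell hν b) = D b := c.2.2 _ b.isLt rfl
      constructor
      · intro h
        rw [← hb]
        exact c.2.1 _ _ ⟨show (b : ℕ) ≤ a by omega, show (b : ℕ) ≤ a + 1 by omega⟩
      · intro h
        rw [← hb]
        exact c.2.1 _ _ ⟨show (a : ℕ) ≤ b by omega, show (a : ℕ) + 1 ≤ b by omega⟩⟩,
    ⟨c.tail, by
      refine ⟨fun u v huv => c.2.1 _ _ ⟨huv.1, Nat.succ_le_succ huv.2⟩, fun u h hu => ?_⟩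
      congr 1
      exact ShiftedCell.ext rfl hu.symm⟩⟩
  left_inv x := by
    obtain ⟨⟨E, hE⟩, c⟩ := x
    have h1 : ∀ u, consDiag hν D c.1 (offCellEquiv ν u).1 = c.1 u := by
      intro u
      rw [consDiag_off hν _ (offCellEquiv ν u).2]
      congr 1
    have h2 : (fun a => Filling.tail ⟨consDiag hν D c.1, consDiag_anti hν he hde hD hE c,
        fun _ h hu => consDiag_diag hν _ hu h⟩ (diagCell he a)) = E := by
      funext a
      exact (h1 _).trans (c.2.2 (diagCell he a) a.isLt rfl)
    -- The type of the filling depends on the superdiagonal, so equality is proved for a variable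
    -- `E'` that can be substituted.
    have h3 : ∀ (E' : Fin e → ℕ) (hE' : Interlaces D E') (c' : Filling (fun a => ν a - 1) E'),
        E' = E → c'.1 = c.1 →
        (⟨⟨E', hE'⟩, c'⟩ : Σ E : {E : Fin e → ℕ // Interlaces D E}, Filling (fun a => ν a - 1) E.1)
          = ⟨⟨E, hE⟩, c⟩ := by
      rintro E' hE' c' rfl hc
      congr 1
      exact Subtype.ext hc
    exact h3 _ _ _ h2 (funext h1)
  right_inv c := by
    refine Subtype.ext (funext fun u => ?_)
    change consDiag hν D c.tail u = c.1 u
    by_cases hu : u.row = u.col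
    · rw [consDiag_diag hν _ hu (row_lt_of_pos_iff hν u), c.2.2 u (row_lt_of_pos_iff hν u) hu]
    · rw [consDiag_off hν _ hu]
      change c.1 _ = c.1 u
      rw [Equiv.apply_symm_apply]

/-- Removing the diagonal shifts columns but keeps rows, so the added row index, which makes columns
strict, is compatible with the recursion. -/
lemma sum_offCell_consDiag (hν : ∀ a, 0 < ν a ↔ a < d) (he : ∀ a, 0 < ν a - 1 ↔ a < e)
    {E : Fin e → ℕ} (c : Filling (fun a => ν a - 1) E) [Fintype (OffCell ν)]
    [Fintype (OffCell fun a => ν a - 1)] :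
    ∑ u : OffCell ν, (consDiag hν D c.1 u.1 + u.1.row) =
      ∑ a, (E a + a) + ∑ u : OffCell fun a => ν a - 1, (c.1 u.1 + u.1.row) := by
  classical
  have := Fintype.ofEquiv _ (offCellEquiv ν).symm
  rw [← (offCellEquiv ν).sum_comp,
    ← Fintype.sum_subtype_add_sum_subtype (fun u : ShiftedCell (fun a => ν a - 1) => u.row = u.col)]
  have h1 : ∀ u, consDiag hν D c.1 (offCellEquiv ν u).1 = c.1 u := by
    intro u
    rw [consDiag_off hν _ (offCellEquiv ν u).2]
    congr 1
  have h2 : ∀ u, (offCellEquiv ν u).1.row = u.row := fun u => rfl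
  simp only [h1, h2]
  congr 1
  · let f : Fin e ≃ {u : ShiftedCell (fun a => ν a - 1) // u.row = u.col} :=
      { toFun := fun a => ⟨diagCell he a, rfl⟩
        invFun := fun u => ⟨u.1.row, row_lt_of_pos_iff he u.1⟩
        left_inv := fun a => rfl
        right_inv := fun u => Subtype.ext (ShiftedCell.ext rfl u.2) }
    rw [← f.sum_comp]
    refine Finset.sum_congr rfl fun a _ => ?_
    rw [c.2.2 (f a).1 a.isLt rfl]
    rfl
  · congr!

end Peel

end HookInsets

namespace HookInsets

/-! ### Sums over interlacing tuples and the generating function of fillings with a fixed diagonal.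
-/

lemma hasSum_geometric_from {x : ℝ} (hx : 0 ≤ x) (hx1 : x < 1) (a i : ℕ) :
    HasSum (fun e : ℕ => if a ≤ e then x ^ (e + i) else 0) (x ^ (a + i) / (1 - x)) := by
  have h := (hasSum_geometric_of_lt_one hx hx1).mul_left (x ^ (a + i))
  have hinj : Function.Injective fun e : ℕ => a + e := fun _ _ h => Nat.add_left_cancel h
  rw [← div_eq_mul_inv] at h
  rw [← hinj.hasSum_iff]
  · refine h.congr_fun fun e => ?_
    simp only [Function.comp_apply, Nat.le_add_right, if_true, ← pow_add]
    congr 1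
    ring
  · intro e he
    refine if_neg fun hae => he ⟨e - a, ?_⟩
    simp only
    omega

lemma hasSum_geometric_Icc {x : ℝ} (hx : 0 ≤ x) (hx1 : x < 1) {a b : ℕ} (hab : a ≤ b) (i : ℕ) :
    HasSum (fun e : ℕ => if a ≤ e ∧ e ≤ b then x ^ (e + i) else 0)
      ((x ^ (a + i) - x ^ (b + 1 + i)) / (1 - x)) := by
  have h := (hasSum_geometric_from hx hx1 a i).sub (hasSum_geometric_from hx hx1 (b + 1) i)
  rw [← sub_div] at h
  refine h.congr_fun fun e => ?_
  by_cases h1 : a ≤ e <;> by_cases h2 : e ≤ b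
  · rw [if_pos ⟨h1, h2⟩, if_pos h1, if_neg (by omega), sub_zero]
  · rw [if_neg (fun h => h2 h.2), if_pos h1, if_pos (by omega), sub_self]
  · rw [if_neg (fun h => h1 h.1), if_neg h1, if_neg (by omega), sub_zero]
  · omega

/-- Reversing rows and columns turns subtraction of the next row into subtraction of the preceding
one; the unchanged last row becomes the first. -/
lemma det_sub_next {r : ℕ} (A : Fin (r + 1) → Fin (r + 1) → ℝ) :
    (Matrix.of fun i j => (Fin.lastCases (A (Fin.last r) j)
      (fun i => A i.castSucc j - A i.succ j) i : ℝ)).det = (Matrix.of A).det := by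
  rw [← Matrix.det_submatrix_equiv_self Fin.revPerm (Matrix.of A),
    ← Matrix.det_submatrix_equiv_self Fin.revPerm]
  symm
  refine Matrix.det_eq_of_forall_row_eq_smul_add_pred (fun _ => 1) ?_ ?_
  · intro j
    simp
  · intro i j
    simp [Fin.rev_succ, Fin.rev_castSucc]

/-- After taking differences of consecutive rows, the last column is zero except for its bottom
entry. -/
lemma det_last_column_one {r : ℕ} (A : Fin (r + 1) → Fin (r + 1) → ℝ)
    (hA : ∀ i, A i (Fin.last r) = 1) :
    (Matrix.of A).det =
      (Matrix.of fun i j : Fin r => A i.castSucc j.castSucc - A i.succ j.castSucc).det := by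
  rw [← det_sub_next, Matrix.det_succ_column _ (Fin.last r), Fin.sum_univ_castSucc]
  simp only [Matrix.of_apply, Fin.lastCases_castSucc, Fin.lastCases_last, hA, sub_self, mul_zero,
    zero_mul, Finset.sum_const_zero, zero_add, mul_one]
  rw [Even.neg_one_pow ⟨_, rfl⟩, one_mul]
  congr 1
  ext i j
  simp [Fin.succAbove_last]

/-- The indicator of `Interlaces` splits over the entries. -/
lemma hasSum_interlaces {d e : ℕ} (D : Fin d → ℕ) (f : Fin e → Fin e → ℕ → ℝ)
    (F : Fin e → Fin e → ℝ)
    (h : ∀ i j : Fin e, HasSum (fun x : ℕ => if (∀ b : Fin d, ((b : ℕ) = i → D b ≤ x) ∧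
      ((b : ℕ) = i + 1 → x ≤ D b)) then f i j x else 0) (F i j)) :
    HasSum (fun E : {E : Fin e → ℕ // Interlaces D E} => (Matrix.of fun i j => f i j (E.1 i)).det)
      (Matrix.of F).det := by
  classical
  have h1 := hasSum_det _ _ h
  have hinj : Function.Injective (Subtype.val : {E : Fin e → ℕ // Interlaces D E} → _) :=
    Subtype.val_injective
  rw [← hinj.hasSum_iff] at h1
  · refine h1.congr_fun fun E => ?_
    simp only [Function.comp_apply]
    congr 1
    ext i j
    simp only [Matrix.of_apply]
    exact (if_pos (E.2 i)).symm
  · intro E hE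
    have : ¬ Interlaces D E := fun h => hE ⟨⟨E, h⟩, rfl⟩
    simp only [Interlaces, not_forall] at this
    obtain ⟨i, b, hb⟩ := this
    refine Matrix.det_eq_zero_of_row_eq_zero i fun j => ?_
    exact if_neg fun h => hb (h b)

/-- The sum over all interlacing tuples when the new tuple is as long as the given one. -/
lemma hasSum_interlaces_same {r : ℕ} (D : Fin (r + 1) → ℕ) (hD : Monotone D)
    (x : Fin (r + 1) → ℝ) (hx : ∀ j, 0 ≤ x j) (hx1 : ∀ j, x j < 1) :
    HasSum (fun E : {E : Fin (r + 1) → ℕ // Interlaces D E} =>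
        (Matrix.of fun i j => x j ^ (E.1 i + i)).det)
      ((Matrix.of fun i j => x j ^ (D i + i)).det / ∏ j, (1 - x j)) := by
  -- The sum over `D i ≤ y ≤ D (i + 1)` is a difference of consecutive rows of the matrix `x j ^ (D
  -- i + i)`: the extra `+ 1` from the end of the geometric sum is the step of the staircase. The
  -- last row has no upper bound and yields that row itself.
  have h := hasSum_interlaces (e := r + 1) D (fun i j y => x j ^ (y + i))
    (fun i j => (1 - x j)⁻¹ * (Fin.lastCases (x j ^ (D (Fin.last r) + r))
      (fun i => x j ^ (D i.castSucc + i) - x j ^ (D i.succ + (i + 1))) i : ℝ)) ?_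
  · rw [det_of_mul_row] at h
    have h2 := det_sub_next (fun i j => x j ^ (D i + i))
    simp only [Fin.val_last, Fin.val_castSucc, Fin.val_succ] at h2
    rw [h2, Finset.prod_inv_distrib, mul_comm, ← div_eq_mul_inv] at h
    exact h
  · intro i j
    refine Fin.lastCases ?_ (fun i => ?_) i
    · rw [Fin.lastCases_last, mul_comm, ← div_eq_mul_inv]
      refine (hasSum_geometric_from (hx j) (hx1 j) _ r).congr_fun fun y => ?_
      simp only [Fin.val_last]
      refine if_congr ⟨fun h => (h (Fin.last r)).1 rfl, fun h b => ⟨fun hb => ?_, fun hb => ?_⟩⟩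
        rfl rfl
      · rwa [show b = Fin.last r from Fin.ext hb]
      · omega
    · rw [Fin.lastCases_castSucc, mul_comm, ← div_eq_mul_inv,
        show D i.succ + ((i : ℕ) + 1) = D i.succ + 1 + i by ring]
      refine (hasSum_geometric_Icc (hx j) (hx1 j) (hD (Fin.castSucc_lt_succ (i := i)).le) _).congr_fun
        fun y => ?_
      simp only [Fin.val_castSucc]
      refine if_congr ⟨fun h => ⟨(h i.castSucc).1 rfl, (h i.succ).2 rfl⟩,
        fun h b => ⟨fun hb => ?_, fun hb => ?_⟩⟩ rfl rfl
      · rw [show b = i.castSucc from Fin.ext hb]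
        exact h.1
      · rw [show b = i.succ from Fin.ext hb]
        exact h.2

/-- The sum over all interlacing tuples when the new tuple is shorter by one. -/
lemma hasSum_interlaces_shorter {r : ℕ} (D : Fin (r + 1) → ℕ) (hD : Monotone D)
    (x : Fin (r + 1) → ℝ) (hx : ∀ j : Fin r, 0 ≤ x j.castSucc) (hx1 : ∀ j : Fin r, x j.castSucc < 1)
    (hlast : x (Fin.last r) = 1) :
    HasSum (fun E : {E : Fin r → ℕ // Interlaces D E} =>
        (Matrix.of fun i j : Fin r => x j.castSucc ^ (E.1 i + i)).det)
      ((Matrix.of fun i j => x j ^ (D i + i)).det / ∏ j : Fin r, (1 - x j.castSucc)) := by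
  have h := hasSum_interlaces (e := r) D (fun i j y => x j.castSucc ^ (y + i))
    (fun i j => (1 - x j.castSucc)⁻¹ *
      (x j.castSucc ^ (D i.castSucc + i) - x j.castSucc ^ (D i.succ + (i + 1)))) ?_
  · rw [det_of_mul_row] at h
    -- Every row now has an upper bound, so the differences form an `r` by `r` matrix; the column of
    -- ones from the last base `1` completes it to the full determinant.
    have h2 := det_last_column_one (fun i j => x j ^ (D i + i)) (by simp [hlast])
    simp only [Fin.val_castSucc, Fin.val_succ] at h2
    rw [← h2, Finset.prod_inv_distrib, mul_comm, ← div_eq_mul_inv] at h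
    exact h
  · intro i j
    rw [mul_comm, ← div_eq_mul_inv, show D i.succ + ((i : ℕ) + 1) = D i.succ + 1 + i by ring]
    refine (hasSum_geometric_Icc (hx j) (hx1 j) (hD (Fin.castSucc_lt_succ (i := i)).le) _).congr_fun
      fun y => ?_
    refine if_congr ⟨fun h => ⟨(h i.castSucc).1 rfl, (h i.succ).2 rfl⟩,
      fun h b => ⟨fun hb => ?_, fun hb => ?_⟩⟩ rfl rfl
    · rw [show b = i.castSucc from Fin.ext hb]
      exact h.1
    · rw [show b = i.succ from Fin.ext hb]
      exact h.2

/-- The denominator `∏_j (q; q)_{m_j}`. -/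
noncomputable def qFactProd (q : ℝ) {d : ℕ} (m : Fin d → ℕ) : ℝ :=
  ∏ j, ∏ i ∈ Finset.range (m j), (1 - q ^ (i + 1))

/-- The inductive step of `hasSum_filling`. -/
lemma hasSum_filling_step {q : ℝ} (hq : 0 < q) {ν : ℕ → ℕ} {d e : ℕ} {D : Fin d → ℕ}
    (hν : ∀ a, 0 < ν a ↔ a < d) (he : ∀ a, 0 < ν a - 1 ↔ a < e) (hde : d ≤ e + 1)
    (hD : Monotone D) [Fintype (OffCell ν)] [Fintype (OffCell fun a => ν a - 1)] {S : ℝ}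
    (ih : ∀ E : Fin e → ℕ, Monotone E →
      HasSum (fun c : Filling (fun a => ν a - 1) E =>
        q ^ (∑ u : OffCell fun a => ν a - 1, (c.1 u.1 + u.1.row)))
      ((Matrix.of fun i j : Fin e => q ^ ((E i + i) * (ν j - 1 - 1))).det /
        qFactProd q fun j : Fin e => ν j - 1 - 1))
    (hS : HasSum (fun E : {E : Fin e → ℕ // Interlaces D E} =>
        (Matrix.of fun i j : Fin e => (q ^ (ν j - 1)) ^ (E.1 i + i)).det) S) :
    HasSum (fun c : Filling ν D => q ^ (∑ u : OffCell ν, (c.1 u.1 + u.1.row)))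
      (S / qFactProd q fun j : Fin e => ν j - 1 - 1) := by
  have hmono : ∀ E : Fin e → ℕ, Interlaces D E → Monotone E := by
    intro E hE
    rcases e with _ | e
    · exact fun a => a.elim0
    refine Fin.monotone_iff_le_succ.2 fun i => ?_
    have h1 : (i : ℕ) + 1 < d := by
      rw [← hν]
      have := (he (i + 1)).2 (by omega)
      omega
    exact ((hE i.castSucc ⟨i + 1, h1⟩).2 rfl).trans ((hE i.succ ⟨i + 1, h1⟩).1 rfl)
  rw [← (fillingEquiv hν he hde hD).hasSum_iff]
  refine hasSum_sigma_of_nonneg (fun x => (pow_pos hq _).le)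
    (g := fun E => q ^ (∑ a : Fin e, (E.1 a + (a : ℕ))) *
      ((Matrix.of fun i j : Fin e => q ^ ((E.1 i + i) * (ν j - 1 - 1))).det /
        qFactProd q fun j : Fin e => ν j - 1 - 1)) ?_ ?_
  · intro E
    refine ((ih E.1 (hmono _ E.2)).mul_left (q ^ (∑ a : Fin e, (E.1 a + (a : ℕ))))).congr_fun fun c => ?_
    rw [← pow_add, ← sum_offCell_consDiag hν he c]
    rfl
  · refine (hS.div_const _).congr_fun fun E => ?_
    -- The weight `q ^ (E i + i)` of the new diagonal multiplies row `i` and raises the base `q ^ (ν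
    -- j - 2)` to `q ^ (ν j - 1)`.
    rw [← mul_div_assoc, ← Finset.prod_pow_eq_pow_sum, ← det_of_mul_column]
    congr 3
    ext i j
    have h1 := (he j).2 j.isLt
    rw [← pow_add, ← pow_mul]
    congr 1
    obtain ⟨t, ht⟩ := Nat.exists_eq_add_of_lt h1
    rw [ht]
    simp only [zero_add, Nat.add_sub_cancel]
    ring

/-- The generating function of the fillings of a shifted diagram with a given diagonal. -/
theorem hasSum_filling {q : ℝ} (hq : 0 < q) (hq1 : q < 1) (N : ℕ) : ∀ (ν : ℕ → ℕ), ν 0 ≤ N →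
    ∀ (d : ℕ), (∀ a, 0 < ν a ↔ a < d) → (∀ a b, a < b → b < d → ν b < ν a) →
    ∀ (D : Fin d → ℕ), Monotone D → ∀ [Fintype (OffCell ν)],
    HasSum (fun c : Filling ν D => q ^ (∑ u : OffCell ν, (c.1 u.1 + u.1.row)))
      ((Matrix.of fun i j : Fin d => q ^ ((D i + i) * (ν j - 1))).det /
        qFactProd q fun j : Fin d => ν j - 1) := by
  induction N with
  | zero =>
    intro ν h0 d hν _ D _ _
    obtain rfl : d = 0 := by
      by_contra h
      have := (hν 0).2 (by omega)
      omega
    have hc : IsEmpty (ShiftedCell ν) := ⟨fun u => by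
      have := row_lt_of_pos_iff hν u
      omega⟩
    have : Unique (Filling ν D) :=
      { default := ⟨fun _ => 0, fun u => hc.elim u, fun u => hc.elim u⟩
        uniq := fun c => Subtype.ext (funext fun u => hc.elim u) }
    have h1 : ∀ c : Filling ν D, q ^ (∑ u : OffCell ν, (c.1 u.1 + u.1.row)) = 1 := by
      intro c
      have : IsEmpty (OffCell ν) := ⟨fun u => hc.elim u.1⟩
      simp
    simp only [h1]
    simp [qFactProd]
  | succ N ih =>
    intro ν h0 d hν hanti D hD _
    rcases d with _ | r
    · exact ih ν (by have := (hν 0).not.2 (by omega); omega) 0 hν hanti D hD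
    have hr := (hν r).2 (by omega)
    have hx : ∀ j : ℕ, 0 ≤ q ^ (ν j - 1) := fun j => (pow_pos hq _).le
    have hx1 : ∀ j : ℕ, 2 ≤ ν j → q ^ (ν j - 1) < 1 := fun j hj => pow_lt_one₀ hq.le hq1 (by omega)
    have hle : ∀ j, j < r + 1 → ν r ≤ ν j := fun j hj => by
      rcases (Nat.lt_succ_iff.1 hj).eq_or_lt with rfl | h
      · exact le_rfl
      · exact (hanti j r h (by omega)).le
    have hzero : ∀ j, r + 1 ≤ j → ν j = 0 := fun j hj => by
      have := (hν j).not.2 (by omega)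
      omega
    have hfact : ∀ (e : ℕ), (∀ j : Fin e, 2 ≤ ν j) → (qFactProd q fun j : Fin e => ν j - 1) =
        (∏ j : Fin e, (1 - q ^ (ν j - 1))) * qFactProd q fun j : Fin e => ν j - 1 - 1 := by
      intro e h
      rw [qFactProd, qFactProd, ← Finset.prod_mul_distrib]
      refine Finset.prod_congr rfl fun j _ => ?_
      obtain ⟨t, ht⟩ := Nat.exists_eq_add_of_le (h j)
      rw [ht, show 2 + t - 1 = t + 1 by omega, Nat.add_sub_cancel, Finset.prod_range_succ, mul_comm]
    have hfin : ∀ e, (∀ a, 0 < ν a - 1 ↔ a < e) → Finite (OffCell fun a => ν a - 1) := fun e he => by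
      have := finite_shiftedCell he
      infer_instance
    -- If the last row has at least two cells, the superdiagonal is as long as the diagonal. If it
    -- has one cell, the superdiagonal is shorter by one and the base `q ^ (ν r - 1)` equals `1`.
    by_cases h2 : 2 ≤ ν r
    · have he : ∀ a, 0 < ν a - 1 ↔ a < r + 1 := fun a => by
        rcases Nat.lt_or_ge a (r + 1) with h | h
        · have := hle a h
          omega
        · have := hzero a h
          omega
      have := hfin _ he
      have := Fintype.ofFinite (OffCell fun a => ν a - 1)
      have h3 := hasSum_filling_step hq hν he (by omega) hD
        (fun E hE => ih (fun a => ν a - 1) (by omega) (r + 1) he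
          (fun a b hab hb => by have := hanti a b hab hb; have := hle b hb; omega) E hE)
        (hasSum_interlaces_same D hD (fun j => q ^ (ν j - 1)) (fun j => hx j)
          fun j => hx1 j (h2.trans (hle j j.isLt)))
      rw [div_div, ← hfact _ fun j => h2.trans (hle j j.isLt)] at h3
      simpa only [← pow_mul, mul_comm] using h3
    · have hr1 : ν r = 1 := by omega
      have hgt : ∀ j, j < r → 2 ≤ ν j := fun j hj => by
        have := hanti j r hj (by omega)
        omega
      have he : ∀ a, 0 < ν a - 1 ↔ a < r := fun a => by
        rcases Nat.lt_trichotomy a r with h | rfl | h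
        · have := hgt a h
          omega
        · omega
        · have := hzero a h
          omega
      have := hfin _ he
      have := Fintype.ofFinite (OffCell fun a => ν a - 1)
      have h3 := hasSum_filling_step hq hν he (by omega) hD
        (fun E hE => ih (fun a => ν a - 1) (by omega) r he
          (fun a b hab hb => by
            have := hanti a b hab (by omega)
            have := hgt b hb
            omega) E hE)
        (hasSum_interlaces_shorter D hD (fun j => q ^ (ν j - 1)) (fun j => hx j)
          (fun j => hx1 j (hgt j j.isLt)) (by simp [hr1]))
      simp only [Fin.val_castSucc] at h3
      rw [div_div, ← hfact _ fun j => hgt j j.isLt] at h3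
      have h4 : (qFactProd q fun j : Fin (r + 1) => ν j - 1) = qFactProd q fun j : Fin r => ν j - 1 := by
        rw [qFactProd, Fin.prod_univ_castSucc]
        simp [hr1, qFactProd]
      rw [h4]
      simpa only [← pow_mul, mul_comm] using h3

end HookInsets

namespace HookInsets

/-! ### The `P`-partition generating function as a sum over the diagonal -/

section Rows

variable {n : ℕ} (A : Attachment n)

lemma Attachment.rows_pos_iff (a : ℕ) : 0 < A.rows a ↔ a < A.len := by
  simp only [Attachment.rows, staircase]
  constructor
  · intro h
    by_contra h1
    have := A.shape.part_eq_zero a (by omega)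
    omega
  · intro h
    omega

lemma Attachment.rows_strictAnti (a b : ℕ) (hab : a < b) (hb : b < A.len) : A.rows b < A.rows a := by
  have := A.shape.antitone_part hab.le
  simp only [Attachment.rows, staircase]
  omega

lemma Attachment.rows_sub_one (a : Fin A.len) : A.rows a - 1 = A.shape.exps a := by
  have := a.isLt
  simp only [Attachment.rows, Par.exps, staircase]
  omega

instance : Finite (ShiftedCell A.rows) := finite_shiftedCell A.rows_pos_iff

noncomputable instance : Fintype (OffCell A.rows) := Fintype.ofFinite _

/-- The off-diagonal cells, row by row. -/
def Attachment.offCellRowsEquiv : (Σ a : Fin A.len, Fin (A.shape.exps a)) ≃ OffCell A.rows where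
  toFun x := ⟨⟨x.1, x.1 + x.2 + 1, by omega, by
    have h1 := x.2.isLt
    have h2 := A.rows_sub_one x.1
    omega⟩, by
    simp only
    omega⟩
  invFun u := ⟨⟨u.1.row, row_lt_of_pos_iff A.rows_pos_iff u.1⟩, ⟨u.1.col - u.1.row - 1, by
    have h1 := A.rows_sub_one ⟨u.1.row, row_lt_of_pos_iff A.rows_pos_iff u.1⟩
    have h2 := u.1.row_le_col
    have h3 := u.1.col_lt
    have h4 := u.2
    simp only at h1
    omega⟩⟩
  left_inv x := by
    obtain ⟨a, i⟩ := x
    have : (a : ℕ) + i + 1 - a - 1 = i := by omega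
    simp only [Fin.eta, Sigma.mk.injEq, heq_eq_eq, true_and]
    exact Fin.ext this
  right_inv u := by
    have h1 := u.1.row_le_col
    have h2 := u.2
    refine Subtype.ext (ShiftedCell.ext rfl ?_)
    simp only
    omega

lemma Attachment.sum_row : ∑ u : OffCell A.rows, u.1.row = ∑ a : Fin A.len, (a : ℕ) * A.shape.exps a := by
  rw [← A.offCellRowsEquiv.sum_comp, Fintype.sum_sigma]
  refine Finset.sum_congr rfl fun a _ => ?_
  simp [Attachment.offCellRowsEquiv, mul_comm]

/-- The row indices added in the recursion do not depend on the filling, so their power of `q` is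
divided out. -/
lemma Attachment.hasSum_filling {q : ℝ} (hq : 0 < q) (hq1 : q < 1) (D : Fin A.len → ℕ)
    (hD : Monotone D) :
    HasSum (fun c : Filling A.rows D => q ^ (∑ u : OffCell A.rows, c.1 u.1))
      ((Matrix.of fun i j : Fin A.len => q ^ ((D i + i) * A.shape.exps j)).det /
        (q ^ (∑ a : Fin A.len, (a : ℕ) * A.shape.exps a) * qFactProd q A.shape.exps)) := by
  have h := HookInsets.hasSum_filling hq hq1 _ A.rows le_rfl A.len A.rows_pos_iff A.rows_strictAnti D hD
  simp only [A.rows_sub_one] at h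
  have h1 := h.div_const (q ^ (∑ a : Fin A.len, (a : ℕ) * A.shape.exps a))
  rw [div_div, mul_comm (qFactProd _ _)] at h1
  refine h1.congr_fun fun c => ?_
  rw [Finset.sum_add_distrib, A.sum_row, pow_add, mul_div_cancel_right₀ _ (pow_pos hq _).ne']

end Rows

variable {n r : ℕ} {X : Fin r → Attachment n} {m : ℕ}

/-- The elements of `P_n^m(X)` as a disjoint union. -/
def nodeEquiv (X : Fin r → Attachment n) (m : ℕ) :
    Node X m ≃ Fin n ⊕ (Σ i : Fin r, OffCell (X i).rows) ⊕ Fin m where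
  toFun
    | .diag t => Sum.inl t
    | .cell i u hu => Sum.inr (Sum.inl ⟨i, u, hu⟩)
    | .top j => Sum.inr (Sum.inr j)
  invFun
    | .inl t => .diag t
    | .inr (.inl x) => .cell x.1 x.2.1 x.2.2
    | .inr (.inr j) => .top j
  left_inv z := by cases z <;> rfl
  right_inv z := by rcases z with t | ⟨i, u⟩ | j <;> rfl

lemma prod_node {M : Type*} [CommMonoid M] (f : Node X m → M) :
    ∏ z, f z = (∏ t, f (.diag t)) *
      ((∏ i, ∏ u : OffCell (X i).rows, f (.cell i u.1 u.2)) * ∏ j, f (.top j)) := by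
  rw [← (nodeEquiv X m).symm.prod_comp, Fintype.prod_sum_type, Fintype.prod_sum_type,
    Fintype.prod_sigma]
  rfl

lemma sum_node {M : Type*} [AddCommMonoid M] (f : Node X m → M) :
    ∑ z, f z = (∑ t, f (.diag t)) +
      ((∑ i, ∑ u : OffCell (X i).rows, f (.cell i u.1 u.2)) + ∑ j, f (.top j)) :=
  prod_node (M := Multiplicative M) f

lemma le_of_gen {a b : Node X m} (h : Gen a b) : a ≤ b := Relation.ReflTransGen.single h

lemma antitone_of_gen {σ : Node X m → ℕ} (h : ∀ a b, Gen a b → σ b ≤ σ a) : Antitone σ := by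
  intro a b hab
  induction hab with
  | refl => exact le_rfl
  | tail _ h1 ih => exact (h _ _ h1).trans ih

/-- The index of the diagonal entry in row `a` of an attached diagram. -/
def Attachment.diagIndex (A : Attachment n) (a : Fin A.len) : Fin n :=
  ⟨A.start + A.len - 1 - a, by
    have h1 := A.len_pos
    have h2 := A.start_add_len_le
    omega⟩

lemma cellNode_diag (i : Fin r) (u : ShiftedCell (X i).rows) (h : u.row = u.col)
    (hl : u.row < (X i).len) :
    (cellNode i u : Node X m) = .diag ((X i).diagIndex ⟨u.row, hl⟩) := dif_pos h

lemma cellNode_off (i : Fin r) (u : ShiftedCell (X i).rows) (h : ¬ u.row = u.col) :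
    (cellNode i u : Node X m) = .cell i u h := dif_neg h

/-- The function on the poset that is given by a diagonal and off-diagonal fillings. -/
def glue (d : Fin n → ℕ) (c : ∀ i, Filling (X i).rows (d ∘ (X i).diagIndex)) : Node X 0 → ℕ
  | .diag t => d t
  | .cell i u _ => (c i).1 u
  | .top j => j.elim0

lemma glue_cellNode (d : Fin n → ℕ) (c : ∀ i, Filling (X i).rows (d ∘ (X i).diagIndex)) (i : Fin r)
    (u : ShiftedCell (X i).rows) : glue d c (cellNode i u) = (c i).1 u := by
  by_cases h : u.row = u.col
  · have hl := row_lt_of_pos_iff (X i).rows_pos_iff u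
    rw [cellNode_diag i u h hl, (c i).2.2 u hl h]
    rfl
  · rw [cellNode_off i u h]
    rfl

lemma glue_antitone (d : Fin n → ℕ) (hd : Antitone d)
    (c : ∀ i, Filling (X i).rows (d ∘ (X i).diagIndex)) : Antitone (glue d c) := by
  refine antitone_of_gen fun a b h => ?_
  cases h with
  | chain s t h => exact hd h
  | piece i u v h =>
    rw [glue_cellNode, glue_cellNode]
    exact (c i).2.1 _ _ h
  | attach t j => exact j.elim0
  | topChain j => exact j.elim0

/-- A `P`-partition without top chain is given by its diagonal and the fillings of the attached
diagrams. -/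
def ppartitionEquiv (X : Fin r → Attachment n) :
    (Σ d : {d : Fin n → ℕ // Antitone d}, ∀ i, Filling (X i).rows (d.1 ∘ (X i).diagIndex)) ≃
      PPartition (Node X 0) where
  toFun x := ⟨glue x.1.1 x.2, glue_antitone x.1.1 x.1.2 x.2⟩
  invFun σ := ⟨⟨fun t => σ.1 (.diag t), fun s t h => σ.2 (le_of_gen (.chain s t h))⟩,
    fun i => ⟨fun u => σ.1 (cellNode i u), fun u v h => σ.2 (le_of_gen (.piece i u v h)),
      fun u hl h => congrArg σ.1 (cellNode_diag i u h hl)⟩⟩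
  left_inv x := by
    obtain ⟨⟨d, hd⟩, c⟩ := x
    refine Sigma.ext rfl (heq_of_eq (funext fun i => Subtype.ext (funext fun u => ?_)))
    exact glue_cellNode d c i u
  right_inv σ := by
    refine Subtype.ext (funext fun z => ?_)
    cases z with
    | diag t => rfl
    | cell i u hu => exact congrArg σ.1 (cellNode_off i u hu)
    | top j => exact j.elim0

/-- The attached diagrams interact only through the diagonal, so for a fixed diagonal their
generating functions multiply. -/
theorem hasSum_ppartition_zero {q : ℝ} (hq : 0 < q) (hq1 : q < 1) {S : ℝ}
    (h : HasSum (fun d : {d : Fin n → ℕ // Antitone d} => q ^ (∑ t, d.1 t) *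
      ∏ i, ((Matrix.of fun a b : Fin (X i).len =>
        q ^ ((d.1 ((X i).diagIndex a) + a) * (X i).shape.exps b)).det /
        (q ^ (∑ a : Fin (X i).len, (a : ℕ) * (X i).shape.exps a) *
          qFactProd q (X i).shape.exps))) S) :
    HasSum (fun σ : PPartition (Node X 0) => q ^ σ.size) S := by
  rw [← (ppartitionEquiv X).hasSum_iff]
  refine hasSum_sigma_of_nonneg (fun x => (pow_pos hq _).le) (fun d => ?_) h
  have h1 := hasSum_pi _ _ fun i => (X i).hasSum_filling hq hq1 (d.1 ∘ (X i).diagIndex) (by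
    intro a b hab
    refine d.2 ?_
    simp only [Attachment.diagIndex, Fin.mk_le_mk]
    have : (a : ℕ) ≤ b := hab
    omega)
  refine (h1.mul_left (q ^ (∑ t, d.1 t))).congr_fun fun c => ?_
  rw [Finset.prod_pow_eq_pow_sum, ← pow_add]
  simp only [Function.comp_apply, PPartition.size]
  rw [sum_node]
  simp only [Finset.univ_eq_empty, Finset.sum_empty, add_zero]
  rfl

/-- The embedding of the poset into the one with one more top element. -/
def Node.lift : Node X m → Node X (m + 1)
  | .diag t => .diag t
  | .cell i u hu => .cell i u hu
  | .top j => .top j.castSucc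

lemma lift_cellNode (i : Fin r) (u : ShiftedCell (X i).rows) :
    (cellNode i u : Node X m).lift = cellNode i u := by
  unfold cellNode
  split_ifs <;> rfl

lemma lift_mono : Monotone (Node.lift : Node X m → Node X (m + 1)) := by
  intro a b hab
  induction hab with
  | refl => exact le_rfl
  | tail _ h ih =>
    refine ih.trans (le_of_gen ?_)
    cases h with
    | chain s t h => exact .chain s t h
    | piece i u v h =>
      rw [lift_cellNode, lift_cellNode]
      exact .piece i u v h
    | attach t j => exact .attach t _
    | topChain j j' h => exact .topChain _ _ (by simpa using h)

lemma le_top_last (z : Node X (m + 1)) : z ≤ .top (Fin.last m) := by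
  cases z with
  | diag t => exact le_of_gen (.attach t _)
  | cell i u hu =>
    have hl := row_lt_of_pos_iff (X i).rows_pos_iff u
    let v : ShiftedCell (X i).rows := diagCell (X i).rows_pos_iff ⟨u.row, hl⟩
    have h1 : (cellNode i u : Node X (m + 1)) ≤ cellNode i v :=
      le_of_gen (.piece i u v ⟨le_rfl, u.row_le_col⟩)
    rw [cellNode_off i u hu, cellNode_diag i v rfl hl] at h1
    exact h1.trans (le_of_gen (.attach _ _))
  | top j => exact le_of_gen (.topChain _ _ (Fin.le_last j))

/-- Add `v` to a `P`-partition and give the new top element the value `v`. -/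
def extendTop (v : ℕ) (σ : Node X m → ℕ) : Node X (m + 1) → ℕ
  | .diag t => σ (.diag t) + v
  | .cell i u hu => σ (.cell i u hu) + v
  | .top j => Fin.lastCases v (fun j => σ (.top j) + v) j

lemma extendTop_lift (v : ℕ) (σ : Node X m → ℕ) (z : Node X m) :
    extendTop v σ z.lift = σ z + v := by
  cases z with
  | diag t => rfl
  | cell i u hu => rfl
  | top j => simp [Node.lift, extendTop]

lemma extendTop_last (v : ℕ) (σ : Node X m → ℕ) : extendTop v σ (.top (Fin.last m)) = v := by
  simp [extendTop]

lemma exists_lift_or_last (z : Node X (m + 1)) : (∃ y : Node X m, y.lift = z) ∨ z = .top (Fin.last m) := by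
  cases z with
  | diag t => exact Or.inl ⟨.diag t, rfl⟩
  | cell i u hu => exact Or.inl ⟨.cell i u hu, rfl⟩
  | top j =>
    refine Fin.lastCases (Or.inr rfl) (fun j => Or.inl ⟨.top j, rfl⟩) j

lemma extendTop_antitone (v : ℕ) {σ : Node X m → ℕ} (hσ : Antitone σ) : Antitone (extendTop v σ) := by
  refine antitone_of_gen fun a b h => ?_
  cases h with
  | chain s t h => exact Nat.add_le_add_right (hσ (le_of_gen (.chain s t h))) v
  | piece i u u' h =>
    rw [← lift_cellNode, ← lift_cellNode, extendTop_lift, extendTop_lift]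
    exact Nat.add_le_add_right (hσ (le_of_gen (.piece i u u' h))) v
  | attach t j =>
    refine Fin.lastCases ?_ (fun j => ?_) j
    · rw [extendTop_last]
      exact Nat.le_add_left _ _
    · exact (extendTop_lift v σ (.top j)).trans_le
        (Nat.add_le_add_right (hσ (le_of_gen (.attach t j))) v)
  | topChain j j' h =>
    revert h
    refine Fin.lastCases (fun h => ?_) (fun j' h => ?_) j'
    · rw [extendTop_last]
      rcases exists_lift_or_last (Node.top j : Node X (m + 1)) with ⟨y, hy⟩ | hy
      · rw [← hy, extendTop_lift]
        exact Nat.le_add_left _ _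
      · rw [hy, extendTop_last]
    · obtain ⟨j, rfl⟩ := Fin.exists_castSucc_eq.2 (lt_of_le_of_lt h (Fin.castSucc_lt_last j')).ne
      change extendTop v σ (Node.lift (.top j')) ≤ extendTop v σ (Node.lift (.top j))
      rw [extendTop_lift, extendTop_lift]
      exact Nat.add_le_add_right (hσ (le_of_gen (.topChain _ _ (by simpa using h)))) v

/-- A `P`-partition of the poset with one more top element is given by the value at that element and
the differences. -/
def topEquiv (X : Fin r → Attachment n) (m : ℕ) :
    ℕ × PPartition (Node X m) ≃ PPartition (Node X (m + 1)) where
  toFun x := ⟨extendTop x.1 x.2.1, extendTop_antitone x.1 x.2.2⟩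
  invFun σ := (σ.1 (.top (Fin.last m)), ⟨fun z => σ.1 z.lift - σ.1 (.top (Fin.last m)),
    fun _ _ h => Nat.sub_le_sub_right (σ.2 (lift_mono h)) _⟩)
  left_inv x := by
    refine Prod.ext (extendTop_last _ _) (Subtype.ext (funext fun z => ?_))
    change extendTop x.1 x.2.1 z.lift - extendTop x.1 x.2.1 (.top (Fin.last m)) = x.2.1 z
    rw [extendTop_lift, extendTop_last, Nat.add_sub_cancel]
  right_inv σ := by
    refine Subtype.ext (funext fun z => ?_)
    change extendTop (σ.1 (.top (Fin.last m))) (fun z => σ.1 z.lift - σ.1 (.top (Fin.last m))) z = σ.1 z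
    rcases exists_lift_or_last z with ⟨y, rfl⟩ | rfl
    · rw [extendTop_lift]
      exact Nat.sub_add_cancel (σ.2 (le_top_last _))
    · rw [extendTop_last]

lemma sum_node_succ (f : Node X (m + 1) → ℕ) :
    ∑ z, f z = ∑ z : Node X m, f z.lift + f (.top (Fin.last m)) := by
  rw [sum_node, sum_node, Fin.sum_univ_castSucc]
  simp only [Node.lift]
  ring

lemma card_node : Fintype.card (Node X m) =
    n + (∑ i, ∑ a, (X i).shape.exps a) + m := by
  have h := sum_node (X := X) (m := m) (fun _ => 1)
  simp only [Finset.sum_const, Finset.card_univ, smul_eq_mul, mul_one, Fintype.card_fin] at h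
  rw [h]
  have h1 : ∀ i, Fintype.card (OffCell (X i).rows) = ∑ a, (X i).shape.exps a := by
    intro i
    rw [← Fintype.card_congr (X i).offCellRowsEquiv]
    simp
  simp only [h1]
  ring

/-- The new element is the maximum of the poset, so its value `v` is the least one. Subtracting `v`
everywhere removes `v` times the new cardinality from the size and leaves an arbitrary `P`-partition
of the old poset. -/
lemma hasSum_ppartition_succ {q : ℝ} (hq : 0 < q) (hq1 : q < 1) {S : ℝ}
    (h : HasSum (fun σ : PPartition (Node X m) => q ^ σ.size) S) :
    HasSum (fun σ : PPartition (Node X (m + 1)) => q ^ σ.size)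
      (S / (1 - q ^ (Fintype.card (Node X m) + 1))) := by
  have h1 := hasSum_geometric_of_lt_one (pow_pos hq (Fintype.card (Node X m) + 1)).le
    (pow_lt_one₀ hq.le hq1 (Nat.succ_ne_zero _))
  have h2 := hasSum_prod_mul h1 h
  rw [← (topEquiv X m).hasSum_iff, div_eq_inv_mul]
  refine h2.congr_fun fun x => ?_
  rw [← pow_mul, ← pow_add, Function.comp_apply, PPartition.size, PPartition.size, sum_node_succ]
  congr 1
  change ∑ z, extendTop x.1 x.2.1 (Node.lift z) + extendTop x.1 x.2.1 (.top (Fin.last m)) = _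
  simp only [extendTop_lift, extendTop_last]
  rw [Finset.sum_add_distrib, Finset.sum_const, Finset.card_univ, smul_eq_mul]
  ring

theorem hasSum_ppartition {q : ℝ} (hq : 0 < q) (hq1 : q < 1) {S : ℝ}
    (h : HasSum (fun σ : PPartition (Node X 0) => q ^ σ.size) S) (m : ℕ) :
    HasSum (fun σ : PPartition (Node X m) => q ^ σ.size)
      (S / ∏ j ∈ Finset.range m, (1 - q ^ (Fintype.card (Node X 0) + j + 1))) := by
  induction m with
  | zero => simpa using h
  | succ m ih =>
    have := hasSum_ppartition_succ hq hq1 ih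
    rw [div_div] at this
    rw [Finset.prod_range_succ]
    have e : Fintype.card (Node X m) = Fintype.card (Node X 0) + m := by
      rw [card_node, card_node, add_zero]
    rwa [e] at this

end HookInsets

namespace HookInsets

/-! ### The generating function of an inset -/

/-- Weakly decreasing tuples correspond to strictly increasing ones. -/
def antitoneEquivStrictMono (N : ℕ) :
    {s : Fin N → ℕ // StrictMono s} ≃ {d : Fin N → ℕ // Antitone d} where
  toFun s := ⟨fun t => s.1 t.rev - t.rev, by
    have h : ∀ (i : ℕ) (a b : Fin N), (b : ℕ) = a + i → s.1 a + i ≤ s.1 b := by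
      intro i
      induction i with
      | zero =>
        intro a b h
        rw [show b = a from Fin.ext h, add_zero]
      | succ i ih =>
        intro a b h
        have h1 := ih a ⟨a + i, by omega⟩ rfl
        have h2 : s.1 ⟨a + i, by omega⟩ < s.1 b := s.2 (by rw [Fin.lt_def]; simp only; omega)
        omega
    intro a b hab
    have h1 : (a : ℕ) ≤ b := hab
    have h2 := h (b - a) b.rev a.rev (by simp only [Fin.val_rev]; omega)
    simp only [Fin.val_rev]
    omega⟩
  invFun d := ⟨fun a => d.1 a.rev + a, by
    intro a b hab
    have h1 := d.2 (Fin.rev_le_rev.2 hab.le)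
    have h2 : (a : ℕ) < b := hab
    simp only
    omega⟩
  left_inv s := by
    refine Subtype.ext (funext fun a => ?_)
    have h : ∀ (i : ℕ) (hi : i < N), i ≤ s.1 ⟨i, hi⟩ := by
      intro i
      induction i with
      | zero => exact fun _ => Nat.zero_le _
      | succ i ih =>
        intro hi
        exact lt_of_le_of_lt (ih (by omega)) (s.2 (by rw [Fin.lt_def]; simp only; omega))
    simp only [Fin.rev_rev]
    exact Nat.sub_add_cancel (h a a.isLt)
  right_inv d := by
    refine Subtype.ext (funext fun a => ?_)
    simp

/-- The factor that an attached diagram contributes to the generating function. -/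
noncomputable def Attachment.factor {n : ℕ} (A : Attachment n) (q : ℝ) (d : Fin n → ℕ) : ℝ :=
  (Matrix.of fun a b : Fin A.len => q ^ ((d (A.diagIndex a) + a) * A.shape.exps b)).det /
    (q ^ (∑ a : Fin A.len, (a : ℕ) * A.shape.exps a) * qFactProd q A.shape.exps)

section

variable {p k : ℕ} {lam : Par p} {mu : Par (p + 2)}

/-- The denominator of the generating function that comes from the attached diagrams. -/
noncomputable def insetDenom (q : ℝ) (k : ℕ) (lam : Par p) (mu : Par (p + 2)) : ℝ :=
  qFactProd q mu.exps * qFactProd q lam.exps * ∏ i ∈ Finset.range k, (1 - q ^ (i + 1))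

lemma factor_mu {q : ℝ} (s : {s : Fin (p + 2) → ℕ // StrictMono s}) (h1 h2) :
    Attachment.factor (n := p + 2)
      { len := p + 2, len_pos := h1, shape := mu, start := 0, start_add_len_le := h2 } q
      (antitoneEquivStrictMono _ s).1 =
    (Matrix.of fun i j => q ^ (s.1 i * mu.exps j)).det /
      (q ^ (∑ a : Fin (p + 2), (a : ℕ) * mu.exps a) * qFactProd q mu.exps) := by
  rw [Attachment.factor]
  congr 2
  ext a b
  have h3 : Attachment.diagIndex (n := p + 2)
      { len := p + 2, len_pos := h1, shape := mu, start := 0, start_add_len_le := h2 } a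
      = a.rev := by
    ext
    simp only [Attachment.diagIndex, Fin.val_rev]
    omega
  have h4 := congrArg (fun s => s.1 a) ((antitoneEquivStrictMono _).symm_apply_apply s)
  rw [Matrix.of_apply, Matrix.of_apply, h3, ← h4]
  rfl

/-- Row `a` of this diagram sits at entry `a + 2` of the tuple, so its shift by `a` falls short of
the staircase by `2`; the difference is a factor `q ^ (2 * lam.exps b)` for each column. In
`factor_single` the shortfall is `1`. -/
lemma factor_lam {q : ℝ} (hq : 0 < q) (s : {s : Fin (p + 2) → ℕ // StrictMono s}) (h1 h2) :
    Attachment.factor (n := p + 2)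
      { len := p, len_pos := h1, shape := lam, start := 0, start_add_len_le := h2 } q
      (antitoneEquivStrictMono _ s).1 =
    (Matrix.of fun a b : Fin p => q ^ (s.1 a.succ.succ * lam.exps b)).det /
      (q ^ (∑ a : Fin p, ((a : ℕ) + 2) * lam.exps a) * qFactProd q lam.exps) := by
  rw [Attachment.factor]
  have h5 : (Matrix.of fun a b : Fin p => q ^ (s.1 a.succ.succ * lam.exps b)).det =
      q ^ (∑ a : Fin p, 2 * lam.exps a) * (Matrix.of fun a b : Fin p =>
        q ^ (((antitoneEquivStrictMono _ s).1 (Attachment.diagIndex (n := p + 2)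
      { len := p, len_pos := h1, shape := lam, start := 0, start_add_len_le := h2 } a) + a)
        * lam.exps b)).det := by
    rw [← Finset.prod_pow_eq_pow_sum, ← det_of_mul_row]
    congr 1
    ext a b
    have h3 : Attachment.diagIndex (n := p + 2)
        { len := p, len_pos := h1, shape := lam, start := 0, start_add_len_le := h2 } a
        = a.succ.succ.rev := by
      ext
      simp only [Attachment.diagIndex, Fin.val_rev, Fin.val_succ]
      omega
    have h4 : s.1 a.succ.succ = (antitoneEquivStrictMono _ s).1 a.succ.succ.rev
        + (a.succ.succ : Fin (p + 2)) :=
      (congrArg (fun s => s.1 a.succ.succ) ((antitoneEquivStrictMono _).symm_apply_apply s)).symm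
    rw [Matrix.of_apply, Matrix.of_apply, h3, h4, ← pow_add]
    congr 1
    simp only [Fin.val_succ]
    ring
  have h6 : ∑ a : Fin p, ((a : ℕ) + 2) * lam.exps a =
      ∑ a : Fin p, 2 * lam.exps a + ∑ a : Fin p, (a : ℕ) * lam.exps a := by
    rw [← Finset.sum_add_distrib]
    exact Finset.sum_congr rfl fun a _ => by ring
  rw [h5, h6, pow_add, mul_assoc (q ^ _), mul_div_mul_left _ _ (pow_pos hq _).ne']

lemma factor_single {q : ℝ} (hq : 0 < q) (s : {s : Fin (p + 2) → ℕ // StrictMono s}) (h1 h2) :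
    Attachment.factor (n := p + 2)
      { len := 1, len_pos := h1, shape := Par.single k, start := p, start_add_len_le := h2 } q
      (antitoneEquivStrictMono _ s).1 =
    q ^ (k * s.1 1) / (q ^ k * ∏ i ∈ Finset.range k, (1 - q ^ (i + 1))) := by
  have h3 : Attachment.diagIndex (n := p + 2)
      { len := 1, len_pos := h1, shape := Par.single k, start := p, start_add_len_le := h2 } 0
      = Fin.rev 1 := by
    ext
    simp [Attachment.diagIndex, Fin.val_rev]
  have h4 : s.1 1 = (antitoneEquivStrictMono _ s).1 (Fin.rev 1) + ((1 : Fin (p + 2)) : ℕ) :=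
    (congrArg (fun s => s.1 1) ((antitoneEquivStrictMono _).symm_apply_apply s)).symm
  have h5 : (Par.single k).exps 0 = k := rfl
  rw [Attachment.factor, Matrix.det_fin_one]
  simp only [Matrix.of_apply, Fin.val_zero, add_zero, Finset.univ_unique, Fin.default_eq_zero,
    Finset.sum_singleton, zero_mul, pow_zero, one_mul, qFactProd, Finset.prod_singleton]
  rw [h3, h5, h4, Fin.val_one, mul_add, mul_one, pow_add, mul_comm (q ^ (k * _)),
    mul_div_mul_left _ _ (pow_pos hq _).ne', mul_comm k]

/-- The staircase corrections of the three diagrams and of the diagonal weight add up to the very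
exponent in the monomial prefactor of `diagTotal`. -/
theorem hasSum_inset_zero (hn : 2 ≤ p + 1) {q : ℝ} (hq : 0 < q) (hq1 : q < 1) :
    HasSum (fun σ : PPartition (Node (insetData (p + 1) hn k lam mu) 0) => q ^ σ.size)
      (diagTotal q k mu.exps lam.exps /
        (q ^ (∑ j : Fin (p + 2), (j : ℕ) * mu.exps j + ∑ b : Fin p, ((b : ℕ) + 2) * lam.exps b +
          ∑ j ∈ Finset.range (p + 2), j + k) * insetDenom q k lam mu)) := by
  refine hasSum_ppartition_zero hq hq1 ?_
  have h0 := hasSum_diagWeight hq hq1 k mu.exps lam.exps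
  rw [det_baseMatrix hq hq1 k mu.exps_strictAnti lam.exps_strictAnti] at h0
  rw [← (antitoneEquivStrictMono _).hasSum_iff]
  refine (h0.div_const _).congr_fun fun s => ?_
  rw [Function.comp_apply, Fin.prod_univ_three]
  have e0 := factor_lam (lam := lam) hq s (by omega) (by omega)
  have e1 := factor_mu (mu := mu) (q := q) s (by omega) (by omega)
  have e2 := factor_single (k := k) hq s (by omega) (by omega)
  have e3 : ∑ i, s.1 i = ∑ t, (antitoneEquivStrictMono _ s).1 t + ∑ j ∈ Finset.range (p + 2), j := by
    have h4 : ∀ i, s.1 i = (antitoneEquivStrictMono _ s).1 (Fin.revPerm i) + (i : ℕ) := fun i =>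
      (congrArg (fun s => s.1 i) ((antitoneEquivStrictMono _).symm_apply_apply s)).symm
    rw [Finset.sum_congr rfl fun i _ => h4 i, Finset.sum_add_distrib, Finset.sum_range]
    congr 1
    exact Equiv.sum_comp Fin.revPerm _
  refine Eq.trans (congrArg _ (congrArg₂ _ (congrArg₂ _ e0 e1) e2)) ?_
  rw [diagWeight, insetDenom, e3]
  have hne := (pow_pos hq (∑ j ∈ Finset.range (p + 2), j)).ne'
  simp only [pow_add]
  rw [div_mul_div_comm, div_mul_div_comm, ← mul_div_assoc,
    ← mul_div_mul_left _ _ hne]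
  congr 1 <;> ring

end

end HookInsets

namespace HookInsets

/-! ### The order of an inset -/

/-- The poset of an inset, with a top chain of any length. -/
abbrev Inset {p : ℕ} (hn : 2 ≤ p + 1) (k : ℕ) (lam : Par p) (mu : Par (p + 2)) (m : ℕ) : Type :=
  Node (insetData (p + 1) hn k lam mu) m

/-- The cells `(a, b)` of the main part of an inset. The cells on and above the diagonal form the
shifted diagram of `mu`, those on and below it the transposed shifted diagram of `lam`, moved by
`(2, 2)`. -/
def InShape {p : ℕ} (lam : Par p) (mu : Par (p + 2)) (a b : ℕ) : Prop :=
  (a ≤ b ∧ a ≤ p + 1 ∧ b ≤ p + 1 + mu.part a) ∨ (b < a ∧ 2 ≤ b ∧ a ≤ p + 1 + lam.part (b - 2))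

section

variable {p : ℕ} {lam : Par p} {mu : Par (p + 2)}

lemma InShape.lower_col_le {a b : ℕ} (h : InShape lam mu a b) (hba : b < a) : b ≤ p + 1 := by
  obtain h | h := h
  · omega
  · by_contra hb
    have := lam.part_eq_zero (b - 2) (by omega)
    omega

/-- The cell of the diagram of `mu` at `(a, b)`. -/
def upperCell (hn : 2 ≤ p + 1) (k : ℕ) (lam : Par p) (mu : Par (p + 2)) (a b : ℕ) (h1 : a ≤ b)
    (h2 : a ≤ p + 1) (h3 : b ≤ p + 1 + mu.part a) :
    ShiftedCell (insetData (p + 1) hn k lam mu 1).rows :=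
  ⟨a, b, h1, by
    change b < a + (mu.part a + (p + 3 - 1 - a))
    omega⟩

/-- The cell of the diagram of `lam` at `(a, b)`. -/
def lowerCell (hn : 2 ≤ p + 1) (k : ℕ) (lam : Par p) (mu : Par (p + 2)) (a b : ℕ) (h1 : b ≤ a)
    (h2 : 2 ≤ b) (h3 : b ≤ p + 1) (h4 : a ≤ p + 1 + lam.part (b - 2)) :
    ShiftedCell (insetData (p + 1) hn k lam mu 0).rows :=
  ⟨b - 2, a - 2, by omega, by
    change a - 2 < b - 2 + (lam.part (b - 2) + (p + 1 - 1 - (b - 2)))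
    omega⟩

/-- The cell in column `c` of the diagram of `(k)`. -/
def chainCell (hn : 2 ≤ p + 1) (k : ℕ) (lam : Par p) (mu : Par (p + 2)) (c : ℕ) (h : c ≤ k) :
    ShiftedCell (insetData (p + 1) hn k lam mu 2).rows :=
  ⟨0, c, by omega, by
    change c < 0 + (k + (2 - 1 - 0))
    omega⟩

/-- The element of the inset at the position `(a, b)`. -/
def mainNode (hn : 2 ≤ p + 1) (k m : ℕ) {a b : ℕ} (h : InShape lam mu a b) : Inset hn k lam mu m :=
  if hab : a ≤ b then
    cellNode 1 (upperCell hn k lam mu a b hab (by obtain h | h := h <;> omega)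
      (by obtain h | h := h <;> omega))
  else
    cellNode 0 (lowerCell hn k lam mu a b (by omega) (by obtain h | h := h <;> omega)
      (h.lower_col_le (by omega)) (by obtain h | h := h <;> omega))

lemma mainNode_of_le (hn : 2 ≤ p + 1) (k m : ℕ) {a b : ℕ} (h : InShape lam mu a b) (hab : a ≤ b)
    (h2 h3) : mainNode hn k m h = cellNode 1 (upperCell hn k lam mu a b hab h2 h3) := dif_pos hab

lemma mainNode_of_lt (hn : 2 ≤ p + 1) (k m : ℕ) {a b : ℕ} (h : InShape lam mu a b) (hab : b < a)
    (h1 h2 h3 h4) : mainNode hn k m h = cellNode 0 (lowerCell hn k lam mu a b h1 h2 h3 h4) :=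
  dif_neg hab.not_ge

/-- The elements of the chain below `x_n`, counted from the top. -/
def chainNode (hn : 2 ≤ p + 1) (lam : Par p) (mu : Par (p + 2)) (m : ℕ) (c : Fin k) :
    Inset hn k lam mu m :=
  cellNode 2 (chainCell hn k lam mu (c + 1) c.isLt)

end

section

variable {p k : ℕ} {lam : Par p} {mu : Par (p + 2)} {hn : 2 ≤ p + 1} {m : ℕ}

/-- The row of an element in a drawing of an inset in the plane. -/
def row (z : Inset hn k lam mu m) : ℤ :=
  match z with
  | .diag t => p + 1 - (t : ℕ)
  | .cell i u _ =>
    -- The chain below `x_n` starts in row `lam.part 0 + p + 2`, just under the last cell of column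
    -- `2`, so the product order makes it incomparable to everything in the columns from `2` on.
    if i = 0 then u.col + 2 else if i = 1 then u.row else lam.part 0 + p + 1 + u.col
  | .top j => -(j + 1)

/-- The column of an element in a drawing of an inset in the plane. -/
def col (z : Inset hn k lam mu m) : ℤ :=
  match z with
  | .diag t => p + 1 - (t : ℕ)
  | .cell i u _ => if i = 0 then u.row + 2 else if i = 1 then u.col else 1
  | .top j => -(j + 1)

lemma upper_row_lt (u : ShiftedCell (insetData (p + 1) hn k lam mu 1).rows) : u.row < p + 2 :=
  row_lt_of_pos_iff (insetData (p + 1) hn k lam mu 1).rows_pos_iff u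

lemma lower_row_lt (u : ShiftedCell (insetData (p + 1) hn k lam mu 0).rows) : u.row < p :=
  row_lt_of_pos_iff (insetData (p + 1) hn k lam mu 0).rows_pos_iff u

lemma chain_row_lt (u : ShiftedCell (insetData (p + 1) hn k lam mu 2).rows) : u.row < 1 :=
  row_lt_of_pos_iff (insetData (p + 1) hn k lam mu 2).rows_pos_iff u

lemma upper_diag (u : ShiftedCell (insetData (p + 1) hn k lam mu 1).rows) (h : u.row = u.col) :
    (cellNode 1 u : Inset hn k lam mu m) = .diag ⟨p + 1 - u.row, by omega⟩ := by
  rw [cellNode_diag 1 u h (upper_row_lt u)]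
  congr 1
  ext
  change 0 + (p + 2) - 1 - u.row = p + 1 - u.row
  omega

lemma lower_diag (u : ShiftedCell (insetData (p + 1) hn k lam mu 0).rows) (h : u.row = u.col) :
    (cellNode 0 u : Inset hn k lam mu m) = .diag ⟨p - 1 - u.row, by omega⟩ := by
  rw [cellNode_diag 0 u h (lower_row_lt u)]
  congr 1
  ext
  change 0 + p - 1 - u.row = p - 1 - u.row
  omega

lemma chain_diag (u : ShiftedCell (insetData (p + 1) hn k lam mu 2).rows) (h : u.row = u.col) :
    (cellNode 2 u : Inset hn k lam mu m) = .diag ⟨p, by omega⟩ := by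
  have h1 := chain_row_lt u
  rw [cellNode_diag 2 u h h1]
  congr 1
  ext
  change p + 1 - 1 - u.row = p
  omega

lemma row_upper (u : ShiftedCell (insetData (p + 1) hn k lam mu 1).rows) :
    row (cellNode 1 u : Inset hn k lam mu m) = u.row := by
  have h1 := upper_row_lt u
  by_cases h : u.row = u.col
  · rw [upper_diag u h]
    simp only [row]
    omega
  · rw [cellNode_off 1 u h]
    rfl

lemma col_upper (u : ShiftedCell (insetData (p + 1) hn k lam mu 1).rows) :
    col (cellNode 1 u : Inset hn k lam mu m) = u.col := by
  have h1 := upper_row_lt u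
  by_cases h : u.row = u.col
  · rw [upper_diag u h]
    simp only [col]
    omega
  · rw [cellNode_off 1 u h]
    rfl

lemma row_lower (u : ShiftedCell (insetData (p + 1) hn k lam mu 0).rows) :
    row (cellNode 0 u : Inset hn k lam mu m) = u.col + 2 := by
  have h1 := lower_row_lt u
  by_cases h : u.row = u.col
  · rw [lower_diag u h]
    simp only [row]
    omega
  · rw [cellNode_off 0 u h]
    rfl

lemma col_lower (u : ShiftedCell (insetData (p + 1) hn k lam mu 0).rows) :
    col (cellNode 0 u : Inset hn k lam mu m) = u.row + 2 := by
  have h1 := lower_row_lt u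
  by_cases h : u.row = u.col
  · rw [lower_diag u h]
    simp only [col]
    omega
  · rw [cellNode_off 0 u h]
    rfl

lemma row_chain (u : ShiftedCell (insetData (p + 1) hn k lam mu 2).rows) :
    row (cellNode 2 u : Inset hn k lam mu m) =
      if u.col = 0 then 1 else (lam.part 0 + p + 1 + u.col : ℤ) := by
  have h1 := chain_row_lt u
  by_cases h : u.row = u.col
  · rw [chain_diag u h, if_pos (by omega)]
    simp only [row]
    omega
  · rw [cellNode_off 2 u h, if_neg (by omega)]
    rfl

lemma col_chain (u : ShiftedCell (insetData (p + 1) hn k lam mu 2).rows) :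
    col (cellNode 2 u : Inset hn k lam mu m) = 1 := by
  by_cases h : u.row = u.col
  · rw [chain_diag u h]
    simp only [col]
    omega
  · rw [cellNode_off 2 u h]
    rfl

lemma row_col_antitone {z w : Inset hn k lam mu m} (hzw : z ≤ w) : row w ≤ row z ∧ col w ≤ col z := by
  induction hzw with
  | refl => exact ⟨le_rfl, le_rfl⟩
  | tail _ h ih =>
    refine ⟨le_trans ?_ ih.1, le_trans ?_ ih.2⟩
    all_goals
      cases h with
      | chain s t h =>
        have : (s : ℕ) ≤ t := h
        simp only [row, col]
        omega
      | piece i u v h =>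
        obtain ⟨h1, h2⟩ := h
        match i with
        | 0 =>
          simp only [row_lower, col_lower]
          omega
        | 1 =>
          simp only [row_upper, col_upper]
          omega
        | 2 =>
          simp only [row_chain, col_chain]
          try split_ifs
          all_goals omega
      | attach t j =>
        have := t.isLt
        simp only [row, col]
        omega
      | topChain j j' h =>
        have : (j : ℕ) ≤ j' := h
        simp only [row, col]
        omega

lemma row_mainNode {a b : ℕ} (h : InShape lam mu a b) : row (mainNode hn k m h) = a := by
  unfold mainNode
  split_ifs with hab
  · exact row_upper _
  · rw [row_lower]
    obtain h | h := h
    · omega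
    · simp only [lowerCell]
      omega

lemma col_mainNode {a b : ℕ} (h : InShape lam mu a b) : col (mainNode hn k m h) = b := by
  unfold mainNode
  split_ifs with hab
  · exact col_upper _
  · rw [col_lower]
    obtain h | h := h
    · omega
    · simp only [lowerCell]
      omega

lemma row_top (j : Fin m) : row (.top j : Inset hn k lam mu m) = -((j : ℕ) + 1 : ℤ) := rfl

lemma col_top (j : Fin m) : col (.top j : Inset hn k lam mu m) = -((j : ℕ) + 1 : ℤ) := rfl

lemma row_chainNode (c : Fin k) :
    row (chainNode hn lam mu m c) = (lam.part 0 + p + 2 + (c : ℕ) : ℤ) := by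
  rw [chainNode, row_chain, if_neg (by simp [chainCell])]
  simp only [chainCell]
  omega

lemma col_chainNode (c : Fin k) : col (chainNode hn lam mu m c) = 1 := col_chain _

lemma lower_eq_upper (a : ℕ) (h1 h2 h3 h4 h5 h6 h7) :
    (cellNode 0 (lowerCell hn k lam mu a a h1 h2 h3 h4) : Inset hn k lam mu m) =
      cellNode 1 (upperCell hn k lam mu a a h5 h6 h7) := by
  rw [lower_diag _ rfl, upper_diag _ rfl]
  congr 1
  ext
  change p - 1 - (a - 2) = p + 1 - a
  omega

/-- Cells on different sides of the diagonal are compared through a diagonal cell with both indices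
at least `2`, which belongs to both diagrams by `lower_eq_upper`. -/
lemma mainNode_le_mainNode {a b a' b' : ℕ} (h : InShape lam mu a b) (h' : InShape lam mu a' b')
    (ha : a' ≤ a) (hb : b' ≤ b) : mainNode hn k m h ≤ mainNode hn k m h' := by
  unfold mainNode
  split_ifs with h1 h2 h2
  · exact le_of_gen (.piece 1 _ _ ⟨ha, hb⟩)
  · obtain h3 | h3 := h
    · have h4 : 2 ≤ a := by obtain h' | h' := h' <;> omega
      refine le_trans (le_of_gen (.piece 1 _ (upperCell hn k lam mu a a le_rfl h3.2.1 (by omega))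
        ⟨le_rfl, h1⟩)) ?_
      rw [← lower_eq_upper a le_rfl h4 h3.2.1 (by omega)]
      refine le_of_gen (.piece 0 _ _ ⟨?_, ?_⟩)
      · change b' - 2 ≤ a - 2
        omega
      · change a' - 2 ≤ a - 2
        omega
    · omega
  · have h3 := h.lower_col_le (by omega)
    have h4 : 2 ≤ b := by obtain h | h := h <;> omega
    refine le_trans (le_of_gen (.piece 0 _ (lowerCell hn k lam mu b b le_rfl h4 h3 (by omega))
        ⟨le_rfl, show b - 2 ≤ a - 2 by omega⟩)) ?_
    rw [lower_eq_upper b le_rfl h4 h3 (by omega) le_rfl h3 (by omega)]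
    exact le_of_gen (.piece 1 _ _ ⟨show a' ≤ b by omega, hb⟩)
  · refine le_of_gen (.piece 0 _ _ ⟨?_, ?_⟩)
    · change b' - 2 ≤ b - 2
      omega
    · change a' - 2 ≤ a - 2
      omega

/-- The comparison passes through the cell `(1, 1)`, which is `x_n`. -/
lemma chainNode_le_mainNode (c : Fin k) {a b : ℕ} (h : InShape lam mu a b) (hb : b ≤ 1) :
    chainNode hn lam mu m c ≤ mainNode hn k m h := by
  have h11 : InShape lam mu 1 1 := Or.inl (by omega)
  have h1 : chainNode hn lam mu m c ≤ cellNode 2 (chainCell hn k lam mu 0 (by omega)) :=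
    le_of_gen (.piece 2 _ _ ⟨le_rfl, Nat.zero_le _⟩)
  have h2 : (cellNode 2 (chainCell hn k lam mu 0 (by omega)) : Inset hn k lam mu m)
      = mainNode hn k m h11 := by
    rw [chain_diag _ rfl, mainNode, dif_pos le_rfl, upper_diag _ rfl]
    rfl
  refine h1.trans (h2.le.trans (mainNode_le_mainNode _ _ ?_ hb))
  obtain h | h := h <;> omega

lemma InShape.row_le {a b : ℕ} (h : InShape lam mu a b) : a ≤ p + 1 + lam.part 0 := by
  obtain h | h := h
  · omega
  · have := lam.antitone_part (Nat.zero_le (b - 2))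
    omega

lemma cellNode_le_top (i : Fin 3) (u : ShiftedCell (insetData (p + 1) hn k lam mu i).rows)
    (j : Fin m) : (cellNode i u : Inset hn k lam mu m) ≤ .top j := by
  have hl := row_lt_of_pos_iff (insetData (p + 1) hn k lam mu i).rows_pos_iff u
  let v : ShiftedCell (insetData (p + 1) hn k lam mu i).rows :=
    diagCell (Attachment.rows_pos_iff _) ⟨u.row, hl⟩
  exact le_trans (le_of_gen (.piece i u v ⟨le_rfl, u.row_le_col⟩))
    ((cellNode_diag i v rfl hl).le.trans (le_of_gen (.attach _ _)))

lemma inset_cases (z : Inset hn k lam mu m) :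
    (∃ (a b : ℕ) (h : InShape lam mu a b), z = mainNode hn k m h) ∨
      (∃ c : Fin k, z = chainNode hn lam mu m c) ∨ ∃ j : Fin m, z = .top j := by
  cases z with
  | diag t =>
    have hs : InShape lam mu (p + 1 - t) (p + 1 - t) := Or.inl (by omega)
    refine Or.inl ⟨_, _, hs, ?_⟩
    rw [mainNode_of_le _ _ _ hs le_rfl (by omega) (by omega), upper_diag _ rfl]
    congr 1
    ext
    change (t : ℕ) = p + 1 - (p + 1 - t)
    have : (t : ℕ) < p + 2 := t.isLt
    omega
  | cell i u hu =>
    match i with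
    | 0 =>
      have h1 : u.col < u.row + (lam.part u.row + (p - u.row)) := u.col_lt
      have h2 := lower_row_lt u
      have h3 := u.row_le_col
      have h4 : u.col + 2 ≤ p + 1 + lam.part (u.row + 2 - 2) := by
        rw [Nat.add_sub_cancel]
        omega
      have hs : InShape lam mu (u.col + 2) (u.row + 2) := Or.inr ⟨by omega, by omega, h4⟩
      refine Or.inl ⟨_, _, hs, ?_⟩
      rw [mainNode_of_lt _ _ _ hs (by omega) (by omega) (by omega) (by omega) h4]
      exact (cellNode_off 0 u hu).symm
    | 1 =>
      have h1 : u.col < u.row + (mu.part u.row + (p + 2 - u.row)) := u.col_lt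
      have h2 := upper_row_lt u
      have h3 := u.row_le_col
      have hs : InShape lam mu u.row u.col := Or.inl ⟨by omega, by omega, by omega⟩
      refine Or.inl ⟨_, _, hs, ?_⟩
      rw [mainNode_of_le _ _ _ hs h3 (by omega) (by omega)]
      exact (cellNode_off 1 u hu).symm
    | 2 =>
      have h2 := chain_row_lt u
      have h1 : u.col < u.row + ((if u.row = 0 then k else 0) + (2 - 1 - u.row)) := u.col_lt
      rw [if_pos (by omega)] at h1
      have h3 := u.row_le_col
      refine Or.inr (Or.inl ⟨⟨u.col - 1, by omega⟩, ?_⟩)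
      rw [chainNode, ← cellNode_off 2 u hu]
      congr 1
      refine ShiftedCell.ext ?_ ?_
      · change u.row = 0
        omega
      · change u.col = u.col - 1 + 1
        omega
  | top j => exact Or.inr (Or.inr ⟨j, rfl⟩)

/-- The drawing in the plane determines the order. -/
lemma le_iff_row_col (z w : Inset hn k lam mu m) : z ≤ w ↔ row w ≤ row z ∧ col w ≤ col z := by
  refine ⟨row_col_antitone, fun ⟨hr, hc⟩ => ?_⟩
  obtain ⟨a, b, h, rfl⟩ | ⟨c, rfl⟩ | ⟨j, rfl⟩ := inset_cases z <;>
  obtain ⟨a', b', h', rfl⟩ | ⟨c', rfl⟩ | ⟨j', rfl⟩ := inset_cases w <;>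
  simp only [row_mainNode, col_mainNode, row_chainNode, col_chainNode, row_top, col_top] at hr hc
  · exact mainNode_le_mainNode _ _ (by omega) (by omega)
  · have := h.row_le
    omega
  · unfold mainNode
    split_ifs <;> exact cellNode_le_top _ _ _
  · exact chainNode_le_mainNode _ _ (by omega)
  · exact le_of_gen (.piece 2 _ _ ⟨le_rfl, Nat.succ_le_succ (by omega)⟩)
  · exact cellNode_le_top _ _ _
  · omega
  · omega
  · exact le_of_gen (.topChain _ _ (Fin.le_def.2 (by omega)))

end

end HookInsets

namespace HookInsets

/-! ### Double-tailed diamonds -/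

section Diamond

variable {P : Type*} [PartialOrder P]

/-- What is needed of a `d_k`-interval `[w, z]` with the incomparable elements `x` and `y`. -/
structure IsDiamond (w x y z : P) : Prop where
  bot_le_left : w ≤ x
  bot_le_right : w ≤ y
  left_le_top : x ≤ z
  right_le_top : y ≤ z
  not_left_le : ¬ x ≤ y
  not_right_le : ¬ y ≤ x
  comparable : ∀ u, w ≤ u → u ≤ z → u ≠ x → u ≠ y → (u ≤ x ∧ u ≤ y) ∨ (x ≤ u ∧ y ≤ u)
  card_eq : {u : Set.Icc w z | u.1 ≤ x ∧ u.1 ≤ y}.ncard = {u : Set.Icc w z | x ≤ u.1 ∧ y ≤ u.1}.ncard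

lemma IsDiamond.symm {w x y z : P} (h : IsDiamond w x y z) : IsDiamond w y x z where
  bot_le_left := h.bot_le_right
  bot_le_right := h.bot_le_left
  left_le_top := h.right_le_top
  right_le_top := h.left_le_top
  not_left_le := h.not_right_le
  not_right_le := h.not_left_le
  comparable u h1 h2 h3 h4 := by
    have := h.comparable u h1 h2 h4 h3
    tauto
  card_eq := by simpa only [and_comm] using h.card_eq

lemma DoubleTailedDiamond.le_iff {k : ℕ} (i j : DoubleTailedDiamond k) :
    i ≤ j ↔ (i.pos : ℕ) = j.pos ∨
      ((i.pos : ℕ) < j.pos ∧ ¬ ((i.pos : ℕ) = k - 2 ∧ (j.pos : ℕ) = k - 1)) := by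
  refine or_congr_left ⟨fun h => by rw [h], fun h => ?_⟩
  cases i
  cases j
  congr 1
  exact Fin.ext h

lemma ncard_Icc_int {α : Type*} (S : Set α) (f : α → ℤ) (hf : Set.InjOn f S) (a b : ℤ)
    (h : ∀ c, (∃ u ∈ S, f u = c) ↔ a ≤ c ∧ c ≤ b) : S.ncard = (b + 1 - a).toNat := by
  rw [← hf.ncard_image, ← Int.card_Icc, ← Set.ncard_coe_finset]
  congr 1
  ext c
  simp only [Set.mem_image, Finset.coe_Icc, Set.mem_Icc, h]

section

variable {k : ℕ} {w z : P} (e : Set.Icc w z ≃o DoubleTailedDiamond k)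

lemma orderIso_le_iff (u v : Set.Icc w z) : u.1 ≤ v.1 ↔ ((e u).pos : ℕ) = (e v).pos ∨
    (((e u).pos : ℕ) < (e v).pos ∧ ¬ (((e u).pos : ℕ) = k - 2 ∧ ((e v).pos : ℕ) = k - 1)) := by
  rw [← DoubleTailedDiamond.le_iff, e.le_iff_le]
  rfl

lemma orderIso_pos_injective : Function.Injective fun u : Set.Icc w z => (((e u).pos : ℕ) : ℤ) := by
  intro u v h
  have h1 : ((e u).pos : ℕ) = (e v).pos := by simpa using h
  exact Subtype.ext (le_antisymm ((orderIso_le_iff e u v).2 (Or.inl h1))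
    ((orderIso_le_iff e v u).2 (Or.inl h1.symm)))

lemma isDiamond_of_orderIso (hk : 3 ≤ k) (x y : Set.Icc w z) (hx : ((e x).pos : ℕ) = k - 2)
    (hy : ((e y).pos : ℕ) = k - 1) : IsDiamond w x.1 y.1 z where
  bot_le_left := x.2.1
  bot_le_right := y.2.1
  left_le_top := x.2.2
  right_le_top := y.2.2
  not_left_le h := by
    rw [orderIso_le_iff e] at h
    omega
  not_right_le h := by
    rw [orderIso_le_iff e] at h
    omega
  comparable u h1 h2 h3 h4 := by
    have hx' : ((e ⟨u, h1, h2⟩).pos : ℕ) ≠ (e x).pos := fun h => h3 (by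
      have := orderIso_pos_injective e (a₁ := ⟨u, h1, h2⟩) (a₂ := x) (by simp only [h])
      rw [← this])
    have hy' : ((e ⟨u, h1, h2⟩).pos : ℕ) ≠ (e y).pos := fun h => h4 (by
      have := orderIso_pos_injective e (a₁ := ⟨u, h1, h2⟩) (a₂ := y) (by simp only [h])
      rw [← this])
    have a1 := orderIso_le_iff e ⟨u, h1, h2⟩ x
    have a2 := orderIso_le_iff e ⟨u, h1, h2⟩ y
    have a3 := orderIso_le_iff e x ⟨u, h1, h2⟩
    have a4 := orderIso_le_iff e y ⟨u, h1, h2⟩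
    simp only at a1 a2 a3 a4
    rw [a1, a2, a3, a4]
    omega
  card_eq := by
    -- The tail occupies the positions `0, …, k - 3` and the neck `k, …, 2k - 3`, so both have `k -
    -- 2` elements.
    rw [ncard_Icc_int _ _ (orderIso_pos_injective e).injOn 0 (k - 3),
      ncard_Icc_int _ _ (orderIso_pos_injective e).injOn k (2 * k - 3)]
    · omega
    · intro c
      constructor
      · rintro ⟨u, ⟨h1, h2⟩, rfl⟩
        rw [orderIso_le_iff e] at h1 h2
        have := (e u).pos.isLt
        omega
      · rintro ⟨h1, h2⟩
        refine ⟨e.symm ⟨⟨c.toNat, by omega⟩⟩, ?_, ?_⟩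
        · simp only [Set.mem_ofPred_eq, orderIso_le_iff e, OrderIso.apply_symm_apply]
          omega
        · simp only [OrderIso.apply_symm_apply]
          omega
    · intro c
      constructor
      · rintro ⟨u, ⟨h1, h2⟩, rfl⟩
        rw [orderIso_le_iff e] at h1 h2
        omega
      · rintro ⟨h1, h2⟩
        refine ⟨e.symm ⟨⟨c.toNat, by omega⟩⟩, ?_, ?_⟩
        · simp only [Set.mem_ofPred_eq, orderIso_le_iff e, OrderIso.apply_symm_apply]
          omega
        · simp only [OrderIso.apply_symm_apply]
          omega

lemma exists_sides (hk : 3 ≤ k) : ∃ x y : Set.Icc w z,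
    ((e x).pos : ℕ) = k - 2 ∧ ((e y).pos : ℕ) = k - 1 :=
  ⟨e.symm ⟨⟨k - 2, by omega⟩⟩, e.symm ⟨⟨k - 1, by omega⟩⟩, by simp, by simp⟩

end

lemma InNeck.exists_isDiamond {u : P} (hu : InNeck u) :
    ∃ w x y z, IsDiamond w x y z ∧ x ≤ u ∧ y ≤ u ∧ u ≤ z := by
  obtain ⟨k, hk, w, z, e, hz, hpos⟩ := hu
  obtain ⟨x, y, hx, hy⟩ := exists_sides e hk
  refine ⟨w, x, y, z, isDiamond_of_orderIso e hk x y hx hy, ?_, ?_, hz.2⟩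
  · have := orderIso_le_iff e x ⟨u, hz⟩
    simp only at this
    rw [this]
    omega
  · have := orderIso_le_iff e y ⟨u, hz⟩
    simp only at this
    rw [this]
    omega

lemma inNeck_top {k : ℕ} (hk : 3 ≤ k) {w z : P} (e : Set.Icc w z ≃o DoubleTailedDiamond k) :
    InNeck z := by
  obtain ⟨x, y, hx, hy⟩ := exists_sides e hk
  have hz : z ∈ Set.Icc w z := ⟨x.2.1.trans x.2.2, le_rfl⟩
  refine ⟨k, hk, w, z, e, hz, ?_⟩
  have h1 := (orderIso_le_iff e x ⟨z, hz⟩).1 x.2.2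
  have h2 := (orderIso_le_iff e y ⟨z, hz⟩).1 y.2.2
  omega

/-- A `d_k`-interval from a list of its elements. -/
lemma nonempty_orderIso {k : ℕ} {w z : P} (g : Fin (2 * k - 2) → Set.Icc w z)
    (hg : ∀ i j, g i ≤ g j ↔ (i : ℕ) = j ∨ ((i : ℕ) < j ∧ ¬ ((i : ℕ) = k - 2 ∧ (j : ℕ) = k - 1)))
    (hs : Function.Surjective g) : Nonempty (Set.Icc w z ≃o DoubleTailedDiamond k) := by
  have hinj : Function.Injective g := fun i j h => by
    have h1 := (hg i j).1 h.le
    have h2 := (hg j i).1 h.ge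
    exact Fin.ext (by omega)
  have hf : Function.Bijective fun i : DoubleTailedDiamond k => g i.pos := by
    refine ⟨fun i j h => ?_, fun u => ?_⟩
    · cases i
      cases j
      congr 1
      exact hinj h
    · obtain ⟨i, hi⟩ := hs u
      exact ⟨⟨i⟩, hi⟩
  let e : DoubleTailedDiamond k ≃o Set.Icc w z :=
    { Equiv.ofBijective _ hf with
      map_rel_iff' := fun {i j} => by
        rw [DoubleTailedDiamond.le_iff]
        exact hg _ _ }
  exact ⟨e.symm⟩

end Diamond

end HookInsets

namespace HookInsets

/-! ### Hook lengths of posets that are drawn like insets -/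

/-- A drawing of a poset in the plane: a Young diagram with rows `0, 1, …` and columns `2, 3, …`,
the cells `(0, 1)`, `(1, 1)` and `(0, 0)`, a chain of `k` elements in column `1` below the first
column of the diagram, and `M` elements on the diagonal above `(0, 0)`. The order is the product
order. The row `a` ends in the column `R a` and the column `b` of the diagram has `C b` rows. -/
structure PlanarInset (P : Type*) [PartialOrder P] where
  row : P → ℤ
  col : P → ℤ
  R : ℤ → ℤ
  C : ℤ → ℤ
  M : ℤ
  k : ℤ
  le_iff : ∀ z w, z ≤ w ↔ row w ≤ row z ∧ col w ≤ col z
  exists_iff : ∀ a b, (∃ z, row z = a ∧ col z = b) ↔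
    (0 ≤ a ∧ 2 ≤ b ∧ a < C b) ∨ (b = 1 ∧ (a = 0 ∨ a = 1 ∨ (M + 3 ≤ a ∧ a < M + 3 + k))) ∨
      (a = b ∧ -M ≤ a ∧ a ≤ 0)
  C_two : C 2 = M + 3
  C_anti : ∀ b b', 2 ≤ b → b ≤ b' → C b' ≤ C b
  lt_C_iff : ∀ a b, 0 ≤ a → 2 ≤ b → (a < C b ↔ b ≤ R a)
  M_nonneg : 0 ≤ M
  k_nonneg : 0 ≤ k

namespace PlanarInset

variable {P : Type*} [PartialOrder P] (D : PlanarInset P)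

lemma mem (z : P) : (0 ≤ D.row z ∧ 2 ≤ D.col z ∧ D.row z < D.C (D.col z)) ∨
    (D.col z = 1 ∧ (D.row z = 0 ∨ D.row z = 1 ∨ (D.M + 3 ≤ D.row z ∧ D.row z < D.M + 3 + D.k))) ∨
      (D.row z = D.col z ∧ -D.M ≤ D.row z ∧ D.row z ≤ 0) :=
  (D.exists_iff _ _).1 ⟨z, rfl, rfl⟩

lemma ext {z w : P} (h1 : D.row z = D.row w) (h2 : D.col z = D.col w) : z = w :=
  le_antisymm ((D.le_iff _ _).2 (by omega)) ((D.le_iff _ _).2 (by omega))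

/-- The cells weakly above and to the left of a cell of the diagram belong to the diagram. -/
lemma exists_of_le {z : P} (a b : ℤ) (ha : 0 ≤ a) (hb : 2 ≤ b) (haz : a ≤ D.row z)
    (hbz : b ≤ D.col z) : ∃ u, D.row u = a ∧ D.col u = b := by
  have h1 := D.mem z
  have h2 := D.C_anti b (D.col z) hb hbz
  exact (D.exists_iff a b).2 (Or.inl ⟨ha, hb, by omega⟩)

lemma row_lt {z : P} (hz : 2 ≤ D.col z) : D.row z < D.M + 3 := by
  have h1 := D.mem z
  have h2 := D.C_anti 2 (D.col z) le_rfl hz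
  have h3 := D.C_two
  omega

/-- The `d_k`-intervals of a planar inset: squares, and intervals from the first column of the
diagram to a special element. -/
lemma isDiamond_cases_aux {w x y z : P} (h : IsDiamond w x y z) (hr : D.row x < D.row y) :
    D.row y = D.row x + 1 ∧ D.col x = D.col y + 1 ∧
      ((2 ≤ D.col y ∧ D.row w = D.row y ∧ D.col w = D.col x ∧ D.row z = D.row x ∧
          D.col z = D.col y) ∨
        (D.col y = 1 ∧ D.row x = 0 ∧ D.col w = 2 ∧ 1 ≤ D.row w ∧ D.row z ≤ 0 ∧ D.col z ≤ 1 ∧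
          D.row w = (if D.col z = 1 then 1 else 2) - D.row z)) := by
  obtain ⟨hwx, hwy, hxz, hyz, hxy, hyx, hcomp, hcard⟩ := h
  simp only [D.le_iff] at hwx hwy hxz hyz hxy hyx hcomp
  have hx := D.mem x
  have hy := D.mem y
  have hw := D.mem w
  have hz := D.mem z
  have hM := D.M_nonneg
  have hx2 : 2 ≤ D.col x := by omega
  have hw2 : 2 ≤ D.col w := by omega
  have hwr := D.row_lt hw2
  -- Otherwise the cell to the left of `x` would lie in the interval, above `x` but incomparable to
  -- `y`. Suitable extra cells also exclude the other gaps.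
  have hcol : D.col x = D.col y + 1 := by
    by_contra hne
    obtain ⟨u, hu1, hu2⟩ := D.exists_of_le (z := w) (D.row x) (D.col x - 1) (by omega) (by omega)
      (by omega) (by omega)
    have := hcomp u (by omega) (by omega) (by rintro rfl; omega) (by rintro rfl; omega)
    omega
  have hrow : D.row y = D.row x + 1 := by
    by_contra hne
    obtain ⟨u, hu1, hu2⟩ := D.exists_of_le (z := w) (D.row y - 1) (D.col x) (by omega) (by omega)
      (by omega) (by omega)
    have := hcomp u (by omega) (by omega) (by rintro rfl; omega) (by rintro rfl; omega)
    omega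
  have hwcol : D.col w = D.col x := by
    by_contra hne
    obtain ⟨u, hu1, hu2⟩ := D.exists_of_le (z := w) (D.row x) (D.col x + 1) (by omega) (by omega)
      (by omega) (by omega)
    have := hcomp u (by omega) (by omega) (by rintro rfl; omega) (by rintro rfl; omega)
    omega
  refine ⟨hrow, hcol, ?_⟩
  by_cases hy2 : 2 ≤ D.col y
  · left
    have hwrow : D.row w = D.row y := by
      by_contra hne
      obtain ⟨u, hu1, hu2⟩ := D.exists_of_le (z := w) (D.row y + 1) (D.col y) (by omega) (by omega)
        (by omega) (by omega)
      have := hcomp u (by omega) (by omega) (by rintro rfl; omega) (by rintro rfl; omega)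
      omega
    -- The tail is `w` alone, so the neck has one element. Both `z` and the fourth corner of the
    -- square lie in the neck, hence coincide.
    have h1 : {u : Set.Icc w z | u.1 ≤ x ∧ u.1 ≤ y}.ncard = 1 := by
      rw [Set.ncard_eq_one]
      refine ⟨⟨w, le_rfl, (D.le_iff _ _).2 (by omega)⟩, ?_⟩
      ext ⟨u, hu1, hu2⟩
      simp only [Set.mem_ofPred_eq, Set.mem_singleton_iff, D.le_iff]
      simp only [D.le_iff] at hu1 hu2
      refine ⟨fun h => ?_, fun h => ?_⟩
      · have : u = w := D.ext (by omega) (by omega)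
        exact Subtype.ext this
      · obtain rfl : u = w := congrArg Subtype.val h
        omega
    rw [hcard, Set.ncard_eq_one] at h1
    obtain ⟨v, hv⟩ := h1
    obtain ⟨u, hu1, hu2⟩ := D.exists_of_le (z := w) (D.row x) (D.col y) (by omega) (by omega)
      (by omega) (by omega)
    have e1 : (⟨z, (D.le_iff _ _).2 (by omega), le_rfl⟩ : Set.Icc w z) = v := by
      rw [← Set.mem_singleton_iff, ← hv]
      simp only [Set.mem_ofPred_eq, D.le_iff]
      omega
    have e2 : (⟨u, (D.le_iff _ _).2 (by omega), (D.le_iff _ _).2 (by omega)⟩ : Set.Icc w z) = v := by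
      rw [← Set.mem_singleton_iff, ← hv]
      simp only [Set.mem_ofPred_eq, D.le_iff]
      omega
    have e3 : z = u := congrArg Subtype.val (e1.trans e2.symm)
    rw [e3]
    omega
  · right
    have hcy : D.col y = 1 := by omega
    refine ⟨by omega, by omega, by omega, by omega, by omega, by omega, ?_⟩
    -- On the neck, `s` numbers the elements `(0, 1)`, `(0, 0)`, `(-1, -1)`, … by `1, 2, 3, …`. The
    -- tail is column `2` from row `1` to the row of `w`, so equal cardinalities give `D.row w = s
    -- z`.
    let s : Set.Icc w z → ℤ := fun u => (if D.col u = 1 then 1 else 2) - D.row u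
    rw [ncard_Icc_int _ (fun u : Set.Icc w z => D.row u) ?_ 1 (D.row w),
      ncard_Icc_int _ s ?_ 1 ((if D.col z = 1 then 1 else 2) - D.row z)] at hcard
    · split_ifs at hcard ⊢ <;> omega
    · intro c
      constructor
      · rintro ⟨⟨u, hu1, hu2⟩, ⟨h1, h2⟩, rfl⟩
        have hu := D.mem u
        simp only [D.le_iff] at hu1 hu2 h1 h2
        simp only [s]
        split_ifs <;> omega
      · rintro ⟨h1, h2⟩
        obtain ⟨u, hu1, hu2⟩ := (D.exists_iff (if c = 1 then 0 else 2 - c)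
          (if c = 1 then 1 else 2 - c)).2 (by split_ifs at h2 ⊢ <;> omega)
        have hu3 : D.row u ≤ D.row x ∧ D.col u ≤ D.col y ∧ D.row z ≤ D.row u ∧ D.col z ≤ D.col u := by
          rw [hu1, hu2]
          split_ifs at h2 ⊢ <;> omega
        refine ⟨⟨u, (D.le_iff _ _).2 (by omega), (D.le_iff _ _).2 (by omega)⟩, ?_, ?_⟩
        · simp only [Set.mem_ofPred_eq, D.le_iff]
          omega
        · simp only [s, hu1, hu2]
          split_ifs <;> omega
    · rintro ⟨u, hu1, hu2⟩ ⟨h1, h2⟩ ⟨v, hv1, hv2⟩ ⟨h3, h4⟩ heq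
      have hu := D.mem u
      have hv := D.mem v
      simp only [D.le_iff] at hu1 hu2 h1 h2 hv1 hv2 h3 h4
      simp only [s] at heq
      refine Subtype.ext (D.ext ?_ ?_) <;> simp only <;> split_ifs at heq <;> omega
    · intro c
      constructor
      · rintro ⟨⟨u, hu1, hu2⟩, ⟨h1, h2⟩, rfl⟩
        have hu := D.mem u
        simp only [D.le_iff] at hu1 hu2 h1 h2
        simp only
        omega
      · rintro ⟨h1, h2⟩
        obtain ⟨u, hu1, hu2⟩ := D.exists_of_le (z := w) c 2 (by omega) (by omega)
          (by omega) (by omega)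
        refine ⟨⟨u, (D.le_iff _ _).2 (by omega), (D.le_iff _ _).2 (by omega)⟩, ?_, hu1⟩
        simp only [Set.mem_ofPred_eq, D.le_iff]
        omega
    · rintro ⟨u, hu1, hu2⟩ ⟨h1, h2⟩ ⟨v, hv1, hv2⟩ ⟨h3, h4⟩ heq
      have hu := D.mem u
      have hv := D.mem v
      simp only [D.le_iff] at hu1 hu2 h1 h2 hv1 hv2 h3 h4
      simp only at heq
      exact Subtype.ext (D.ext heq (by simp only; omega))

/-- The elements in the neck of some `d_k`-interval. -/
def Good (z : P) : Prop :=
  (2 ≤ D.col z ∧ D.row z + 1 < D.C (D.col z + 1)) ∨ (D.col z ≤ 1 ∧ D.row z ≤ 0)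

lemma good_of_inNeck {u : P} (hu : InNeck u) : D.Good u := by
  obtain ⟨w, x, y, z, h, hxu, hyu, huz⟩ := hu.exists_isDiamond
  wlog hr : D.row x < D.row y generalizing x y
  · refine this y x h.symm hyu hxu ?_
    have h1 := h.not_left_le
    have h2 := h.not_right_le
    rw [D.le_iff] at h1 h2
    omega
  rw [D.le_iff] at hxu hyu huz
  have hw := D.mem w
  have huu := D.mem u
  obtain ⟨h1, h2, h3⟩ := D.isDiamond_cases_aux h hr
  obtain h3 | h3 := h3
  · left
    have e1 : D.col u + 1 = D.col w := by omega
    rw [e1]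
    omega
  · right
    omega

variable (T : ℤ)

/-- The hook length at a position. The number of elements except the `M` topmost ones is `T`. -/
def hook (a b : ℤ) : ℤ :=
  if 2 ≤ b then D.R a - b + (D.C b - a)
  else if D.M + 3 ≤ a then D.M + 3 + D.k - a
  else T - 1 + ((if b = 1 then 1 else 2) - a) - D.R ((if b = 1 then 1 else 2) - a)

lemma hook_of_two_le (a : ℤ) {b : ℤ} (hb : 2 ≤ b) :
    D.hook T a b = D.R a - b + (D.C b - a) := if_pos hb

lemma hook_of_le_one {a b : ℤ} (hb : b ≤ 1) (ha : a < D.M + 3) :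
    D.hook T a b =
      T - 1 + ((if b = 1 then 1 else 2) - a) - D.R ((if b = 1 then 1 else 2) - a) := by
  rw [hook, if_neg (by omega), if_neg (by omega)]

lemma hook_chain {a : ℤ} (ha : D.M + 3 ≤ a) : D.hook T a 1 = D.M + 3 + D.k - a := by
  rw [hook, if_neg (by omega), if_pos ha]

/-- Inside the diagram the hook is a function of the row plus a function of the column, so it is
additive on squares. For the special element with number `s`, the terms `R 0` and `C 2` cancel
between `(0, 2)`, `(1, 1)` and `(s, 2)`, which leaves `T - 1 + s - R s`. -/
lemma hook_of_isDiamond {w x y z : P} (h : IsDiamond w x y z) :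
    D.hook T (D.row z) (D.col z) =
      D.hook T (D.row x) (D.col x) + D.hook T (D.row y) (D.col y) - D.hook T (D.row w) (D.col w) := by
  wlog hr : D.row x < D.row y generalizing x y
  · rw [this h.symm, add_comm (D.hook T (D.row y) _)]
    have h1 := h.not_left_le
    have h2 := h.not_right_le
    rw [D.le_iff] at h1 h2
    omega
  have hM := D.M_nonneg
  have hw := D.mem w
  obtain ⟨h1, h2, h3⟩ := D.isDiamond_cases_aux h hr
  obtain ⟨h3, h4, h5, h6, h7⟩ | ⟨h3, h4, h5, h6, h7, h8, h9⟩ := h3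
  · rw [h4, h5, h6, h7, h1, h2]
    rw [D.hook_of_two_le T _ h3, D.hook_of_two_le T _ h3, D.hook_of_two_le T _ (by omega),
      D.hook_of_two_le T _ (by omega)]
    omega
  · rw [h1, h2, h3, h4, h5, D.hook_of_le_one T h8 (by omega), ← h9,
      D.hook_of_two_le T _ (by norm_num), D.hook_of_two_le T _ le_rfl,
      D.hook_of_le_one T le_rfl (by omega)]
    norm_num
    omega

end PlanarInset

end HookInsets

namespace HookInsets

/-! ### Existence of the intervals, sizes of principal ideals, and uniqueness of hook lengths. -/

namespace PlanarInset

variable {P : Type*} [PartialOrder P] (D : PlanarInset P)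

/-- A `d_k`-interval from the positions of its elements. -/
lemma nonempty_orderIso {k : ℕ} {w z : P} (r c : ℕ → ℤ)
    (hmem : ∀ i, i < 2 * k - 2 → ∃ u, D.row u = r i ∧ D.col u = c i)
    (hIcc : ∀ i, i < 2 * k - 2 → (r i ≤ D.row w ∧ c i ≤ D.col w) ∧ (D.row z ≤ r i ∧ D.col z ≤ c i))
    (hle : ∀ i j, i < 2 * k - 2 → j < 2 * k - 2 →
      ((r j ≤ r i ∧ c j ≤ c i) ↔ i = j ∨ (i < j ∧ ¬ (i = k - 2 ∧ j = k - 1))))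
    (hs : ∀ u, w ≤ u → u ≤ z → ∃ i, i < 2 * k - 2 ∧ D.row u = r i ∧ D.col u = c i) :
    Nonempty (Set.Icc w z ≃o DoubleTailedDiamond k) := by
  choose g hg1 hg2 using hmem
  have hg3 (i : ℕ) (hi : i < 2 * k - 2) : g i hi ∈ Set.Icc w z := by
    rw [Set.mem_Icc, D.le_iff, D.le_iff, hg1, hg2]
    exact hIcc i hi
  refine HookInsets.nonempty_orderIso (fun i => ⟨g i i.isLt, hg3 i i.isLt⟩) ?_ ?_
  · intro i j
    rw [Subtype.mk_le_mk, D.le_iff, hg1, hg2, hg1, hg2]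
    exact hle i j i.isLt j.isLt
  · rintro ⟨u, hu1, hu2⟩
    obtain ⟨i, hi, h1, h2⟩ := hs u hu1 hu2
    exact ⟨⟨i, hi⟩, Subtype.ext (D.ext ((hg1 i hi).trans h1.symm) ((hg2 i hi).trans h2.symm))⟩

/-- In the diagram the interval is a unit square. The special element with number `s` is the top of
an interval with bottom `(s, 2)`; here `s ≤ M + 2`, and column `2` has exactly the rows `0, …, M +
2`. -/
lemma exists_interval_of_good {z : P} (hz : D.Good z) :
    ∃ k, 3 ≤ k ∧ ∃ w, Nonempty (Set.Icc w z ≃o DoubleTailedDiamond k) := by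
  have hm := D.mem z
  have hM := D.M_nonneg
  have hk := D.k_nonneg
  have hC := D.C_two
  obtain ⟨h1, h2⟩ | ⟨h1, h2⟩ := hz
  · obtain ⟨w, hw1, hw2⟩ := (D.exists_iff (D.row z + 1) (D.col z + 1)).2 (Or.inl (by omega))
    refine ⟨3, le_rfl, w, ?_⟩
    refine D.nonempty_orderIso (fun i => if i = 0 ∨ i = 2 then D.row z + 1 else D.row z)
      (fun i => if i = 0 ∨ i = 1 then D.col z + 1 else D.col z) ?_ ?_ ?_ ?_
    · intro i hi
      exact D.exists_of_le (z := w) _ _ (by split_ifs <;> omega) (by split_ifs <;> omega)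
        (by split_ifs <;> omega) (by split_ifs <;> omega)
    · intro i hi
      split_ifs <;> omega
    · intro i j hi hj
      interval_cases i <;> interval_cases j <;> norm_num
    · intro u hu1 hu2
      rw [D.le_iff] at hu1 hu2
      by_cases ha : D.row u = D.row z <;> by_cases hb : D.col u = D.col z
      · exact ⟨3, by omega, by simp [ha, hb]⟩
      · exact ⟨1, by omega, by simp [ha]; omega⟩
      · exact ⟨2, by omega, by simp [hb]; omega⟩
      · exact ⟨0, by omega, by simp; omega⟩
  · obtain ⟨s, hs⟩ : ∃ s : ℕ, (s : ℤ) = (if D.col z = 1 then 1 else 2) - D.row z :=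
      ⟨((if D.col z = 1 then 1 else 2) - D.row z).toNat, Int.toNat_of_nonneg (by split_ifs <;> omega)⟩
    have hs1 : 1 ≤ s ∧ (s : ℤ) ≤ D.M + 2 := by split_ifs at hs <;> omega
    have hzr : D.row z = if s = 1 then 0 else 2 - (s : ℤ) := by split_ifs at hs ⊢ <;> omega
    have hzc : D.col z = if s = 1 then 1 else 2 - (s : ℤ) := by split_ifs at hs ⊢ <;> omega
    obtain ⟨w, hw1, hw2⟩ := (D.exists_iff s 2).2 (Or.inl (by omega))
    refine ⟨s + 2, by omega, w, ?_⟩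
    -- The list climbs column `2` from row `s` to `(0, 2)`, which has index `k - 2`, continues with
    -- the incomparable `(1, 1)`, and ends with `(0, 1)`, `(0, 0)`, `(-1, -1)` and so on.
    refine D.nonempty_orderIso
      (fun i => if i ≤ s then (s - i : ℤ) else if i = s + 1 then 1 else if i = s + 2 then 0
        else (s + 3 - i : ℤ))
      (fun i => if i ≤ s then 2 else if i = s + 1 then 1 else if i = s + 2 then 1
        else (s + 3 - i : ℤ)) ?_ ?_ ?_ ?_
    · intro i hi
      rw [D.exists_iff]
      split_ifs <;> omega
    · intro i hi
      split_ifs at hzr hzc ⊢ <;> omega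
    · intro i j hi hj
      split_ifs <;> omega
    · intro u hu1 hu2
      rw [D.le_iff] at hu1 hu2
      have hu := D.mem u
      by_cases hu3 : D.col u = 2
      · refine ⟨(s - D.row u).toNat, by omega, ?_⟩
        split_ifs at hzr hzc ⊢ <;> omega
      · refine ⟨(s + 1 + ((if D.col u = 1 then 1 else 2) - D.row u)).toNat, ?_, ?_⟩
        · split_ifs at hzr hzc ⊢ <;> omega
        · split_ifs at hzr hzc ⊢ <;> omega

/-- Since the cell diagonally below and to the right is missing, the principal ideal is just the arm
and the leg of `z`. -/
lemma card_Iic_of_two_le {z : P} (hz : 2 ≤ D.col z) (h : ¬ D.Good z) :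
    (Nat.card (Set.Iic z) : ℤ) = D.R (D.row z) - D.col z + (D.C (D.col z) - D.row z) := by
  have hm := D.mem z
  have hR := D.lt_C_iff (D.row z) (D.col z) (by omega) hz
  simp only [Good, not_or, not_and, not_lt, not_le] at h
  have h1 := h.1 hz
  let S : Finset (ℤ × ℤ) := (Finset.Icc (D.col z) (D.R (D.row z))).map
      ⟨fun b => (D.row z, b), Prod.mk_right_injective _⟩ ∪
    (Finset.Ioo (D.row z) (D.C (D.col z))).map
      ⟨fun a => (a, D.col z), Prod.mk_left_injective _⟩
  have hS : (fun u => (D.row u, D.col u)) '' Set.Iic z = S := by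
    ext ⟨a, b⟩
    simp only [Set.mem_image, Set.mem_Iic, D.le_iff, Prod.mk.injEq, S, Finset.coe_union,
      Finset.coe_map, Function.Embedding.coeFn_mk, Set.mem_union, Finset.coe_Icc, Set.mem_Icc,
      Finset.coe_Ioo, Set.mem_Ioo]
    constructor
    · rintro ⟨u, hu, rfl, rfl⟩
      have hmu := D.mem u
      have hu2 := D.lt_C_iff (D.row u) (D.col u) (by omega) (by omega)
      by_cases h3 : D.row u = D.row z
      · rw [h3] at hu2
        exact Or.inl ⟨D.col u, by omega, h3.symm, rfl⟩
      · by_cases h4 : D.col u = D.col z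
        · rw [h4] at hmu
          exact Or.inr ⟨D.row u, by omega, rfl, h4.symm⟩
        · have := D.C_anti (D.col z + 1) (D.col u) (by omega) (by omega)
          omega
    · rintro (⟨b, hb, rfl, rfl⟩ | ⟨a, ha, rfl, rfl⟩)
      · obtain ⟨u, hu1, hu2⟩ := (D.exists_iff (D.row z) b).2
          (Or.inl ⟨by omega, by omega, (D.lt_C_iff _ _ (by omega) (by omega)).2 hb.2⟩)
        exact ⟨u, by omega, hu1, hu2⟩
      · obtain ⟨u, hu1, hu2⟩ := (D.exists_iff a (D.col z)).2 (Or.inl (by omega))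
        exact ⟨u, by omega, hu1, hu2⟩
  have hinj : Set.InjOn (fun u => (D.row u, D.col u)) (Set.Iic z) := fun u _ v _ huv =>
    D.ext (congrArg Prod.fst huv) (congrArg Prod.snd huv)
  rw [Nat.card_coe_set_eq, ← hinj.ncard_image, hS, Set.ncard_coe_finset, Finset.card_union_of_disjoint,
    Finset.card_map, Finset.card_map, Int.card_Icc, Int.card_Ioo]
  · omega
  · rw [Finset.disjoint_left]
    rintro ⟨a, b⟩ h3 h4
    simp only [Finset.mem_map, Finset.mem_Icc, Function.Embedding.coeFn_mk, Prod.mk.injEq,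
      Finset.mem_Ioo] at h3 h4
    obtain ⟨b', h5, h6, h7⟩ := h3
    obtain ⟨a', h8, h9, h10⟩ := h4
    omega

lemma card_Iic_chain {z : P} (hz : D.col z = 1) (h : D.M + 3 ≤ D.row z) :
    (Nat.card (Set.Iic z) : ℤ) = D.M + 3 + D.k - D.row z := by
  have hM := D.M_nonneg
  have hm := D.mem z
  have h2 {u : P} (hu : u ≤ z) : D.col u = 1 := by
    rw [D.le_iff] at hu
    by_contra hc
    have := D.row_lt (z := u) (by omega)
    omega
  rw [Nat.card_coe_set_eq, ncard_Icc_int (Set.Iic z) D.row ?_ (D.row z) (D.M + 2 + D.k)]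
  · omega
  · intro c
    constructor
    · rintro ⟨u, hu, rfl⟩
      have h3 := h2 hu
      have hmu := D.mem u
      rw [Set.mem_Iic, D.le_iff] at hu
      omega
    · intro hc
      obtain ⟨u, hu1, hu2⟩ := (D.exists_iff c 1).2 (by omega)
      refine ⟨u, ?_, hu1⟩
      rw [Set.mem_Iic, D.le_iff]
      omega
  · intro u hu v hv huv
    exact D.ext huv ((h2 hu).trans (h2 hv).symm)

/-- The complement of the ideal of `(1, 1)` consists of row `0` and the top chain; its columns are
the integers from `-M` to `R 0`, each once. -/
lemma card_Iic_one [Finite P] {z : P} (hr : D.row z = 1) (hc : D.col z = 1) :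
    (Nat.card (Set.Iic z) : ℤ) = Nat.card P - D.M - 1 - D.R 0 := by
  have hM := D.M_nonneg
  have hC := D.C_two
  have hR := D.lt_C_iff 0 2 le_rfl le_rfl
  have h1 : (Set.Iic z)ᶜ.ncard = (D.R 0 + 1 - (-D.M)).toNat := by
    refine ncard_Icc_int _ D.col ?_ _ _ ?_
    · intro u hu v hv huv
      have hmu := D.mem u
      have hmv := D.mem v
      rw [Set.mem_compl_iff, Set.mem_Iic, D.le_iff] at hu hv
      exact D.ext (by omega) huv
    · intro c
      constructor
      · rintro ⟨u, hu, rfl⟩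
        have hmu := D.mem u
        rw [Set.mem_compl_iff, Set.mem_Iic, D.le_iff] at hu
        by_cases h2 : 2 ≤ D.col u
        · have h3 := D.lt_C_iff 0 (D.col u) le_rfl h2
          omega
        · omega
      · rintro ⟨h2, h3⟩
        by_cases h4 : 2 ≤ c
        · obtain ⟨u, hu1, hu2⟩ := (D.exists_iff 0 c).2
            (Or.inl ⟨le_rfl, h4, (D.lt_C_iff 0 c le_rfl h4).2 h3⟩)
          refine ⟨u, ?_, hu2⟩
          rw [Set.mem_compl_iff, Set.mem_Iic, D.le_iff]
          omega
        · obtain ⟨u, hu1, hu2⟩ := (D.exists_iff (min c 0) c).2 (by omega)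
          refine ⟨u, ?_, hu2⟩
          rw [Set.mem_compl_iff, Set.mem_Iic, D.le_iff]
          omega
  have h2 := Set.ncard_add_ncard_compl (Set.Iic z)
  rw [Nat.card_coe_set_eq]
  omega

lemma card_Iic_of_not_good [Finite P] {z : P} (h : ¬ D.Good z) :
    (Nat.card (Set.Iic z) : ℤ) = D.hook (Nat.card P - D.M) (D.row z) (D.col z) := by
  have hm := D.mem z
  have hM := D.M_nonneg
  by_cases h2 : 2 ≤ D.col z
  · rw [D.card_Iic_of_two_le h2 h, D.hook_of_two_le _ _ h2]
  · have h3 : D.col z = 1 ∧ 1 ≤ D.row z := by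
      simp only [Good] at h
      omega
    by_cases h4 : D.row z = 1
    · rw [D.card_Iic_one h4 h3.1, h4, h3.1, D.hook_of_le_one _ le_rfl (by omega)]
      norm_num
    · rw [D.card_Iic_chain h3.1 (by omega), h3.1, D.hook_chain _ (by omega)]

/-- For the special element with number `i` this follows from `R i ≤ R 0`, because `T - 1 - R 0` is
the size of the ideal of `(1, 1)`. -/
lemma hook_nonneg [Finite P] (z : P) :
    0 ≤ D.hook (Nat.card P - D.M) (D.row z) (D.col z) := by
  have hm := D.mem z
  have hM := D.M_nonneg
  have hC := D.C_two
  by_cases h2 : 2 ≤ D.col z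
  · have := D.lt_C_iff (D.row z) (D.col z) (by omega) h2
    rw [D.hook_of_two_le _ _ h2]
    omega
  · by_cases h4 : D.M + 3 ≤ D.row z
    · rw [show D.col z = 1 by omega, D.hook_chain _ h4]
      omega
    · rw [D.hook_of_le_one _ (by omega) (by omega)]
      obtain ⟨v, hv1, hv2⟩ := (D.exists_iff 1 1).2 (by omega)
      have h5 := D.card_Iic_one hv1 hv2
      obtain ⟨i, hi⟩ : ∃ i, i = (if D.col z = 1 then 1 else 2) - D.row z := ⟨_, rfl⟩
      rw [← hi]
      have hi1 : 0 ≤ i ∧ i < D.M + 3 := by split_ifs at hi <;> omega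
      have h6 := D.lt_C_iff i 2 hi1.1 le_rfl
      have h7 := D.lt_C_iff i (D.R i) hi1.1 (by omega)
      have h8 := D.lt_C_iff 0 (D.R i) le_rfl (by omega)
      omega

/-- The hook lengths of a planar inset. -/
theorem isHookLength_iff [Finite P] (h : P → ℕ) :
    IsHookLength h ↔ ∀ z, (h z : ℤ) = D.hook (Nat.card P - D.M) (D.row z) (D.col z) := by
  constructor
  · intro hh z
    induction z using WellFoundedLT.induction with
    | ind z ih =>
      by_cases hz : D.Good z
      · obtain ⟨k, hk, w, ⟨e⟩⟩ := D.exists_interval_of_good hz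
        obtain ⟨x, y, hx, hy⟩ := exists_sides e hk
        have hd := isDiamond_of_orderIso e hk x y hx hy
        have hxz : x.1 < z := hd.left_le_top.lt_of_ne fun he => hd.not_right_le (by
          rw [he]
          exact hd.right_le_top)
        have hyz : y.1 < z := hd.right_le_top.lt_of_ne fun he => hd.not_left_le (by
          rw [he]
          exact hd.left_le_top)
        rw [hh.of_interval k hk w z e x y hx hy, ih _ hxz, ih _ hyz, ih _ (hd.bot_le_left.trans_lt hxz),
          D.hook_of_isDiamond _ hd]
      · rw [hh.of_not_inNeck z fun hn => hz (D.good_of_inNeck hn), D.card_Iic_of_not_good hz]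
  · intro hh
    refine ⟨fun z hz => ?_, fun k hk w z e x y hx hy => ?_⟩
    · have h1 : ¬ D.Good z := fun hg => by
        obtain ⟨k, hk, w, ⟨e⟩⟩ := D.exists_interval_of_good hg
        exact hz (inNeck_top hk e)
      exact_mod_cast (hh z).trans (D.card_Iic_of_not_good h1).symm
    · rw [hh, hh, hh, hh]
      exact D.hook_of_isDiamond _ (isDiamond_of_orderIso e hk x y hx hy)

theorem existsUnique_isHookLength (D : PlanarInset P) [Finite P] : ∃! h : P → ℕ, IsHookLength h := by
  refine ⟨fun z => (D.hook (Nat.card P - D.M) (D.row z) (D.col z)).toNat,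
    (D.isHookLength_iff _).2 fun z => Int.toNat_of_nonneg (D.hook_nonneg z), fun h hh => ?_⟩
  ext z
  have := (D.isHookLength_iff h).1 hh z
  omega

end PlanarInset

end HookInsets

namespace HookInsets

/-! ### Conjugate partitions -/

/-- The number of the parts `ν 0, …, ν (N - 1)` that exceed `c`. -/
def conj (ν : ℕ → ℕ) (N c : ℕ) : ℕ := ∑ j ∈ Finset.range N, if c < ν j then 1 else 0

lemma conj_le (ν : ℕ → ℕ) (N c : ℕ) : conj ν N c ≤ N := by
  calc conj ν N c ≤ ∑ j ∈ Finset.range N, 1 := Finset.sum_le_sum fun j _ => by split_ifs <;> omega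
    _ = N := by simp

lemma conj_of_lt {ν : ℕ → ℕ} (hν : Antitone ν) (a N : ℕ) {c : ℕ} (hc : c < ν a) :
    conj ν (a + 1 + N) c = a + 1 + conj (fun j => ν (a + 1 + j)) N c := by
  rw [conj, Finset.sum_range_add, conj]
  congr 1
  calc ∑ j ∈ Finset.range (a + 1), (if c < ν j then 1 else 0)
      = ∑ j ∈ Finset.range (a + 1), 1 := Finset.sum_congr rfl fun j hj => by
        have := hν (show j ≤ a by simpa [Nat.lt_succ_iff] using hj)
        rw [if_pos (by omega)]
    _ = a + 1 := by simp

lemma conj_of_le {ν : ℕ → ℕ} (hν : Antitone ν) (N : ℕ) {c : ℕ} (hc : ν 0 ≤ c) : conj ν N c = 0 :=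
  Finset.sum_eq_zero fun j _ => if_neg (by have := hν (Nat.zero_le j); omega)

lemma Par.lt_conj_iff {N : ℕ} (l : Par N) (j c : ℕ) : j < conj l.part N c ↔ c < l.part j := by
  have h1 : conj l.part N c = ((Finset.range N).filter fun i => c < l.part i).card := by
    rw [conj, Finset.card_filter]
  rw [h1]
  constructor
  · intro h
    by_contra hc
    have : ((Finset.range N).filter fun i => c < l.part i) ⊆ Finset.range j := by
      intro i hi
      rw [Finset.mem_filter] at hi
      by_contra hij
      have := l.antitone_part (show j ≤ i by simpa using hij)
      omega
    have := Finset.card_le_card this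
    rw [Finset.card_range] at this
    omega
  · intro h
    have : Finset.range (j + 1) ⊆ ((Finset.range N).filter fun i => c < l.part i) := by
      intro i hi
      rw [Finset.mem_range] at hi
      have h2 := l.antitone_part (show i ≤ j by omega)
      rw [Finset.mem_filter, Finset.mem_range]
      refine ⟨?_, by omega⟩
      by_contra h3
      have := l.part_eq_zero i (by omega)
      omega
    have := Finset.card_le_card this
    rw [Finset.card_range] at this
    omega

section

variable {M : Type*} [CommMonoid M]

/-- The numbers `ν_j + N - 1 - j` and `N + c - ν'_c` for `c < L` are the numbers below `L + N`. -/
lemma prod_mul_prod_conj (f : ℕ → M) (N : ℕ) (ν : ℕ → ℕ) (hν : Antitone ν) (L : ℕ) (hL : ν 0 ≤ L) :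
    (∏ j ∈ Finset.range N, f (ν j + (N - 1 - j))) *
      ∏ c ∈ Finset.range L, f (N + c - conj ν N c) = ∏ i ∈ Finset.range (L + N), f i := by
  induction N generalizing ν L with
  | zero => simp [conj]
  | succ N ih =>
    have hν' : Antitone fun j => ν (j + 1) := fun a b hab => hν (by omega)
    -- The largest part gives the value `ν 0 + N`. Columns `c ≥ ν 0` are empty and give the values
    -- above it, and the columns below `ν 0` are those of the remaining parts with one row more.
    have h := ih (fun j => ν (j + 1)) hν' (ν 0) (hν (by omega))
    obtain ⟨L, rfl⟩ := Nat.exists_eq_add_of_le hL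
    rw [Finset.prod_range_succ', Finset.prod_range_add _ (ν 0),
      Finset.prod_congr rfl (g := fun j => f (ν (j + 1) + (N - 1 - j)))
        fun j hj => by rw [show N + 1 - 1 - (j + 1) = N - 1 - j by omega],
      Finset.prod_congr (s₁ := Finset.range (ν 0)) rfl
        (g := fun c => f (N + c - conj (fun j => ν (j + 1)) N c)) fun c hc => ?_,
      Finset.prod_congr (s₁ := Finset.range L) rfl (g := fun c => f (ν 0 + N + 1 + c)) fun c hc => ?_]
    · calc _ = ((∏ j ∈ Finset.range N, f (ν (j + 1) + (N - 1 - j))) *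
              ∏ c ∈ Finset.range (ν 0), f (N + c - conj (fun j => ν (j + 1)) N c)) *
            f (ν 0 + (N + 1 - 1 - 0)) * ∏ c ∈ Finset.range L, f (ν 0 + N + 1 + c) := by
            ac_rfl
        _ = _ := by
          rw [h, show ν 0 + L + (N + 1) = ν 0 + N + 1 + L by omega,
            Finset.prod_range_add _ (ν 0 + N + 1), Finset.prod_range_succ]
          simp
    · rw [conj_of_le hν _ (by omega)]
      congr 1
      omega
    · have h1 := conj_of_lt hν 0 N (show c < ν 0 by simpa using hc)
      rw [show N + 1 = 0 + 1 + N by omega, h1]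
      simp only [zero_add, add_comm 1]
      congr 1
      omega

/-- The hook lengths of a row, together with the differences to the later exponents. -/
lemma prod_row_hooks (f : ℕ → M) (N : ℕ) (ν : ℕ → ℕ) (hν : Antitone ν) (a : ℕ) (ha : a < N) :
    (∏ j ∈ Finset.Ioo a N, f (ν a + (N - 1 - a) - (ν j + (N - 1 - j)))) *
      ∏ c ∈ Finset.range (ν a), f (ν a - 1 - c + (conj ν N c - a)) =
        ∏ i ∈ Finset.range (ν a + (N - 1 - a)), f (i + 1) := by
  obtain ⟨K, rfl⟩ := Nat.exists_eq_add_of_le (show a + 1 ≤ N from ha)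
  have hν' : Antitone fun j => ν (a + 1 + j) := fun i j hij => hν (by omega)
  -- The complement identity is applied to the `K` parts after `a`, with the values reflected in the
  -- exponent `ν a + K` of row `a`.
  have h := prod_mul_prod_conj (fun i => f (ν a + K - i)) K (fun j => ν (a + 1 + j)) hν' (ν a)
    (hν (by omega))
  rw [show a + 1 + K - 1 - a = K by omega,
    ← Finset.prod_range_reflect (fun i => f (i + 1)),
    Finset.prod_congr (s₁ := Finset.range (ν a + K)) rfl (g := fun i => f (ν a + K - i))
      fun i hi => by
        rw [Finset.mem_range] at hi
        rw [show ν a + K - 1 - i + 1 = ν a + K - i by omega], ← h]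
  congr 1
  · rw [show Finset.Ioo a (a + 1 + K) = Finset.Ico (a + 1) (a + 1 + K) from rfl,
      Finset.prod_Ico_eq_prod_range, show a + 1 + K - (a + 1) = K by omega]
    refine Finset.prod_congr rfl fun j hj => ?_
    rw [show a + 1 + K - 1 - (a + 1 + j) = K - 1 - j by omega]
  · refine Finset.prod_congr rfl fun c hc => ?_
    rw [Finset.mem_range] at hc
    have h1 := conj_le (fun j => ν (a + 1 + j)) K c
    rw [conj_of_lt hν a K hc]
    congr 1
    omega

end

/-! ### The drawing of an inset -/

section

variable {p : ℕ} (lam : Par p) (mu : Par (p + 2))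

/-- The last column of a row of an inset. -/
def rowEnd (a : ℕ) : ℕ :=
  if a ≤ p + 1 then p + 1 + mu.part a else 1 + conj lam.part p (a - p - 2)

/-- The number of cells of a column of the diagram of an inset. -/
def colLen (b : ℕ) : ℕ :=
  if b ≤ p + 1 then p + 2 + lam.part (b - 2) else conj mu.part (p + 2) (b - p - 2)

lemma lt_colLen_iff (a : ℕ) {b : ℕ} (hb : 2 ≤ b) : a < colLen lam mu b ↔ b ≤ rowEnd lam mu a := by
  unfold colLen rowEnd
  split_ifs with h1 h2 h2
  · omega
  · have := lam.lt_conj_iff (b - 2) (a - p - 2)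
    omega
  · have := mu.lt_conj_iff a (b - p - 2)
    omega
  · have := conj_le mu.part (p + 2) (b - p - 2)
    have := conj_le lam.part p (a - p - 2)
    omega

lemma colLen_antitone {b b' : ℕ} (hb : 2 ≤ b) (hbb : b ≤ b') :
    colLen lam mu b' ≤ colLen lam mu b := by
  by_contra h
  rw [not_le, lt_colLen_iff _ _ _ (by omega)] at h
  have := (lt_colLen_iff lam mu (colLen lam mu b) hb).2 (by omega)
  omega

variable {lam mu} in
lemma inShape_iff {a b : ℕ} (hb : 2 ≤ b) : InShape lam mu a b ↔ a < colLen lam mu b := by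
  unfold InShape colLen
  split_ifs with h1
  · by_cases h2 : a ≤ b <;> omega
  · have h2 := mu.lt_conj_iff a (b - p - 2)
    have h3 := conj_le mu.part (p + 2) (b - p - 2)
    have h4 : lam.part (b - 2) = 0 := lam.part_eq_zero _ (by omega)
    omega

lemma exists_mainNode (hn : 2 ≤ p + 1) (k m : ℕ) {a b : ℕ} (h : InShape lam mu a b) :
    ∃ z : Inset hn k lam mu m, row z = a ∧ col z = b :=
  ⟨mainNode hn k m h, row_mainNode h, col_mainNode h⟩

/-- The drawing of an inset in the plane. -/
def drawing (hn : 2 ≤ p + 1) (k : ℕ) :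
    PlanarInset (Inset hn k lam mu (lam.part 0 + (p + 1 - 2))) where
  row := row
  col := col
  R a := rowEnd lam mu a.toNat
  C b := colLen lam mu b.toNat
  M := (lam.part 0 + (p + 1 - 2) : ℕ)
  k := k
  le_iff := le_iff_row_col
  exists_iff a b := by
    constructor
    · rintro ⟨z, rfl, rfl⟩
      obtain ⟨a, b, h, rfl⟩ | ⟨c, rfl⟩ | ⟨j, rfl⟩ := inset_cases z
      · rw [row_mainNode, col_mainNode]
        by_cases hb : 2 ≤ b
        · have := (inShape_iff hb).1 h
          rw [Int.toNat_natCast]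
          omega
        · unfold InShape at h
          omega
      · rw [row_chainNode, col_chainNode]
        omega
      · rw [row_top, col_top]
        omega
    · rintro (⟨ha, hb, h⟩ | ⟨rfl, h⟩ | ⟨rfl, h⟩)
      · obtain ⟨z, h1, h2⟩ := exists_mainNode lam mu hn k (lam.part 0 + (p + 1 - 2))
          ((inShape_iff (a := a.toNat) (b := b.toNat) (by omega)).2 (by omega))
        exact ⟨z, by omega, by omega⟩
      · by_cases h1 : a ≤ 1
        · obtain ⟨z, h1, h2⟩ := exists_mainNode lam mu hn k (lam.part 0 + (p + 1 - 2))
            (a := a.toNat) (b := 1) (Or.inl (by omega))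
          exact ⟨z, by omega, by omega⟩
        · refine ⟨chainNode hn lam mu _ ⟨(a - (lam.part 0 + p + 2)).toNat, by omega⟩, ?_,
            col_chainNode _⟩
          rw [row_chainNode]
          simp only
          omega
      · by_cases h1 : 0 ≤ a
        · obtain ⟨z, h1, h2⟩ := exists_mainNode lam mu hn k (lam.part 0 + (p + 1 - 2))
            (a := 0) (b := 0) (Or.inl (by omega))
          exact ⟨z, by omega, by omega⟩
        · refine ⟨.top ⟨(-a - 1).toNat, by omega⟩, ?_, ?_⟩
          · rw [row_top]
            simp only
            omega
          · rw [col_top]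
            simp only
            omega
  C_two := by
    change ((colLen lam mu 2 : ℕ) : ℤ) = _
    rw [colLen, if_pos (by omega)]
    simp only [Nat.sub_self]
    omega
  C_anti b b' h1 h2 := by
    have := colLen_antitone lam mu (b := b.toNat) (b' := b'.toNat) (by omega) (by omega)
    exact_mod_cast this
  lt_C_iff a b ha hb := by
    have := lt_colLen_iff lam mu a.toNat (b := b.toNat) (by omega)
    omega
  M_nonneg := Int.natCast_nonneg _
  k_nonneg := Int.natCast_nonneg _

end

end HookInsets

namespace HookInsets

/-! ### The product of the hook lengths -/

/-- After exchanging the order of the first product, this is `prod_row_hooks` applied to each row.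
-/
lemma Par.prod_hooks {M : Type*} [CommMonoid M] {d : ℕ} (l : Par d) (f : ℕ → M) :
    (∏ j, ∏ i ∈ Finset.univ.filter (· < j), f (l.exps i - l.exps j)) *
      ∏ a : Fin d, ∏ c ∈ Finset.range (l.part a), f (l.part a - 1 - c + (conj l.part d c - a)) =
        ∏ j, ∏ i ∈ Finset.range (l.exps j), f (i + 1) := by
  rw [Finset.prod_comm' (t' := Finset.univ) (s' := fun i => Finset.univ.filter (i < ·))
    (by simp), ← Finset.prod_mul_distrib]
  refine Finset.prod_congr rfl fun a _ => ?_
  refine Eq.trans ?_ (prod_row_hooks f d l.part l.antitone_part a a.isLt)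
  congr 1
  refine Finset.prod_bij (fun j _ => (j : ℕ)) ?_ ?_ ?_ fun _ _ => rfl
  · intro j hj
    simpa using hj
  · intro j _ j' _ h
    exact Fin.ext h
  · intro j hj
    rw [Finset.mem_Ioo] at hj
    exact ⟨⟨j, hj.2⟩, by
      rw [Finset.mem_filter]
      exact ⟨Finset.mem_univ _, hj.1⟩, rfl⟩

section

variable {p : ℕ} (lam : Par p) (mu : Par (p + 2))

/-- The positions of the elements of an inset. -/
def position (k m : ℕ) :
    Fin (m + 3) ⊕ (Fin (p + 2) × Fin p) ⊕ (Σ a : Fin (p + 2), Fin (mu.part a)) ⊕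
      (Σ b : Fin p, Fin (lam.part b)) ⊕ Fin k → ℤ × ℤ
  | .inl i => (if (i : ℕ) ≤ 1 then 1 - (i : ℕ) else 2 - (i : ℕ), if (i : ℕ) ≤ 1 then 1 else 2 - (i : ℕ))
  | .inr (.inl (a, b)) => ((a : ℕ), (b : ℕ) + 2)
  | .inr (.inr (.inl ⟨a, c⟩)) => ((a : ℕ), p + 2 + (c : ℕ))
  | .inr (.inr (.inr (.inl ⟨b, c⟩))) => (p + 2 + (c : ℕ), (b : ℕ) + 2)
  | .inr (.inr (.inr (.inr c))) => (lam.part 0 + p + 2 + (c : ℕ), 1)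

lemma exists_position (hn : 2 ≤ p + 1) {k m : ℕ} (s) :
    ∃ z : Inset hn k lam mu m, (row z, col z) = position lam mu k m s := by
  rcases s with i | ⟨a, b⟩ | ⟨a, c⟩ | ⟨b, c⟩ | c
  · by_cases h : (i : ℕ) ≤ 2
    · obtain ⟨z, h1, h2⟩ := exists_mainNode lam mu hn k m
        (a := if (i : ℕ) ≤ 1 then 1 - i else 0) (b := if (i : ℕ) ≤ 1 then 1 else 0)
        (Or.inl (by split_ifs <;> omega))
      refine ⟨z, ?_⟩
      rw [h1, h2]
      refine Prod.ext ?_ ?_ <;> simp only [position] <;> split_ifs <;> omega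
    · refine ⟨.top ⟨i - 3, by omega⟩, ?_⟩
      rw [row_top, col_top]
      refine Prod.ext ?_ ?_ <;> simp only [position] <;> split_ifs <;> omega
  · obtain ⟨z, h1, h2⟩ := exists_mainNode lam mu hn k m (a := a) (b := b + 2) (by
      unfold InShape
      omega)
    exact ⟨z, by rw [h1, h2]; rfl⟩
  · obtain ⟨z, h1, h2⟩ := exists_mainNode lam mu hn k m (a := a) (b := p + 2 + c)
      (Or.inl (by omega))
    exact ⟨z, by rw [h1, h2]; rfl⟩
  · obtain ⟨z, h1, h2⟩ := exists_mainNode lam mu hn k m (a := p + 2 + c) (b := b + 2)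
      (Or.inr (by rw [Nat.add_sub_cancel]; omega))
    exact ⟨z, by rw [h1, h2]; rfl⟩
  · refine ⟨chainNode hn lam mu m c, ?_⟩
    rw [row_chainNode, col_chainNode]
    rfl

lemma position_injective {k m : ℕ} : Function.Injective (position lam mu k m) := by
  have hl (b : Fin p) : lam.part b ≤ lam.part 0 := lam.antitone_part (Nat.zero_le _)
  rintro (i | ⟨a, b⟩ | ⟨a, c⟩ | ⟨b, c⟩ | c) (i' | ⟨a', b'⟩ | ⟨a', c'⟩ | ⟨b', c'⟩ | c') h
  all_goals simp only [position, Prod.mk.injEq] at h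
  all_goals obtain ⟨h1, h2⟩ := h
  all_goals try (exfalso; omega)
  · congr 1
    ext
    split_ifs at h1 h2 <;> omega
  · obtain rfl : a = a' := Fin.ext (by omega)
    obtain rfl : b = b' := Fin.ext (by omega)
    rfl
  · obtain rfl : a = a' := Fin.ext (by omega)
    obtain rfl : c = c' := Fin.ext (by omega)
    rfl
  · obtain rfl : b = b' := Fin.ext (by omega)
    obtain rfl : c = c' := Fin.ext (by omega)
    rfl
  · obtain rfl : c = c' := Fin.ext (by omega)
    rfl

lemma position_surjective (hn : 2 ≤ p + 1) {k m : ℕ} (z : Inset hn k lam mu m) :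
    ∃ s, position lam mu k m s = (row z, col z) := by
  obtain ⟨a, b, h, rfl⟩ | ⟨c, rfl⟩ | ⟨j, rfl⟩ := inset_cases z
  · rw [row_mainNode, col_mainNode]
    by_cases hb : b ≤ 1
    · refine ⟨.inl ⟨if b = 1 then 1 - a else 2, by split_ifs <;> omega⟩, ?_⟩
      unfold InShape at h
      refine Prod.ext ?_ ?_ <;> simp only [position] <;> split_ifs <;> omega
    · have hlow := fun hba => h.lower_col_le (a := a) (b := b) hba
      by_cases ha : a ≤ p + 1
      · by_cases hb2 : b ≤ p + 1
        · refine ⟨.inr (.inl (⟨a, by omega⟩, ⟨b - 2, by omega⟩)), ?_⟩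
          refine Prod.ext rfl ?_
          simp only [position]
          omega
        · have h1 : b - (p + 2) < mu.part a := by
            unfold InShape at h
            omega
          refine ⟨.inr (.inr (.inl ⟨⟨a, by omega⟩, ⟨b - (p + 2), h1⟩⟩)), ?_⟩
          refine Prod.ext rfl ?_
          simp only [position]
          omega
      · have h1 : a - (p + 2) < lam.part (b - 2) := by
          unfold InShape at h
          omega
        have h2 : b - 2 < p := by
          unfold InShape at h
          omega
        refine ⟨.inr (.inr (.inr (.inl ⟨⟨b - 2, h2⟩, ⟨a - (p + 2), h1⟩⟩))), ?_⟩
        refine Prod.ext ?_ ?_ <;> simp only [position] <;> omega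
  · refine ⟨.inr (.inr (.inr (.inr c))), ?_⟩
    rw [row_chainNode, col_chainNode]
    rfl
  · refine ⟨.inl ⟨j + 3, by omega⟩, ?_⟩
    rw [row_top, col_top]
    refine Prod.ext ?_ ?_ <;> simp only [position] <;> split_ifs <;> omega

lemma prod_inset {M : Type*} [CommMonoid M] (hn : 2 ≤ p + 1) {k m : ℕ} (F : ℤ × ℤ → M) :
    ∏ z : Inset hn k lam mu m, F (row z, col z) =
      (∏ i ∈ Finset.range (m + 3),
        F (if i ≤ 1 then 1 - i else 2 - i, if i ≤ 1 then 1 else 2 - i)) *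
      ((∏ a : Fin (p + 2), ∏ b : Fin p, F ((a : ℕ), (b : ℕ) + 2)) *
      ((∏ a : Fin (p + 2), ∏ c ∈ Finset.range (mu.part a), F ((a : ℕ), p + 2 + c)) *
      ((∏ b : Fin p, ∏ c ∈ Finset.range (lam.part b), F (p + 2 + c, (b : ℕ) + 2)) *
        ∏ c ∈ Finset.range k, F (lam.part 0 + p + 2 + c, 1)))) := by
  choose g hg using exists_position lam mu hn (k := k) (m := m)
  have hbij : Function.Bijective g := by
    refine ⟨fun s t hst => position_injective lam mu ?_, fun z => ?_⟩
    · rw [← hg, ← hg, hst]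
    · obtain ⟨s, hs⟩ := position_surjective lam mu hn z
      have h1 := (hg s).trans hs
      rw [Prod.mk.injEq] at h1
      exact ⟨s, le_antisymm ((le_iff_row_col _ _).2 ⟨h1.1.ge, h1.2.ge⟩)
        ((le_iff_row_col _ _).2 ⟨h1.1.le, h1.2.le⟩)⟩
  rw [← hbij.prod_comp, Finset.prod_congr rfl fun s _ => congrArg F (hg s)]
  rw [Fintype.prod_sum_type, Fintype.prod_sum_type, Fintype.prod_sum_type, Fintype.prod_sum_type,
    Fintype.prod_prod_type, Fintype.prod_sigma, Fintype.prod_sigma, Finset.prod_range,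
    Finset.prod_range (n := k)]
  simp only [Finset.prod_range]
  rfl

end

end HookInsets

namespace HookInsets

/-! ### Comparison of the hook product with the generating function. -/

section

variable {p : ℕ} {lam : Par p} {mu : Par (p + 2)}

lemma card_inset_zero (hn : 2 ≤ p + 1) (k : ℕ) :
    Fintype.card (Inset hn k lam mu 0) =
      ∑ i, mu.exps i + (∑ a, lam.exps a + p + 1 + k) + 1 := by
  have h : ∑ i, ∑ a, (insetData (p + 1) hn k lam mu i).shape.exps a =
      ∑ a, lam.exps a + ∑ i, mu.exps i + k := by
    rw [Fin.sum_univ_three]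
    change (∑ a : Fin p, lam.exps a) + (∑ a : Fin (p + 2), mu.exps a) +
      (∑ a : Fin 1, (Par.single k).exps a) = _
    simp [Par.exps, Par.single, staircase]
  rw [card_node, h]
  omega

/-- The product of the values of a function at the hook lengths. -/
lemma prod_hook {M : Type*} [CommMonoid M] (hn : 2 ≤ p + 1) (k : ℕ) (f : ℕ → M) (T : ℕ) (hT : 1 ≤ T) :
    ∏ z : Inset hn k lam mu (lam.part 0 + (p + 1 - 2)),
        f ((drawing lam mu hn k).hook T (row z) (col z)).toNat =
      ((∏ j, f (T - 1 - mu.exps j)) *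
        ∏ c ∈ Finset.range (lam.part 0), f (T + (p + c - conj lam.part p c))) *
      ((∏ i, ∏ a, f (mu.exps i + lam.exps a + 1)) *
      ((∏ a : Fin (p + 2), ∏ c ∈ Finset.range (mu.part a),
          f (mu.part a - 1 - c + (conj mu.part (p + 2) c - a))) *
      ((∏ b : Fin p, ∏ c ∈ Finset.range (lam.part b),
          f (lam.part b - 1 - c + (conj lam.part p c - b))) *
        ∏ c ∈ Finset.range k, f (c + 1)))) := by
  set D := drawing lam mu hn k
  have hDM : D.M = lam.part 0 + p - 1 := by
    change ((lam.part 0 + (p + 1 - 2) : ℕ) : ℤ) = _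
    omega
  have hR (a : ℕ) : D.R a = rowEnd lam mu a := rfl
  have hC (b : ℕ) : D.C b = colLen lam mu b := rfl
  have hk : D.k = k := rfl
  rw [prod_inset lam mu hn fun x => f (D.hook T x.1 x.2).toNat]
  simp only
  congr 1
  · rw [show lam.part 0 + (p + 1 - 2) + 3 = (p + 2) + lam.part 0 by omega, Finset.prod_range_add]
    -- The special elements, starting with `(1, 1)` as number `0`, are as many as the rows of the
    -- diagram. The first `p + 2` meet rows ending in `p + 1 + mu.part i`, the other `lam.part 0`
    -- rows that are governed by the conjugate of `lam`.
    have h1 (i : ℕ) (hi : i < p + 2 + lam.part 0) :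
        D.hook T (if i ≤ 1 then 1 - i else 2 - i) (if i ≤ 1 then 1 else 2 - i) =
          T - 1 + i - rowEnd lam mu i := by
      rw [D.hook_of_le_one _ (by split_ifs <;> omega) (by split_ifs <;> omega)]
      have h2 : ((if (if i ≤ 1 then (1 : ℤ) else 2 - i) = 1 then (1 : ℤ) else 2) -
          (if i ≤ 1 then (1 : ℤ) - i else 2 - i)) = i := by split_ifs <;> omega
      rw [h2, hR]
    congr 1
    · rw [Finset.prod_range]
      refine Finset.prod_congr rfl fun j _ => ?_
      rw [h1 j (by omega), rowEnd, if_pos (by omega), Par.exps, staircase]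
      congr 1
      omega
    · refine Finset.prod_congr rfl fun c hc => ?_
      rw [Finset.mem_range] at hc
      have h3 := conj_le lam.part p c
      rw [h1 _ (by omega), rowEnd, if_neg (by omega), show p + 2 + c - p - 2 = c by omega]
      congr 1
      omega
  · congr 1
    · refine Finset.prod_congr rfl fun a _ => Finset.prod_congr rfl fun b _ => ?_
      rw [D.hook_of_two_le _ _ (by omega), hR, show ((b : ℕ) + 2 : ℤ) = ((b + 2 : ℕ) : ℤ) by simp, hC,
        rowEnd, colLen, if_pos (by omega), if_pos (by omega), Nat.add_sub_cancel, Par.exps,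
        Par.exps, staircase, staircase]
      congr 1
      omega
    congr 1
    · refine Finset.prod_congr rfl fun a _ => Finset.prod_congr rfl fun c hc => ?_
      rw [Finset.mem_range] at hc
      have h1 := (mu.lt_conj_iff a c).2 hc
      rw [D.hook_of_two_le _ _ (by omega), hR, show ((p : ℤ) + 2 + c) = ((p + 2 + c : ℕ) : ℤ) by simp,
        hC, rowEnd, colLen, if_pos (by omega), if_neg (by omega),
        show p + 2 + c - p - 2 = c by omega]
      congr 1
      omega
    congr 1
    · refine Finset.prod_congr rfl fun b _ => Finset.prod_congr rfl fun c hc => ?_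
      rw [Finset.mem_range] at hc
      have h1 := (lam.lt_conj_iff b c).2 hc
      rw [D.hook_of_two_le _ _ (by omega), show ((b : ℕ) + 2 : ℤ) = ((b + 2 : ℕ) : ℤ) by simp, hC,
        show ((p : ℤ) + 2 + c) = ((p + 2 + c : ℕ) : ℤ) by simp,
        hR, rowEnd, colLen, if_neg (by omega), if_pos (by omega), Nat.add_sub_cancel,
        show p + 2 + c - p - 2 = c by omega]
      congr 1
      omega
    · rw [← Finset.prod_range_reflect]
      refine Finset.prod_congr rfl fun c hc => ?_
      rw [Finset.mem_range] at hc
      rw [D.hook_chain _ (by omega), hDM, hk]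
      congr 1
      omega

/-- For `mu` (index `1`) and `lam` (index `2`), `V` is the product over exponent differences, `C`
the cell hooks outside the rectangle, `Q` the `q`-factorials. `A₁` and `A₂` are the special
elements, `B` the rectangle, `K` the chain below `x_n`, `L` the numerator of `diagTotal` with `T`,
`t` stands for `1 - q ^ T`, and `U` for the top chain factors. -/
lemma inset_product_identity {e V₁ V₂ C₁ C₂ Q₁ Q₂ A₁ A₂ B K L t U : ℝ} (he : e ≠ 0) (hQ₁ : Q₁ ≠ 0)
    (hQ₂ : Q₂ ≠ 0) (hB : B ≠ 0) (hK : K ≠ 0) (ht : t ≠ 0) (hA₁ : A₁ ≠ 0) (hU : U ≠ 0)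
    (h₁ : V₁ * C₁ = Q₁) (h₂ : V₂ * C₂ = Q₂) (h₃ : L * A₂ = U * t) :
    1 / (A₁ * A₂ * (B * (C₁ * (C₂ * K)))) =
      e * (V₁ * V₂ * L) / (B * A₁ * t) / (e * (Q₁ * Q₂ * K)) / U := by
  subst h₁ h₂
  have h₄ : L * A₂ ≠ 0 := by
    rw [h₃]
    exact mul_ne_zero hU ht
  obtain ⟨hV₁, hC₁⟩ := mul_ne_zero_iff.1 hQ₁
  obtain ⟨hV₂, hC₂⟩ := mul_ne_zero_iff.1 hQ₂
  obtain ⟨hL, hA₂⟩ := mul_ne_zero_iff.1 h₄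
  field_simp
  linear_combination -h₃

theorem inset_hasHookLengthProperty (hn : 2 ≤ p + 1) (k : ℕ) :
    HasHookLengthProperty (Inset hn k lam mu (lam.part 0 + (p + 1 - 2))) := by
  set m := lam.part 0 + (p + 1 - 2) with hm
  let D := drawing lam mu hn k
  refine ⟨D.existsUnique_isHookLength, fun h hh q hq hq1 => ?_⟩
  set T := Fintype.card (Inset hn k lam mu 0) with hT
  have hT' := card_inset_zero (lam := lam) (mu := mu) hn k
  rw [← hT] at hT'
  have hcard : (Nat.card (Inset hn k lam mu m) : ℤ) - D.M = T := by
    have h1 : Fintype.card (Inset hn k lam mu m) = T + m := by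
      rw [hT, card_node, card_node, add_zero]
    rw [Nat.card_eq_fintype_card, h1]
    change ((T + m : ℕ) : ℤ) - (m : ℕ) = T
    omega
  have hval (z : Inset hn k lam mu m) : h z = (D.hook T (row z) (col z)).toNat := by
    have := (D.isHookLength_iff h).1 hh z
    rw [hcard] at this
    change (h z : ℤ) = D.hook T (row z) (col z) at this
    omega
  have hne : ∀ n : ℕ, n ≠ 0 → 1 - q ^ n ≠ 0 := fun n hn =>
    sub_ne_zero.2 (pow_lt_one₀ hq.le hq1 hn).ne'
  have hS := hasSum_ppartition hq hq1 (hasSum_inset_zero (lam := lam) (mu := mu) (k := k) hn hq hq1) m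
  have hprod := prod_hook (lam := lam) (mu := mu) hn k (fun i => 1 - q ^ i) T (by omega)
  have h1 := mu.prod_hooks fun i => 1 - q ^ i
  have h2 := lam.prod_hooks fun i => 1 - q ^ i
  -- The complement has `lam.part 0 + p = m + 1` values. The value `0` accounts for `1 - q ^ T` in
  -- the denominator of `diagTotal`, and the other `m` are exactly the factors of the top chain.
  have h3 := prod_mul_prod_conj (fun i => 1 - q ^ (T + i)) p lam.part lam.antitone_part
    (lam.part 0) le_rfl
  rw [show lam.part 0 + p = m + 1 by omega, Finset.prod_range_succ', Finset.prod_range] at h3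
  have h4 : ∏ z, 1 / (1 - q ^ h z) =
      1 / ∏ z : Inset hn k lam mu m, (1 - q ^ (D.hook T (row z) (col z)).toNat) := by
    simp only [hval, one_div, Finset.prod_inv_distrib]
  rw [h4, hprod]
  convert hS using 1
  have hfac {m : ℕ} : ∏ i ∈ Finset.range m, (1 - q ^ (i + 1)) ≠ 0 :=
    Finset.prod_ne_zero_iff.2 fun i _ => hne _ (Nat.succ_ne_zero i)
  have e1 : ∏ j, (1 - q ^ (T - 1 - mu.exps j)) =
      ∏ j, (1 - q ^ (∑ i, mu.exps i - mu.exps j + (∑ a, lam.exps a + p + 1 + k))) := by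
    refine Finset.prod_congr rfl fun j _ => ?_
    have := Finset.single_le_sum (fun i _ => Nat.zero_le (mu.exps i)) (Finset.mem_univ j)
    congr 2
    omega
  rw [diagTotal, insetDenom, e1, ← hT, ← hT']
  have e2 : ∏ i : Fin p, (1 - q ^ (T + (lam.part i + (p - 1 - i)))) =
      ∏ a, (1 - q ^ (T + lam.exps a)) := rfl
  rw [e2] at h3
  simp only [add_zero, ← add_assoc] at h3
  refine inset_product_identity (pow_pos hq _).ne' ?_ ?_ ?_ hfac (hne T (by omega)) ?_ ?_ h1 h2 h3
  · exact Finset.prod_ne_zero_iff.2 fun j _ => hfac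
  · exact Finset.prod_ne_zero_iff.2 fun j _ => hfac
  · exact Finset.prod_ne_zero_iff.2 fun i _ => Finset.prod_ne_zero_iff.2 fun a _ =>
      hne _ (Nat.succ_ne_zero _)
  · exact Finset.prod_ne_zero_iff.2 fun j _ => hne _ (by omega)
  · exact Finset.prod_ne_zero_iff.2 fun j _ => hne _ (by omega)

end

end HookInsets

theorem mainTheorem5 (n : ℕ) (hn : 2 ≤ n) (k : ℕ)
    (lam : HookInsets.Par (n - 1)) (mu : HookInsets.Par (n + 1)) :
    HookInsets.HasHookLengthProperty (HookInsets.InsetPoset n hn k lam mu) ∧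
    ∀ q : ℝ, 0 < q → q < 1 →
      HookInsets.insetIntegral q n k lam mu =
        (-1) * q ^ (∑ i ∈ Finset.range n, ((i + 2) * lam.part i + (i + 1) * mu.part (i + 1))
              + n * (n - 1) * (2 * n + 5) / 6 + 1 + k) * (1 - q) ^ (n + 1)
          / (∏ i ∈ Finset.range (n + 1),
              (1 - q ^ (lam.size + mu.size - mu.part i + n * (n - 1) + k + (i + 1))))
          * ((∏ j ∈ Finset.range (n - 1),
                (1 - q ^ (lam.size + mu.size + lam.part j + n ^ 2 + n - (j + 1) + k + 1)))
              / (1 - q ^ (lam.size + mu.size + n ^ 2 + k + 2)))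
          * (((∏ j ∈ Finset.range (n + 1), ∏ i ∈ Finset.range j,
                  (1 - q ^ (mu.part i - mu.part j + (j - i))))
                * ∏ j ∈ Finset.range (n - 1), ∏ i ∈ Finset.range j,
                  (1 - q ^ (lam.part i - lam.part j + (j - i))))
              / ∏ i ∈ Finset.range (n + 1), ∏ j ∈ Finset.range (n - 1),
                  (1 - q ^ (mu.part i + lam.part j + 2 * n - (i + 1) - (j + 1) + 1))) := by
  obtain ⟨p, rfl⟩ : ∃ p, n = p + 1 := ⟨n - 1, by omega⟩
  exact ⟨HookInsets.inset_hasHookLengthProperty hn k,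
    fun q hq hq1 => HookInsets.insetIntegral_formula hq hq1 k lam mu⟩
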